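/- **Theorem 3.** Let $\mathcal T=[a,b]$ with $-\infty<a<b<\infty$. Along a sequence of sample sizes $n_1,\dots,n_k\ge 2$ with $n=\sum_{i=1}^k n_i\to\infty$, let $y_{i1},\dots,y_{in_i}$, $i=1,\dots,k$, be $k$ independent functional samples on $\mathcal T$, those of the $i$-th sample being i.i.d. (jointly measurable) processes with mean function $\eta_i\in\mathcal L^2(\mathcal T)$ and covariance function $\gamma_i=\gamma_{i}^{(n)}$. Assume * (A1) the processes $y_{ij}$ are Gaussian; * (A2) $n_i/n\to\tau_i\in(0,1)$, $i=1,\dots,k$; * (A3) the functions $\gamma_i(s,t)$ are uniformly bounded; and the local alternative $$\gamma_i(s,t)=\gamma(s,t)+(n_i-1)^{-1/2}d_i(s,t),\qquad i=1,\dots,k, \tag{3.1}$$ where $\gamma$ is a covariance function and $d_1,\dots,d_k$ are functions on $\mathcal T^2$, with $\gamma$ and the $d_i$ independent of $n$. With $\bar y_i=n_i^{-1}\sum_j y_{ij}$, let $$\hat\gamma_i(s,t)=\frac1{n_i-1}\sum_{j=1}^{n_i}[y_{ij}(s)-\bar y_i(s)][y_{ij}(t)-\bar y_i(t)],\qquad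 \hat\gamma=\frac{\sum_{i=1}^k(n_i-1)\hat\gamma_i}{n-k},$$ $$T_n=\sum_{i=1}^k(n_i-1)\int_{\mathcal T}\int_{\mathcal T}[\hat\gamma_i(s,t)-\hat\gamma(s,t)]^2\,ds\,dt .$$ Let $\varpi[(s_1,t_1),(s_2,t_2)]=\gamma(s_1,s_2)\gamma(t_1,t_2)+\gamma(s_1,t_2)\gamma(s_2,t_1)$. Let $(\phi_r)_{r\ge1}$ be a complete orthonormal system of $\mathcal L^2(\mathcal T^2)$ consisting of eigenfunctions of the integral operator with kernel $\varpi$, and $\lambda_r$ the associated eigenvalues (repeated according to multiplicity, the eigenvalue $0$ included, enumerated in any order). Let $\mathbf b=(\sqrt{\tau_1},\dots,\sqrt{\tau_k})^T$, let $\mathbf U$ be an orthogonal matrix with $\mathbf I_k-\mathbf b\mathbf b^T=\mathbf U\,\mathrm{diag}(1,\dots,1,0)\,\mathbf U^T$, and put $$\tilde{\mathbf d}(s,t)=[\mathbf I_{k-1},\mathbf 0]\,\mathbf U^T(d_1(s,t),\dots,d_k(s,t))^T,\qquad \delta_r^2=\Big\|\int_{\mathcal T}\int_{\mathcal T}\tilde{\mathbf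 d}(s,t)\phi_r(s,t)\,ds\,dt\Big\|^2 .$$ Then $\varpi$ is the pointwise limit of the covariance functions of $\sqrt{n-k}\,[\hat\gamma(s,t)-\gamma(s,t)]$, all $\lambda_r$ are nonnegative, and $$T_n\xrightarrow{d}T_1,\qquad T_1\overset{d}{=}\sum_{r:\,\lambda_r>0}\lambda_rA_r+\sum_{r:\,\lambda_r=0}\delta_r^2,$$ where the $A_r$ (for $\lambda_r>0$) are independent with $A_r\sim\chi^2_{k-1}(\lambda_r^{-1}\delta_r^2)$, the noncentral chi-squared law with $k-1$ degrees of freedom and noncentrality parameter $\lambda_r^{-1}\delta_r^2$; the first series converges almost surely and the second converges. In particular, if exactly $m<\infty$ eigenvalues are positive and they are listed first, then $T_1\overset d=\sum_{r=1}^m\lambda_rA_r+\sum_{r=m+1}^\infty\delta_r^2$. -/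

import Mathlib

open MeasureTheory ProbabilityTheory Filter Topology

attribute [local instance] MeasureTheory.Measure.Subtype.measureSpace

noncomputable section

namespace ECF

/-- Sample mean function of one functional sample `y_1, …, y_n`. -/
def sampleMean {T Ω : Type*} {n : ℕ} (y : Fin n → T → Ω → ℝ) (t : T) (ω : Ω) : ℝ :=
  (n : ℝ)⁻¹ * ∑ j, y j t ω

/-- Unbiased sample covariance function of one functional sample. -/
def sampleCov {T Ω : Type*} {n : ℕ} (y : Fin n → T → Ω → ℝ) (s t : T) (ω : Ω) : ℝ :=
  ((n : ℝ) - 1)⁻¹ *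
    ∑ j, (y j s ω - sampleMean y s ω) * (y j t ω - sampleMean y t ω)

/-- Pooled sample covariance function of `k` functional samples of sizes `N 0, …, N (k-1)`. -/
def pooledCov {T Ω : Type*} {k : ℕ} {N : Fin k → ℕ} (y : (i : Fin k) → Fin (N i) → T → Ω → ℝ)
    (s t : T) (ω : Ω) : ℝ :=
  (∑ i, ((N i : ℝ) - 1) * sampleCov (y i) s t ω) / ((∑ i, (N i : ℝ)) - k)

/-- The `L²`-norm based test statistic `T_n`. -/
def testStat {T Ω : Type*} [MeasureSpace T] {k : ℕ} {N : Fin k → ℕ}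
    (y : (i : Fin k) → Fin (N i) → T → Ω → ℝ) (ω : Ω) : ℝ :=
  ∑ i, ((N i : ℝ) - 1) * ∫ s, ∫ t, (sampleCov (y i) s t ω - pooledCov y s t ω) ^ 2

/-- The `k`-sample model: all the curves `y i j` are independent (jointly measurable) second order
processes, and those of the `i`-th sample are identically distributed with mean function `η i` and
covariance function `γ i`. -/
structure IsSample {T Ω : Type*} [MeasurableSpace T] [MeasurableSpace Ω] (P : Measure Ω) {k : ℕ}
    {N : Fin k → ℕ} (y : (i : Fin k) → Fin (N i) → T → Ω → ℝ) (η : Fin k → T → ℝ)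
    (γ : Fin k → T → T → ℝ) : Prop where
  measurable : ∀ i j, Measurable (fun x : T × Ω => y i j x.1 x.2)
  indep : iIndepFun (fun (ij : (i : Fin k) × Fin (N i)) ω t => y ij.1 ij.2 t ω) P
  identDistrib : ∀ i j j', IdentDistrib (fun ω t => y i j t ω) (fun ω t => y i j' t ω) P P
  memLp : ∀ i j t, MemLp (y i j t) 2 P
  mean : ∀ i j t, ∫ ω, y i j t ω ∂P = η i t
  cov : ∀ i j s t, cov[y i j s, y i j t; P] = γ i s t

/-- `γ` is a covariance function: symmetric and positive semidefinite. -/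
def IsCovFun {T : Type*} (γ : T → T → ℝ) : Prop :=
  (∀ s t, γ s t = γ t s) ∧
    ∀ (I : Finset T) (c : T → ℝ), 0 ≤ ∑ s ∈ I, ∑ t ∈ I, c s * c t * γ s t

/-- The function `ϖ[(s₁,t₁),(s₂,t₂)] = γ(s₁,s₂) γ(t₁,t₂) + γ(s₁,t₂) γ(s₂,t₁)`. -/
def varpi {T : Type*} (γ : T → T → ℝ) (p q : T × T) : ℝ :=
  γ p.1 q.1 * γ p.2 q.2 + γ p.1 q.2 * γ q.1 p.2

/-- `φ 0, φ 1, …` is a complete orthonormal system of `L²(T × T)` made of eigenfunctions of the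
integral operator with kernel `K`, with associated eigenvalues `lam 0, lam 1, …` (repeated
according to multiplicity, the eigenvalue `0` included, in any order). -/
def IsEigensystem {T : Type*} [MeasureSpace T] (K : T × T → T × T → ℝ) (lam : ℕ → ℝ)
    (φ : HilbertBasis ℕ ℝ (Lp ℝ 2 (volume : Measure (T × T)))) : Prop :=
  ∀ r, ∀ᵐ p : T × T, ∫ q, K p q * φ r q = lam r * φ r p

/-- The limit matrix `W = I - b bᵀ` with `b = (√τ_1, …, √τ_k)ᵀ`. -/
def limitW {k : ℕ} (τ : Fin k → ℝ) : Matrix (Fin k) (Fin k) ℝ :=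
  1 - Matrix.vecMulVec (fun i => √(τ i)) (fun i => √(τ i))

/-- The diagonal matrix with diagonal `(1, …, 1, 0)`. -/
def diagOneZero (k : ℕ) : Matrix (Fin k) (Fin k) ℝ :=
  Matrix.diagonal fun i => if (i : ℕ) + 1 < k then 1 else 0

/-- The rotated deviation `d̃ = [I_{k-1}, 0] Uᵀ d`. -/
def rotatedDev {T : Type*} {k : ℕ} (U : Matrix (Fin k) (Fin k) ℝ) (d : Fin k → T → T → ℝ)
    (l : Fin (k - 1)) (p : T × T) : ℝ :=
  (U.transpose.mulVec fun i => d i p.1 p.2) (Fin.castLE (Nat.sub_le k 1) l)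

/-- `δ² = ‖∫∫ d̃(s,t) φ(s,t) ds dt‖²`. -/
def deltaSq {T : Type*} [MeasureSpace T] {k : ℕ} (U : Matrix (Fin k) (Fin k) ℝ)
    (d : Fin k → T → T → ℝ) (φ : T × T → ℝ) : ℝ :=
  ∑ l : Fin (k - 1), (∫ p, rotatedDev U d l p * φ p) ^ 2

/-- The noncentral chi-squared law with `m` degrees of freedom and noncentrality parameter `c`:
the law of `Z_1² + ⋯ + Z_m²` for independent unit variance normal `Z_l` with mean vector
`(√c, 0, …, 0)`. -/
def noncentralChiSq (m : ℕ) (c : ℝ) : Measure ℝ :=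
  (Measure.pi fun l : Fin m => gaussianReal (if (l : ℕ) = 0 then √c else 0) 1).map
    fun z => ∑ l, z l ^ 2

end ECF

end

set_option linter.unusedSectionVars false

/-! Put z_i = √(n_i − 1)(γ̂_i − γ), and let b_n be the unit vector with entries √((n_i − 1)/(n −
k)). The pooled estimator is a weighted mean of the γ̂_i, so the scaled residuals form the vector z
− b_n⟨b_n, z⟩ and T_n is the integral of |z|² − ⟨b_n, z⟩². Moreover z_i = v_i + d_i − r_i. Here v_i
(`sumDev`) is a normalized sum of independent centred processes with covariance kernel `varpi` of
γ_i, a Gaussian fourth moment computation, and r_i (`meanDev`) is due to the sample mean and has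
second moments O(1/n_i). Dropping r_i and replacing b_n by its limit b costs o(1) in L¹
(`tendsto_integral_abs_testStat_sub`). What remains is the quadratic form I − bbᵀ at v + d, that is,
the squared norm of the first k − 1 coordinates of Uᵀ(v + d) (`rotatedSum`).

In the basis φ, finitely many coefficients of these k − 1 functions converge jointly to independent
normals with means ∫ d̃_l φ_r and variances λ_r (`tendsto_integral_exp_coeff`). This follows from a
Lyapunov type bound on characteristic functions (`norm_integral_exp_sum_sub_le`), the rotation being
orthogonal and φ diagonalizing the kernel. Summing squares over l gives λ_r times a noncentral
chi-squared variable, or the constant δ_r² when λ_r = 0.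

Truncation is controlled by expectations alone, without tightness in a function space. The energy
outside the first R basis functions is nonnegative, and its expectation tends to a tail of Σ_r (λ_r
+ (∫ d̃_l φ_r)²), summed over l (`exists_tendsto_integral_abs_sub_truncation`). The tail is small
because Σ λ_r = ∫ ϖ(p, p) dp (`hasSum_eigenvalue`). As γ need not be continuous, Mercer's theorem is
not used: the trace formula holds for each `varpi (Γ ν i)` by Parseval in expectation for an actual
process, and it passes to ϖ because ϖ is a linear combination of three such kernels.

The covariance claim uses the same decomposition: the pooled fluctuation is ⟨b_n, z⟩, the v_i are
uncorrelated across samples, and the squared entries of b_n sum to 1. -/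

namespace ECF

/-! ### Moments of Gaussian vectors -/

section GaussianMoments

lemma integral_pow_four_gaussianReal_zero_one : ∫ x, x ^ 4 ∂(gaussianReal 0 1) = 3 := by
  have h := iteratedDeriv_mgf_zero (X := id) (μ := gaussianReal 0 1) (by simp) 4
  have e0 : mgf id (gaussianReal 0 1) = fun t => Real.exp (t ^ 2 / 2) := by
    rw [mgf_id_gaussianReal]; simp
  -- Differentiation preserves the shape polynomial times exp(t²/2), so four applications give the
  -- fourth moment.
  have hd : ∀ (p q : ℝ → ℝ), (∀ t, HasDerivAt p (q t) t) →
      deriv (fun t => p t * Real.exp (t ^ 2 / 2)) =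
        fun t => (q t + p t * t) * Real.exp (t ^ 2 / 2) := by
    intro p q hp
    ext t
    have h1 : HasDerivAt (fun t : ℝ => Real.exp (t ^ 2 / 2)) (Real.exp (t ^ 2 / 2) * t) t := by
      have : HasDerivAt (fun t : ℝ => t ^ 2 / 2) t t := by
        simpa using ((hasDerivAt_pow 2 t).div_const 2)
      exact this.exp
    rw [((hp t).fun_mul h1).deriv]; ring
  have d1 : deriv (fun t : ℝ => Real.exp (t ^ 2 / 2)) = fun t => t * Real.exp (t ^ 2 / 2) := by
    have := hd (fun _ => 1) (fun _ => 0) (fun t => hasDerivAt_const t 1)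
    simpa using this
  have d2 := hd (fun t => t) (fun _ => 1) (fun t => hasDerivAt_id t)
  have d3 := hd (fun t => 1 + t * t) (fun t => 2 * t) (fun t => by
    have := ((hasDerivAt_id t).mul (hasDerivAt_id t)).const_add 1
    convert! this using 1; simp; ring)
  have d4 := hd (fun t => 2 * t + (1 + t * t) * t) (fun t => 3 + 3 * t ^ 2) (fun t => by
    have := ((hasDerivAt_id t).const_mul 3).add (hasDerivAt_pow 3 t)
    convert! this using 1
    · ext s; simp; ring
    · simp)
  rw [e0, iteratedDeriv_succ', d1, iteratedDeriv_succ', d2, iteratedDeriv_succ', d3,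
    iteratedDeriv_succ', d4] at h
  simp at h
  simpa using h.symm

variable {Ω : Type*} [MeasurableSpace Ω] {P : Measure Ω}

/-- A centred Gaussian variable has the law of its standard deviation times a standard normal. In
this form a degenerate variance needs no separate treatment. -/
lemma integral_pow_of_hasGaussianLaw {Z : Ω → ℝ} (h : HasGaussianLaw Z P)
    (h0 : ∫ ω, Z ω ∂P = 0) (n : ℕ) :
    ∫ ω, Z ω ^ (2 * n) ∂P = (∫ ω, Z ω ^ 2 ∂P) ^ n * ∫ x, x ^ (2 * n) ∂(gaussianReal 0 1) := by
  have hv : Var[Z; P] = ∫ ω, Z ω ^ 2 ∂P := by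
    rw [variance_eq_integral h.aemeasurable]; simp [h0]
  have hv0 : 0 ≤ ∫ ω, Z ω ^ 2 ∂P := integral_nonneg fun _ => sq_nonneg _
  have hmap : P.map Z = (gaussianReal 0 1).map (√(∫ ω, Z ω ^ 2 ∂P) * ·) := by
    rw [h.map_eq_gaussianReal, gaussianReal_map_const_mul, hv, h0]
    congr 1
    · simp
    · ext; simp [hv0]
  have : ∫ ω, Z ω ^ (2 * n) ∂P = ∫ x, x ^ (2 * n) ∂(P.map Z) := by
    rw [integral_map h.aemeasurable (by fun_prop)]
  rw [this, hmap, integral_map (by fun_prop) (by fun_prop)]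
  simp_rw [mul_pow, integral_const_mul]
  rw [pow_mul (√_), Real.sq_sqrt hv0]

lemma integral_pow_four_of_hasGaussianLaw {Z : Ω → ℝ} (h : HasGaussianLaw Z P)
    (h0 : ∫ ω, Z ω ∂P = 0) : ∫ ω, Z ω ^ 4 ∂P = 3 * (∫ ω, Z ω ^ 2 ∂P) ^ 2 := by
  have := integral_pow_of_hasGaussianLaw h h0 2
  rw [show 2 * 2 = 4 from rfl, integral_pow_four_gaussianReal_zero_one] at this
  rw [this]; ring

lemma integrable_pow_of_hasGaussianLaw {Z : Ω → ℝ} (h : HasGaussianLaw Z P) (n : ℕ) :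
    Integrable (fun ω => Z ω ^ n) P := by
  have := h.isProbabilityMeasure
  have := (h.memLp (p := n) (by simp)).integrable_norm_pow'
  refine this.mono' (h.aemeasurable.pow_const n).aestronglyMeasurable (ae_of_all _ fun ω => ?_)
  simp

/-- The fourth mixed moment of a centred Gaussian vector. -/
lemma integral_mul_four_of_hasGaussianLaw {X : Fin 4 → Ω → ℝ}
    (h : HasGaussianLaw (fun ω => (X · ω)) P) (h0 : ∀ i, ∫ ω, X i ω ∂P = 0) :
    Integrable (fun ω => X 0 ω * X 1 ω * (X 2 ω * X 3 ω)) P ∧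
    ∫ ω, X 0 ω * X 1 ω * (X 2 ω * X 3 ω) ∂P =
      (∫ ω, X 0 ω * X 1 ω ∂P) * (∫ ω, X 2 ω * X 3 ω ∂P) +
      (∫ ω, X 0 ω * X 2 ω ∂P) * (∫ ω, X 1 ω * X 3 ω ∂P) +
      (∫ ω, X 0 ω * X 3 ω ∂P) * (∫ ω, X 1 ω * X 2 ω ∂P) := by
  have hX2 : ∀ i, MemLp (X i) 2 P := fun i => (h.eval i).memLp (by simp)
  have hXi : ∀ i, Integrable (X i) P := fun i => (h.eval i).integrable
  have hXX : ∀ i j, Integrable (fun ω => X i ω * X j ω) P := fun i j =>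
    (hX2 i).integrable_mul (hX2 j)
  have hL : ∀ a b c : ℝ, HasGaussianLaw
      (fun ω => X 0 ω + a * X 1 ω + b * X 2 ω + c * X 3 ω) P := by
    intro a b c
    have := h.map (.proj 0 + a • .proj 1 + b • .proj 2 + c • .proj 3 : (Fin 4 → ℝ) →L[ℝ] ℝ)
    exact this
  have hL0 : ∀ a b c : ℝ, ∫ ω, X 0 ω + a * X 1 ω + b * X 2 ω + c * X 3 ω ∂P = 0 := by
    intro a b c
    rw [integral_add, integral_add, integral_add] <;> try fun_prop
    · simp [integral_const_mul, h0]
  have hL2 : ∀ a b c : ℝ, ∫ ω, (X 0 ω + a * X 1 ω + b * X 2 ω + c * X 3 ω) ^ 2 ∂P =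
      (∫ ω, X 0 ω * X 0 ω ∂P) + a ^ 2 * (∫ ω, X 1 ω * X 1 ω ∂P) + b ^ 2 * (∫ ω, X 2 ω * X 2 ω ∂P)
      + c ^ 2 * (∫ ω, X 3 ω * X 3 ω ∂P) + 2 * a * (∫ ω, X 0 ω * X 1 ω ∂P)
      + 2 * b * (∫ ω, X 0 ω * X 2 ω ∂P) + 2 * c * (∫ ω, X 0 ω * X 3 ω ∂P)
      + 2 * a * b * (∫ ω, X 1 ω * X 2 ω ∂P) + 2 * a * c * (∫ ω, X 1 ω * X 3 ω ∂P)
      + 2 * b * c * (∫ ω, X 2 ω * X 3 ω ∂P) := by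
    intro a b c
    have : ∀ ω, (X 0 ω + a * X 1 ω + b * X 2 ω + c * X 3 ω) ^ 2 =
      ∑ t : Fin 10, (![1, a ^ 2, b ^ 2, c ^ 2, 2 * a, 2 * b, 2 * c, 2 * a * b, 2 * a * c,
        2 * b * c] t) * (X (![0, 1, 2, 3, 0, 0, 0, 1, 1, 2] t) ω *
          X (![0, 1, 2, 3, 1, 2, 3, 2, 3, 3] t) ω) := by
      intro ω
      simp [Fin.sum_univ_succ]
      ring
    simp_rw [this]
    rw [integral_finsetSum _ fun t _ => (hXX _ _).const_mul _]
    simp_rw [integral_const_mul]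
    simp [Fin.sum_univ_succ]
    ring
  -- Polarization: summing (x₀ ± x₁ ± x₂ ± x₃)⁴ against the product of the signs leaves only
  -- x₀x₁x₂x₃, with coefficient 8 · 4! = 192. This reduces mixed moments to fourth powers of
  -- Gaussian variables.
  have hpol : ∀ ω, X 0 ω * X 1 ω * (X 2 ω * X 3 ω) = ∑ t : Fin 8,
      (![1, -1, -1, 1, -1, 1, 1, -1] t / 192) *
      (X 0 ω + (![1, 1, 1, 1, -1, -1, -1, -1] t) * X 1 ω
        + (![1, 1, -1, -1, 1, 1, -1, -1] t) * X 2 ω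
        + (![1, -1, 1, -1, 1, -1, 1, -1] t) * X 3 ω) ^ 4 := by
    intro ω
    simp [Fin.sum_univ_succ]
    ring
  simp_rw [hpol]
  refine ⟨integrable_finsetSum _ fun t _ =>
    (integrable_pow_of_hasGaussianLaw (hL _ _ _) 4).const_mul _, ?_⟩
  rw [integral_finsetSum _ fun t _ =>
    (integrable_pow_of_hasGaussianLaw (hL _ _ _) 4).const_mul _]
  simp_rw [integral_const_mul, integral_pow_four_of_hasGaussianLaw (hL _ _ _) (hL0 _ _ _), hL2]
  simp [Fin.sum_univ_succ]
  ring

end GaussianMoments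

/-! ### Parseval's identity and integral functionals of a process -/

section Parseval

variable {S : Type*} [MeasurableSpace S] {μ : Measure S}

lemma hasSum_sq_integral (φ : HilbertBasis ℕ ℝ (Lp ℝ 2 μ)) {f : S → ℝ}
    (hf : MemLp f 2 μ) :
    HasSum (fun r => (∫ p, f p * φ r p ∂μ) ^ 2) (∫ p, f p ^ 2 ∂μ) := by
  have h := φ.hasSum_inner_mul_inner (hf.toLp f) (hf.toLp f)
  have e1 : ∀ r, inner ℝ (hf.toLp f) (φ r) = ∫ p, f p * φ r p ∂μ := by
    intro r
    rw [L2.inner_def]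
    refine integral_congr_ae ?_
    filter_upwards [hf.coeFn_toLp] with p hp
    simp [hp, mul_comm]
  have e2 : inner ℝ (hf.toLp f) (hf.toLp f) = ∫ p, f p ^ 2 ∂μ := by
    rw [L2.inner_def]
    refine integral_congr_ae ?_
    filter_upwards [hf.coeFn_toLp] with p hp
    simp [hp, sq]
  rw [e2] at h
  convert! h using 2 with r
  rw [real_inner_comm (hf.toLp f), e1, sq]

lemma integral_basis_mul_basis (φ : HilbertBasis ℕ ℝ (Lp ℝ 2 μ)) (r s : ℕ) :
    ∫ p, φ r p * φ s p ∂μ = if r = s then 1 else 0 := by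
  have := orthonormal_iff_ite.1 φ.orthonormal r s
  rw [L2.inner_def] at this
  rw [← this]
  congr with p
  simp [mul_comm]

lemma sq_integral_mul_le {f g : S → ℝ} (hf : MemLp f 2 μ) (hg : MemLp g 2 μ) :
    (∫ p, f p * g p ∂μ) ^ 2 ≤ (∫ p, f p ^ 2 ∂μ) * ∫ p, g p ^ 2 ∂μ := by
  have h : ∀ (u v : S → ℝ) (hu : MemLp u 2 μ) (hv : MemLp v 2 μ),
      inner ℝ (hu.toLp u) (hv.toLp v) = ∫ p, u p * v p ∂μ := by
    intro u v hu hv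
    rw [L2.inner_def]
    refine integral_congr_ae ?_
    filter_upwards [hu.coeFn_toLp, hv.coeFn_toLp] with p hp hp'
    simp [hp, hp', mul_comm]
  have := real_inner_mul_inner_self_le (hf.toLp f) (hg.toLp g)
  simp only [h] at this
  simpa [sq] using this

variable [IsFiniteMeasure μ] {Ω : Type*} [MeasurableSpace Ω] {P : Measure Ω}
  [IsProbabilityMeasure P]

lemma integrable_prod_of_integral_le {F : S × Ω → ℝ} (hF : Measurable F) (h0 : ∀ z, 0 ≤ F z)
    (hFi : ∀ p, Integrable (fun ω => F (p, ω)) P) {C : ℝ} (hC : ∀ p, ∫ ω, F (p, ω) ∂P ≤ C) :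
    Integrable F (μ.prod P) := by
  rw [integrable_prod_iff hF.aestronglyMeasurable]
  refine ⟨ae_of_all _ hFi, ?_⟩
  refine Integrable.of_bound (C := C) ?_ (ae_of_all _ fun p => ?_)
  · exact (hF.norm.stronglyMeasurable.integral_prod_right).aestronglyMeasurable
  · rw [Real.norm_eq_abs, abs_of_nonneg (integral_nonneg fun _ => norm_nonneg _)]
    simpa [abs_of_nonneg (h0 _)] using hC p

lemma memLp_two_prod {F : S × Ω → ℝ} (hF : Measurable F)
    (hF2 : ∀ p, MemLp (fun ω => F (p, ω)) 2 P) {C : ℝ} (hC : ∀ p, ∫ ω, F (p, ω) ^ 2 ∂P ≤ C) :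
    MemLp F 2 (μ.prod P) := by
  rw [memLp_two_iff_integrable_sq hF.aestronglyMeasurable]
  exact integrable_prod_of_integral_le (hF.pow_const 2) (fun _ => sq_nonneg _)
    (fun p => (hF2 p).integrable_sq) hC

lemma memLp_two_section {F : S × Ω → ℝ} (hF : Measurable F) (hF2 : MemLp F 2 (μ.prod P)) :
    ∀ᵐ ω ∂P, MemLp (fun p => F (p, ω)) 2 μ := by
  filter_upwards [hF2.integrable_sq.prod_left_ae] with ω hω
  exact (memLp_two_iff_integrable_sq
    (hF.comp measurable_prodMk_right).aestronglyMeasurable).2 hω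

/-- Cauchy–Schwarz in the first variable bounds the square by ‖F(·, ω)‖²‖ψ‖², which is integrable in
ω. -/
lemma memLp_two_integral_mul {F : S × Ω → ℝ} (hF : Measurable F) (hF2 : MemLp F 2 (μ.prod P))
    {ψ : S → ℝ} (hψ : MemLp ψ 2 μ) : MemLp (fun ω => ∫ p, F (p, ω) * ψ p ∂μ) 2 P := by
  have hm : AEStronglyMeasurable (fun ω => ∫ p, F (p, ω) * ψ p ∂μ) P := by
    have : AEStronglyMeasurable (fun z : S × Ω => F z * ψ z.1) (μ.prod P) :=
      hF.aestronglyMeasurable.mul hψ.1.comp_fst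
    exact this.prod_swap.integral_prod_right'
  rw [memLp_two_iff_integrable_sq hm]
  have h1 : Integrable (fun ω => (∫ p, F (p, ω) ^ 2 ∂μ) * ∫ p, ψ p ^ 2 ∂μ) P :=
    (hF2.integrable_sq.integral_prod_right).mul_const _
  refine h1.mono' (hm.pow 2) ?_
  filter_upwards [memLp_two_section hF hF2] with ω hω
  rw [Real.norm_eq_abs, abs_of_nonneg (sq_nonneg _)]
  exact sq_integral_mul_le hω hψ

/-- Parseval's identity in expectation. -/
lemma hasSum_integral_sq_integral (φ : HilbertBasis ℕ ℝ (Lp ℝ 2 μ)) {F : S × Ω → ℝ}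
    (hF : Measurable F) (hF2 : MemLp F 2 (μ.prod P)) :
    HasSum (fun r => ∫ ω, (∫ p, F (p, ω) * φ r p ∂μ) ^ 2 ∂P) (∫ ω, ∫ p, F (p, ω) ^ 2 ∂μ ∂P) := by
  have hae := memLp_two_section hF hF2
  have hint : Integrable (fun ω => ∫ p, F (p, ω) ^ 2 ∂μ) P := hF2.integrable_sq.integral_prod_right
  -- The terms are nonnegative, so they serve as their own bounds; almost surely their sum is the
  -- squared L² norm of the path, which is integrable.
  refine hasSum_integral_of_dominated_convergence
    (bound := fun r ω => (∫ p, F (p, ω) * φ r p ∂μ) ^ 2) ?_ ?_ ?_ ?_ ?_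
  · intro r
    exact ((memLp_two_integral_mul hF hF2 (Lp.memLp (φ r))).1).pow 2
  · intro r
    exact ae_of_all _ fun ω => by rw [Real.norm_eq_abs, abs_of_nonneg (sq_nonneg _)]
  · filter_upwards [hae] with ω hω
    exact (hasSum_sq_integral φ hω).summable
  · refine hint.congr ?_
    filter_upwards [hae] with ω hω
    exact (hasSum_sq_integral φ hω).tsum_eq.symm
  · filter_upwards [hae] with ω hω
    exact hasSum_sq_integral φ hω

/-- The quadratic form of the integral operator with kernel `K`. -/
noncomputable def quadForm (μ : Measure S) (K : S → S → ℝ) (ψ : S → ℝ) : ℝ :=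
  ∫ z : S × S, K z.1 z.2 * (ψ z.1 * ψ z.2) ∂(μ.prod μ)

/-- The square is a double integral over S × S, and Fubini moves the expectation inside. This turns
second moments of functionals into quadratic forms of the second moment kernel. -/
lemma integral_sq_integral_eq_quadForm {F : S × Ω → ℝ} (hF : Measurable F)
    (hF2 : MemLp F 2 (μ.prod P)) {ψ : S → ℝ} (hψ : MemLp ψ 2 μ) :
    ∫ ω, (∫ p, F (p, ω) * ψ p ∂μ) ^ 2 ∂P =
      quadForm μ (fun p q => ∫ ω, F (p, ω) * F (q, ω) ∂P) ψ := by
  have hint : Integrable (fun w : (S × S) × Ω =>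
      F (w.1.1, w.2) * F (w.1.2, w.2) * (ψ w.1.1 * ψ w.1.2)) ((μ.prod μ).prod P) := by
    -- Integrability comes from pairing crosswise: the integrand is the product of F(p, ω)ψ(q) and
    -- F(q, ω)ψ(p). Each is square integrable on the triple product, since its two factors depend on
    -- disjoint variables.
    have hb : Integrable (fun w : (S × Ω) × S => F w.1 ^ 2 * ψ w.2 ^ 2) ((μ.prod P).prod μ) :=
      hF2.integrable_sq.mul_prod hψ.integrable_sq
    have m1 : MeasurePreserving (fun w : (S × S) × Ω => ((w.1.1, w.2), w.1.2))
        ((μ.prod μ).prod P) ((μ.prod P).prod μ) := by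
      have a1 := measurePreserving_prodAssoc μ μ P
      have a2 : MeasurePreserving (Prod.map id Prod.swap : S × (S × Ω) → S × (Ω × S))
          (μ.prod (μ.prod P)) (μ.prod (P.prod μ)) :=
        (MeasurePreserving.id μ).prod (Measure.measurePreserving_swap)
      have a3 := (measurePreserving_prodAssoc μ P μ).symm
      exact a3.comp (a2.comp a1)
    have m2 : MeasurePreserving (fun w : (S × S) × Ω => ((w.1.2, w.2), w.1.1))
        ((μ.prod μ).prod P) ((μ.prod P).prod μ) :=
      m1.comp (Measure.measurePreserving_swap.prod (MeasurePreserving.id P))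
    have hb1 := m1.integrable_comp_of_integrable hb
    have hb2 := m2.integrable_comp_of_integrable hb
    refine (hb1.add hb2).mono' ?_ (ae_of_all _ fun w => ?_)
    · have e1 : AEStronglyMeasurable (fun z : S × S => ψ z.1 * ψ z.2) (μ.prod μ) :=
        hψ.1.comp_fst.mul hψ.1.comp_snd
      refine AEStronglyMeasurable.mul ?_ e1.comp_fst
      exact Measurable.aestronglyMeasurable (by fun_prop)
    · simp only [Function.comp, Pi.add_apply]
      rw [Real.norm_eq_abs]
      have e : F (w.1.1, w.2) * F (w.1.2, w.2) * (ψ w.1.1 * ψ w.1.2) =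
        (F (w.1.1, w.2) * ψ w.1.2) * (F (w.1.2, w.2) * ψ w.1.1) := by ring
      rw [e, abs_le]
      constructor <;> nlinarith [sq_nonneg (F (w.1.1, w.2) * ψ w.1.2 + F (w.1.2, w.2) * ψ w.1.1),
        sq_nonneg (F (w.1.1, w.2) * ψ w.1.2 - F (w.1.2, w.2) * ψ w.1.1),
        sq_nonneg (F (w.1.1, w.2) * ψ w.1.2), sq_nonneg (F (w.1.2, w.2) * ψ w.1.1)]
  have e1 : ∀ ω, (∫ p, F (p, ω) * ψ p ∂μ) ^ 2 =
      ∫ z : S × S, F (z.1, ω) * F (z.2, ω) * (ψ z.1 * ψ z.2) ∂(μ.prod μ) := by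
    intro ω
    rw [sq, ← integral_prod_mul]
    congr with z
    ring
  simp_rw [e1]
  rw [← integral_integral_swap (f := fun (z : S × S) ω =>
    F (z.1, ω) * F (z.2, ω) * (ψ z.1 * ψ z.2)) hint, quadForm]
  congr with z
  rw [integral_mul_const]

end Parseval

/-! ### Independence of integral functionals of independent processes -/

section Independence

variable {S : Type*} [MeasurableSpace S] {μ : Measure S} [IsFiniteMeasure μ]
  {Ω : Type*} {m mΩ : MeasurableSpace Ω} {P : Measure Ω} [IsProbabilityMeasure P]

/-- An integral functional of a process is almost surely measurable with respect to any
`σ`-algebra that makes the values of the process measurable. -/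
lemma condExp_integral_mul_ae_eq (hm : m ≤ mΩ) {F : S × Ω → ℝ}
    (hF : Measurable F) (hF2 : MemLp F 2 (μ.prod P))
    (hFm : ∀ p, Measurable[m] fun ω => F (p, ω)) {ψ : S → ℝ} (hψ : MemLp ψ 2 μ) :
    P[fun ω => ∫ p, F (p, ω) * ψ p ∂μ | m] =ᵐ[P] fun ω => ∫ p, F (p, ω) * ψ p ∂μ := by
  -- F is only assumed `m`-measurable for each fixed p, not jointly, so the integral need not be
  -- `m`-measurable. Instead, ξ minus its conditional expectation is shown to be orthogonal to
  -- itself in L².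
  set ξ : Ω → ℝ := fun ω => ∫ p, F (p, ω) * ψ p ∂μ with hξdef
  have hξ : MemLp ξ 2 P := memLp_two_integral_mul hF hF2 hψ
  have hg : MemLp (P[ξ | m]) 2 P := hξ.condExp (by norm_num)
  have hξi : Integrable ξ P := hξ.integrable (by norm_num)
  set D : Ω → ℝ := ξ - P[ξ | m] with hD
  have hD2 : MemLp D 2 P := hξ.sub hg
  have horth : ∀ h : Ω → ℝ, StronglyMeasurable[m] h → MemLp h 2 P → ∫ ω, D ω * h ω ∂P = 0 := by
    intro h hh hh2
    have i1 : Integrable (ξ * h) P := hξ.integrable_mul hh2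
    have i2 : Integrable (P[ξ | m] * h) P := hg.integrable_mul hh2
    have e := condExp_mul_of_stronglyMeasurable_right hh i1 hξi
    have e1 : ∫ ω, (P[ξ | m] * h) ω ∂P = ∫ ω, (ξ * h) ω ∂P := by
      rw [← integral_condExp hm (f := ξ * h)]
      exact integral_congr_ae e.symm
    have : ∀ ω, D ω * h ω = (ξ * h) ω - (P[ξ | m] * h) ω := by
      intro ω; simp [hD]; ring
    simp_rw [this]
    rw [integral_sub i1 i2, e1, sub_self]
  have h1 : ∫ ω, D ω * (P[ξ | m]) ω ∂P = 0 := horth _ stronglyMeasurable_condExp hg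
  -- D is orthogonal to F(p, ·) for almost every p, and Fubini carries this over to the integral ξ.
  have h2 : ∫ ω, D ω * ξ ω ∂P = 0 := by
    have hDψ : MemLp (fun z : S × Ω => ψ z.1 * D z.2) 2 (μ.prod P) := by
      refine (memLp_two_iff_integrable_sq (hψ.1.comp_fst.mul hD2.1.comp_snd)).2 ?_
      simp only [Pi.mul_apply, mul_pow]
      exact hψ.integrable_sq.mul_prod hD2.integrable_sq
    have hi : Integrable (fun z : S × Ω => F z * (ψ z.1 * D z.2)) (μ.prod P) :=
      hF2.integrable_mul hDψ
    have e : ∀ ω, D ω * ξ ω = ∫ p, F (p, ω) * (ψ p * D ω) ∂μ := by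
      intro ω
      rw [hξdef, ← integral_const_mul]
      congr with p; ring
    simp_rw [e]
    rw [← integral_integral_swap (f := fun p ω => F (p, ω) * (ψ p * D ω)) hi]
    refine integral_eq_zero_of_ae ?_
    filter_upwards [hF2.integrable_sq.prod_right_ae] with p hp
    have hp2 : MemLp (fun ω => F (p, ω)) 2 P :=
      (memLp_two_iff_integrable_sq (hF.comp measurable_prodMk_left).aestronglyMeasurable).2 hp
    have := horth _ (hFm p).stronglyMeasurable hp2
    have e2 : ∀ ω, F (p, ω) * (ψ p * D ω) = ψ p * (D ω * F (p, ω)) := fun ω => by ring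
    simp_rw [e2, integral_const_mul, this]
    simp
  have h3 : ∫ ω, D ω ^ 2 ∂P = 0 := by
    have : ∀ ω, D ω ^ 2 = D ω * ξ ω - D ω * (P[ξ | m]) ω := by
      intro ω; simp [hD]; ring
    simp_rw [this]
    have e := integral_sub (hD2.integrable_mul hξ) (hD2.integrable_mul hg)
    simp only [Pi.mul_apply] at e
    rw [e, h1, h2, sub_zero]
  rw [integral_eq_zero_iff_of_nonneg (fun _ => sq_nonneg _) hD2.integrable_sq] at h3
  filter_upwards [h3] with ω hω
  have : D ω = 0 := by simpa using hω
  simp only [hD, Pi.sub_apply] at this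
  linarith

/-- Integral functionals of independent processes are independent. -/
lemma iIndepFun_integral_mul {ι T : Type*} {Y : ι → Ω → T → ℝ}
    (hYm : ∀ α, Measurable (Y α)) (hY : iIndepFun Y P)
    {F : ι → S × Ω → ℝ} (hF : ∀ α, Measurable (F α)) (hF2 : ∀ α, MemLp (F α) 2 (μ.prod P))
    (hFm : ∀ α p, Measurable[MeasurableSpace.comap (Y α) inferInstance] fun ω => F α (p, ω))
    {ψ : ι → S → ℝ} (hψ : ∀ α, MemLp (ψ α) 2 μ) :
    iIndepFun (fun α ω => ∫ p, F α (p, ω) * ψ α p ∂μ) P := by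
  have hle : ∀ α, MeasurableSpace.comap (Y α) inferInstance ≤ mΩ := fun α => (hYm α).comap_le
  -- The conditional expectations are genuinely measurable for the independent σ-algebras, so they
  -- are independent, and almost sure equality transfers this to the functionals.
  have h : iIndepFun (fun α => P[fun ω => ∫ p, F α (p, ω) * ψ α p ∂μ |
      MeasurableSpace.comap (Y α) inferInstance]) P := by
    rw [iIndepFun_iff_iIndep] at hY ⊢
    refine iIndep_of_iIndep_of_le hY fun α => ?_
    exact (stronglyMeasurable_condExp.measurable).comap_le
  exact (iIndepFun_congr fun α => condExp_integral_mul_ae_eq (hle α) (hF α) (hF2 α) (hFm α)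
    (hψ α)).1 h

end Independence

/-! ### Lyapunov type bounds for characteristic functions -/

section CharFun

open Complex in
-- For |x| ≤ 1 this is the Taylor remainder; for larger x every term is separately at most a
-- multiple of |x|³. The constant is crude.
lemma norm_exp_mul_I_sub_le (x : ℝ) :
    ‖cexp (x * I) - (1 + x * I - (x ^ 2 / 2 : ℝ))‖ ≤ 4 * |x| ^ 3 := by
  by_cases hx : |x| ≤ 1
  · have h := Complex.exp_bound (x := x * I) (by simpa using hx) (n := 3) (by norm_num)
    have e : ∑ m ∈ Finset.range 3, (x * I) ^ m / (m.factorial : ℂ) =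
        1 + x * I - (x ^ 2 / 2 : ℝ) := by
      simp [Finset.sum_range_succ, mul_pow]; ring
    rw [e] at h
    refine h.trans ?_
    have : 0 ≤ |x| ^ 3 := by positivity
    simp
    norm_num [Nat.factorial]
    linarith
  · push Not at hx
    have h1 : ‖cexp (x * I)‖ = 1 := by simp [Complex.norm_exp]
    have h2 : ‖(1 + x * I - (x ^ 2 / 2 : ℝ) : ℂ)‖ ≤ 1 + |x| + x ^ 2 / 2 := by
      refine (norm_sub_le _ _).trans (add_le_add ((norm_add_le _ _).trans ?_) ?_)
      · simp
      · rw [Complex.norm_real, Real.norm_eq_abs, abs_of_nonneg (by positivity)]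
    refine (norm_sub_le _ _).trans ?_
    rw [h1]
    have h3 : x ^ 2 = |x| ^ 2 := (sq_abs x).symm
    have h4 : |x| ≤ |x| ^ 3 := by nlinarith [mul_pos (by linarith : 0 < |x|) (by linarith : 0 < |x|)]
    have h5 : |x| ^ 2 ≤ |x| ^ 3 := by
      nlinarith [mul_pos (by linarith : 0 < |x|) (by linarith : 0 < |x|)]
    linarith [h2, h3, h4, h5]

lemma abs_exp_neg_sub_le {u : ℝ} (hu : 0 ≤ u) : |Real.exp (-u) - (1 - u)| ≤ u ^ 2 := by
  by_cases h : u ≤ 1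
  · have := Real.abs_exp_sub_one_sub_id_le (x := -u) (by rwa [abs_neg, abs_of_nonneg hu])
    rw [show Real.exp (-u) - (1 - u) = Real.exp (-u) - 1 - -u by ring, ← neg_sq]
    exact this
  · push Not at h
    have h1 := Real.add_one_le_exp (-u)
    have h2 : Real.exp (-u) ≤ 1 := Real.exp_le_one_iff.2 (by linarith)
    rw [abs_of_nonneg (by linarith)]
    nlinarith

variable {Ω : Type*} [MeasurableSpace Ω] {P : Measure Ω} [IsProbabilityMeasure P]

open Complex in
-- Both the characteristic function and the Gaussian factor are compared with their common second
-- order expansion 1 − a²σ/2. The third absolute moment is absorbed through 2|ξ|³ ≤ ξ² + ξ⁴, so a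
-- fourth moment bound suffices.
lemma norm_integral_exp_sub_le {ξ : Ω → ℝ} (hξ : AEMeasurable ξ P) {a σ M : ℝ}
    (h0 : ∫ ω, ξ ω ∂P = 0) (h2 : ∫ ω, ξ ω ^ 2 ∂P = σ)
    (h4i : Integrable (fun ω => ξ ω ^ 4) P) (h4 : ∫ ω, ξ ω ^ 4 ∂P ≤ M) :
    ‖∫ ω, cexp ((a * ξ ω : ℝ) * I) ∂P - cexp ((-(a ^ 2 * σ / 2) : ℝ))‖ ≤
      2 * |a| ^ 3 * (σ + M) + a ^ 4 * σ ^ 2 := by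
  have h2i : Integrable (fun ω => ξ ω ^ 2) P := by
    refine (h4i.add (integrable_const (1 : ℝ))).mono' (hξ.pow_const 2).aestronglyMeasurable
      (ae_of_all _ fun ω => ?_)
    rw [Real.norm_eq_abs, abs_of_nonneg (sq_nonneg _)]
    simp only [Pi.add_apply]
    nlinarith [sq_nonneg (ξ ω ^ 2 - 1)]
  have h1i : Integrable ξ P :=
    ((memLp_two_iff_integrable_sq hξ.aestronglyMeasurable).2 h2i).integrable (by norm_num)
  have hσ : 0 ≤ σ := h2 ▸ integral_nonneg fun _ => sq_nonneg _
  have hei : Integrable (fun ω => cexp ((a * ξ ω : ℝ) * I)) P := by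
    refine Integrable.of_bound (C := 1) ?_ (ae_of_all _ fun ω => ?_)
    · exact (by fun_prop : AEMeasurable (fun ω => cexp ((a * ξ ω : ℝ) * I)) P).aestronglyMeasurable
    · simp [Complex.norm_exp]
  have hpi : Integrable (fun ω => (1 + ((a * ξ ω : ℝ) : ℂ) * I - ((a * ξ ω) ^ 2 / 2 : ℝ))) P := by
    refine ((integrable_const _).add (((h1i.const_mul a).ofReal).mul_const I)).sub ?_
    refine Integrable.ofReal ?_
    simp_rw [mul_pow]
    exact (h2i.const_mul _).div_const 2
  have hp : ∫ ω, (1 + ((a * ξ ω : ℝ) : ℂ) * I - ((a * ξ ω) ^ 2 / 2 : ℝ)) ∂P =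
      ((1 - a ^ 2 * σ / 2 : ℝ) : ℂ) := by
    rw [integral_sub, integral_add, integral_mul_const, integral_complex_ofReal, integral_complex_ofReal,
      integral_const_mul, h0]
    · simp_rw [mul_pow]
      rw [integral_div, integral_const_mul, h2]
      simp
    · exact integrable_const _
    · exact ((h1i.const_mul a).ofReal).mul_const I
    · exact (integrable_const _).add (((h1i.const_mul a).ofReal).mul_const I)
    · refine Integrable.ofReal ?_
      simp_rw [mul_pow]
      exact (h2i.const_mul _).div_const 2
  have b1 : ‖∫ ω, cexp ((a * ξ ω : ℝ) * I) ∂P - ((1 - a ^ 2 * σ / 2 : ℝ) : ℂ)‖ ≤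
      2 * |a| ^ 3 * (σ + M) := by
    rw [← hp, ← integral_sub hei hpi]
    refine (norm_integral_le_of_norm_le (g := fun ω => 2 * |a| ^ 3 * (ξ ω ^ 2 + ξ ω ^ 4))
      ((h2i.add h4i).const_mul _) (ae_of_all _ fun ω => ?_)).trans ?_
    · refine (norm_exp_mul_I_sub_le (a * ξ ω)).trans ?_
      rw [abs_mul, mul_pow]
      have e2 : ξ ω ^ 2 = |ξ ω| ^ 2 := (sq_abs _).symm
      have e4 : ξ ω ^ 4 = |ξ ω| ^ 4 := by rw [show (4 : ℕ) = 2 * 2 from rfl, pow_mul, pow_mul, sq_abs]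
      have : 2 * |ξ ω| ^ 3 ≤ ξ ω ^ 2 + ξ ω ^ 4 := by
        rw [e2, e4]; nlinarith [sq_nonneg (|ξ ω| - |ξ ω| ^ 2)]
      have ha : 0 ≤ |a| ^ 3 := by positivity
      nlinarith
    · rw [integral_const_mul, integral_add h2i h4i, h2]
      gcongr
  have b2 : ‖((1 - a ^ 2 * σ / 2 : ℝ) : ℂ) - cexp ((-(a ^ 2 * σ / 2) : ℝ))‖ ≤ a ^ 4 * σ ^ 2 := by
    rw [← Complex.ofReal_exp, ← Complex.ofReal_sub, Complex.norm_real, norm_sub_rev,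
      Real.norm_eq_abs]
    refine (abs_exp_neg_sub_le (by positivity)).trans ?_
    nlinarith [mul_nonneg (by positivity : 0 ≤ a ^ 4) (sq_nonneg σ)]
  exact (norm_sub_le_norm_sub_add_norm_sub _ _ _).trans (add_le_add b1 b2)

/-- Factors are exchanged one at a time; the remaining ones lie in the closed unit disc and do not
enlarge the error. -/
lemma norm_prod_sub_prod_le {ι : Type*} (s : Finset ι) {u v : ι → ℂ} (hu : ∀ i ∈ s, ‖u i‖ ≤ 1)
    (hv : ∀ i ∈ s, ‖v i‖ ≤ 1) : ‖∏ i ∈ s, u i - ∏ i ∈ s, v i‖ ≤ ∑ i ∈ s, ‖u i - v i‖ := by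
  classical
  induction s using Finset.induction with
  | empty => simp
  | insert i s hi ih =>
    rw [Finset.prod_insert hi, Finset.prod_insert hi, Finset.sum_insert hi]
    have ih' := ih (fun j hj => hu j (Finset.mem_insert_of_mem hj))
      (fun j hj => hv j (Finset.mem_insert_of_mem hj))
    have e : u i * ∏ j ∈ s, u j - v i * ∏ j ∈ s, v j =
        (u i - v i) * ∏ j ∈ s, u j + v i * (∏ j ∈ s, u j - ∏ j ∈ s, v j) := by ring
    rw [e]
    refine (norm_add_le _ _).trans (add_le_add ?_ ?_)
    · rw [norm_mul]
      have : ‖∏ j ∈ s, u j‖ ≤ 1 := by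
        rw [norm_prod]
        exact Finset.prod_le_one (fun _ _ => norm_nonneg _)
          fun j hj => hu j (Finset.mem_insert_of_mem hj)
      exact mul_le_of_le_one_right (norm_nonneg _) this
    · rw [norm_mul]
      exact (mul_le_of_le_one_left (norm_nonneg _) (hv i (Finset.mem_insert_self i s))).trans ih'

open Complex in
/-- Normal approximation of the characteristic function of a sum of independent variables. -/
lemma norm_integral_exp_sum_sub_le {ι : Type*} [Fintype ι] {ξ : ι → Ω → ℝ}
    (hind : iIndepFun ξ P) (hξ : ∀ α, AEMeasurable (ξ α) P) {a σ M : ι → ℝ}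
    (h0 : ∀ α, ∫ ω, ξ α ω ∂P = 0) (h2 : ∀ α, ∫ ω, ξ α ω ^ 2 ∂P = σ α)
    (h4i : ∀ α, Integrable (fun ω => ξ α ω ^ 4) P) (h4 : ∀ α, ∫ ω, ξ α ω ^ 4 ∂P ≤ M α) :
    ‖∫ ω, cexp ((∑ α, a α * ξ α ω : ℝ) * I) ∂P - cexp ((-(∑ α, a α ^ 2 * σ α) / 2 : ℝ))‖ ≤
      ∑ α, (2 * |a α| ^ 3 * (σ α + M α) + a α ^ 4 * σ α ^ 2) := by
  have hind' : iIndepFun (fun α ω => a α * ξ α ω) P :=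
    hind.comp (fun α x => a α * x) (fun α => by fun_prop)
  have hprod : ∫ ω, cexp ((∑ α, a α * ξ α ω : ℝ) * I) ∂P =
      ∏ α, ∫ ω, cexp ((a α * ξ α ω : ℝ) * I) ∂P := by
    have h := congrFun (hind'.charFun_map_fun_sum_eq_prod
      (fun α => (hξ α).const_mul (a α))) 1
    simp only [Finset.prod_apply, charFun_apply_real] at h
    rw [integral_map (Finset.aemeasurable_fun_sum _ fun α _ => (hξ α).const_mul (a α))
      (by fun_prop)] at h
    simp only [ofReal_one, one_mul] at h
    rw [h]
    refine Finset.prod_congr rfl fun α _ => ?_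
    rw [integral_map ((hξ α).const_mul (a α)) (by fun_prop)]
  have hexp : cexp ((-(∑ α, a α ^ 2 * σ α) / 2 : ℝ)) =
      ∏ α, cexp ((-(a α ^ 2 * σ α / 2) : ℝ)) := by
    rw [← Complex.exp_sum]
    congr 1
    rw [← Complex.ofReal_sum, Finset.sum_neg_distrib, ← Finset.sum_div, neg_div]
  rw [hprod, hexp]
  refine (norm_prod_sub_prod_le _ (fun α _ => ?_) (fun α _ => ?_)).trans
    (Finset.sum_le_sum fun α _ => norm_integral_exp_sub_le (hξ α) (h0 α) (h2 α) (h4i α) (h4 α))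
  · refine (norm_integral_le_of_norm_le (integrable_const (1 : ℝ)) (ae_of_all _ fun ω => ?_)).trans
      (by simp)
    simp [Complex.norm_exp]
  · rw [← Complex.ofReal_exp, Complex.norm_real, Real.norm_eq_abs, abs_of_pos (Real.exp_pos _)]
    refine Real.exp_le_one_iff.2 ?_
    have : 0 ≤ σ α := (h2 α) ▸ integral_nonneg fun _ => sq_nonneg _
    have := mul_nonneg (sq_nonneg (a α)) this
    linarith

end CharFun

/-! ### Orthogonal sums and transformations of Gaussian laws -/

section Orthogonality

variable {Ω : Type*} [MeasurableSpace Ω] {P : Measure Ω}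

lemma integrable_mul_of_memLp_two {f g : Ω → ℝ} (hf : MemLp f 2 P) (hg : MemLp g 2 P) :
    Integrable (fun ω => f ω * g ω) P :=
  hf.integrable_mul hg

lemma integral_sum_mul_sum_of_orthogonal {ι : Type*} [Fintype ι] [DecidableEq ι]
    {F G : ι → Ω → ℝ} (hF : ∀ α, MemLp (F α) 2 P) (hG : ∀ α, MemLp (G α) 2 P)
    (h : ∀ α β, α ≠ β → ∫ ω, F α ω * G β ω ∂P = 0) :
    ∫ ω, (∑ α, F α ω) * (∑ β, G β ω) ∂P = ∑ α, ∫ ω, F α ω * G α ω ∂P := by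
  simp_rw [Finset.sum_mul_sum]
  rw [integral_finsetSum _ fun α _ => integrable_finsetSum _ fun β _ =>
    integrable_mul_of_memLp_two (hF α) (hG β)]
  refine Finset.sum_congr rfl fun α _ => ?_
  rw [integral_finsetSum _ fun β _ => integrable_mul_of_memLp_two (hF α) (hG β)]
  rw [Finset.sum_eq_single α (fun β _ hβ => h α β hβ.symm) (by simp)]

lemma hasGaussianLaw_sub_const {E : Type*} [NormedAddCommGroup E] [NormedSpace ℝ E]
    [MeasurableSpace E] [BorelSpace E] [SecondCountableTopology E] {X : Ω → E}
    (h : HasGaussianLaw X P) (c : E) : HasGaussianLaw (fun ω => X ω - c) P where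
  isGaussian_map := by
    have := h.isGaussian_map
    have e : P.map (fun ω => X ω - c) = (P.map X).map (fun x => x - c) := by
      rw [AEMeasurable.map_map_of_aemeasurable (by fun_prop) h.aemeasurable]
      rfl
    rw [e]
    infer_instance

lemma hasGaussianLaw_fin_of_isGaussianProcess {T : Type*} {X : T → Ω → ℝ}
    (h : IsGaussianProcess X P) {n : ℕ} (t : Fin n → T) :
    HasGaussianLaw (fun ω m => X (t m) ω) P := by
  have h1 := (h.comp_right t).hasGaussianLaw Finset.univ
  let L : (↥(Finset.univ : Finset (Fin n)) → ℝ) →L[ℝ] (Fin n → ℝ) :=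
    ContinuousLinearMap.pi fun m => .proj ⟨m, Finset.mem_univ m⟩
  exact h1.map L

end Orthogonality


/-! ### Decomposition and moments of the sample covariance at fixed sample sizes -/

section Stage

variable {T Ω : Type*} {k : ℕ} {N : Fin k → ℕ}

/-- The products of the centred values of a curve, minus their expectation. -/
noncomputable def prodDev (y : (i : Fin k) → Fin (N i) → T → Ω → ℝ) (η : Fin k → T → ℝ)
    (Γ : Fin k → T → T → ℝ) (α : (i : Fin k) × Fin (N i)) (z : (T × T) × Ω) : ℝ :=
  (y α.1 α.2 z.1.1 z.2 - η α.1 z.1.1) * (y α.1 α.2 z.1.2 z.2 - η α.1 z.1.2) - Γ α.1 z.1.1 z.1.2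

/-- The normalized sum of the `prodDev`s of a sample. -/
noncomputable def sumDev (y : (i : Fin k) → Fin (N i) → T → Ω → ℝ) (η : Fin k → T → ℝ)
    (Γ : Fin k → T → T → ℝ) (i : Fin k) (z : (T × T) × Ω) : ℝ :=
  ∑ j, (√((N i : ℝ) - 1))⁻¹ * prodDev y η Γ ⟨i, j⟩ z

/-- The contribution of the sample mean to the fluctuations of the sample covariance. -/
noncomputable def meanDev (y : (i : Fin k) → Fin (N i) → T → Ω → ℝ) (η : Fin k → T → ℝ)
    (Γ : Fin k → T → T → ℝ) (i : Fin k) (z : (T × T) × Ω) : ℝ :=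
  (√((N i : ℝ) - 1))⁻¹ * ((N i : ℝ)⁻¹ * ((∑ j, (y i j z.1.1 z.2 - η i z.1.1)) *
    ∑ j, (y i j z.1.2 z.2 - η i z.1.2)) - Γ i z.1.1 z.1.2)

lemma abs_varpi_le {γ : T → T → ℝ} {C : ℝ} (hC : ∀ s t, |γ s t| ≤ C) (p q : T × T) :
    |varpi γ p q| ≤ 2 * C ^ 2 := by
  have hC0 : 0 ≤ C := (abs_nonneg _).trans (hC p.1 p.1)
  unfold varpi
  refine (abs_add_le _ _).trans ?_
  rw [abs_mul, abs_mul]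
  have := mul_le_mul (hC p.1 q.1) (hC p.2 q.2) (abs_nonneg _) hC0
  have := mul_le_mul (hC p.1 q.2) (hC q.1 p.2) (abs_nonneg _) hC0
  linarith

/-- Centring at the sample means is translation invariant, so the data may be recentred at any
constants, here the true means, at the price of one product of sums. -/
lemma sum_sub_mean_mul {n : ℕ} (hn : n ≠ 0) (u v : Fin n → ℝ) (a b : ℝ) :
    ∑ j, (u j - (n : ℝ)⁻¹ * ∑ l, u l) * (v j - (n : ℝ)⁻¹ * ∑ l, v l) =
      ∑ j, (u j - a) * (v j - b) - (n : ℝ)⁻¹ * ((∑ j, (u j - a)) * ∑ j, (v j - b)) := by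
  have hn' : (n : ℝ) ≠ 0 := by exact_mod_cast hn
  have e1 : ∀ j, (u j - (n : ℝ)⁻¹ * ∑ l, u l) * (v j - (n : ℝ)⁻¹ * ∑ l, v l) =
      u j * v j - u j * ((n : ℝ)⁻¹ * ∑ l, v l) - ((n : ℝ)⁻¹ * ∑ l, u l) * v j +
        ((n : ℝ)⁻¹ * ∑ l, u l) * ((n : ℝ)⁻¹ * ∑ l, v l) := fun j => by ring
  have e2 : ∀ j, (u j - a) * (v j - b) = u j * v j - u j * b - a * v j + a * b := fun j => by ring
  simp_rw [e1, e2, Finset.sum_add_distrib, Finset.sum_sub_distrib, ← Finset.sum_mul,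
    ← Finset.mul_sum]
  simp only [Finset.sum_const, Finset.card_univ, Fintype.card_fin, nsmul_eq_mul]
  field_simp
  ring

/-- There are `N i` summands but the normalization is `N i - 1`; the surplus copy of Γ goes to
`meanDev`, which thereby becomes centred. -/
lemma sampleCov_eq (y : (i : Fin k) → Fin (N i) → T → Ω → ℝ) (η : Fin k → T → ℝ)
    (Γ : Fin k → T → T → ℝ) {i : Fin k} (hN : 2 ≤ N i) (p : T × T) (ω : Ω) :
    √((N i : ℝ) - 1) * (sampleCov (y i) p.1 p.2 ω - Γ i p.1 p.2) =
      sumDev y η Γ i (p, ω) - meanDev y η Γ i (p, ω) := by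
  have hN1 : (0 : ℝ) < (N i : ℝ) - 1 := by
    have : (2 : ℝ) ≤ N i := by exact_mod_cast hN
    linarith
  have hs : 0 < √((N i : ℝ) - 1) := Real.sqrt_pos.2 hN1
  have hs2 := Real.mul_self_sqrt hN1.le
  unfold sampleCov sumDev meanDev prodDev sampleMean
  rw [sum_sub_mean_mul (by omega) _ _ (η i p.1) (η i p.2), ← Finset.mul_sum,
    Finset.sum_sub_distrib (s := Finset.univ)
      (f := fun j => (y i j p.1 ω - η i p.1) * (y i j p.2 ω - η i p.2))]
  simp only [Finset.sum_const, Finset.card_univ, Fintype.card_fin, nsmul_eq_mul]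
  generalize ∑ j, (y i j p.1 ω - η i p.1) * (y i j p.2 ω - η i p.2) = A
  generalize ∑ j, (y i j p.1 ω - η i p.1) = B
  generalize ∑ j, (y i j p.2 ω - η i p.2) = B'
  have e : ((N i : ℝ) - 1)⁻¹ = (√((N i : ℝ) - 1))⁻¹ * (√((N i : ℝ) - 1))⁻¹ := by
    rw [← mul_inv, hs2]
  have e3 : √((N i : ℝ) - 1) * Γ i p.1 p.2 =
      (√((N i : ℝ) - 1))⁻¹ * (((N i : ℝ) - 1) * Γ i p.1 p.2) := by
    rw [eq_inv_mul_iff_mul_eq₀ hs.ne', ← mul_assoc, hs2]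
  rw [mul_sub, e3, e, mul_assoc, mul_inv_cancel_left₀ hs.ne']
  ring

variable [MeasurableSpace T] [MeasurableSpace Ω] {P : Measure Ω} [IsProbabilityMeasure P]
  {y : (i : Fin k) → Fin (N i) → T → Ω → ℝ} {η : Fin k → T → ℝ} {Γ : Fin k → T → T → ℝ}

namespace IsSample

/-- Integrating a jointly measurable curve over Ω; the size condition only provides a curve. -/
lemma measurable_mean (hy : IsSample P y η Γ) (i : Fin k) (hN : 2 ≤ N i) :
    Measurable (η i) := by
  have e : η i = fun t => ∫ ω, y i ⟨0, by omega⟩ t ω ∂P := by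
    ext t; rw [hy.mean]
  rw [e]
  exact ((hy.measurable i ⟨0, by omega⟩).stronglyMeasurable.integral_prod_right').measurable

lemma cov_eq_integral (hy : IsSample P y η Γ) (i : Fin k) (j : Fin (N i)) (s t : T) :
    ∫ ω, (y i j s ω - η i s) * (y i j t ω - η i t) ∂P = Γ i s t := by
  rw [← hy.cov i j s t, covariance, hy.mean, hy.mean]

lemma measurable_cov (hy : IsSample P y η Γ) (i : Fin k) (hN : 2 ≤ N i) :
    Measurable fun p : T × T => Γ i p.1 p.2 := by
  have e : (fun p : T × T => Γ i p.1 p.2) = fun p => ∫ ω,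
      (y i ⟨0, by omega⟩ p.1 ω - η i p.1) * (y i ⟨0, by omega⟩ p.2 ω - η i p.2) ∂P := by
    ext p; rw [hy.cov_eq_integral]
  rw [e]
  have hm := hy.measurable i ⟨0, by omega⟩
  have hη := hy.measurable_mean i hN
  have h1 : Measurable fun z : (T × T) × Ω => y i ⟨0, by omega⟩ z.1.1 z.2 :=
    hm.comp (measurable_fst.fst.prodMk measurable_snd)
  have h2 : Measurable fun z : (T × T) × Ω => y i ⟨0, by omega⟩ z.1.2 z.2 :=
    hm.comp (measurable_fst.snd.prodMk measurable_snd)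
  have h3 : Measurable fun z : (T × T) × Ω => (y i ⟨0, by omega⟩ z.1.1 z.2 - η i z.1.1) *
      (y i ⟨0, by omega⟩ z.1.2 z.2 - η i z.1.2) :=
    (h1.sub (hη.comp measurable_fst.fst)).mul (h2.sub (hη.comp measurable_fst.snd))
  exact (h3.stronglyMeasurable.integral_prod_right').measurable

lemma measurable_centered_fst (hy : IsSample P y η Γ) (i : Fin k) (hN : 2 ≤ N i) (j : Fin (N i)) :
    Measurable fun z : (T × T) × Ω => y i j z.1.1 z.2 - η i z.1.1 :=
  ((hy.measurable i j).comp (measurable_fst.fst.prodMk measurable_snd)).sub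
    ((hy.measurable_mean i hN).comp measurable_fst.fst)

lemma measurable_centered_snd (hy : IsSample P y η Γ) (i : Fin k) (hN : 2 ≤ N i) (j : Fin (N i)) :
    Measurable fun z : (T × T) × Ω => y i j z.1.2 z.2 - η i z.1.2 :=
  ((hy.measurable i j).comp (measurable_fst.snd.prodMk measurable_snd)).sub
    ((hy.measurable_mean i hN).comp measurable_fst.snd)

lemma measurable_prodDev (hy : IsSample P y η Γ) (hN : ∀ i, 2 ≤ N i)
    (α : (i : Fin k) × Fin (N i)) : Measurable (prodDev y η Γ α) :=
  ((hy.measurable_centered_fst α.1 (hN _) α.2).mul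
    (hy.measurable_centered_snd α.1 (hN _) α.2)).sub
      ((hy.measurable_cov α.1 (hN _)).comp measurable_fst)

lemma measurable_sumDev (hy : IsSample P y η Γ) (hN : ∀ i, 2 ≤ N i) (i : Fin k) :
    Measurable (sumDev y η Γ i) :=
  Finset.measurable_fun_sum _ fun j _ => (hy.measurable_prodDev hN ⟨i, j⟩).const_mul _

lemma measurable_meanDev (hy : IsSample P y η Γ) (hN : ∀ i, 2 ≤ N i) (i : Fin k) :
    Measurable (meanDev y η Γ i) := by
  refine Measurable.const_mul (Measurable.sub (Measurable.const_mul (Measurable.mul ?_ ?_) _) ?_) _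
  · exact Finset.measurable_fun_sum _ fun j _ => hy.measurable_centered_fst i (hN i) j
  · exact Finset.measurable_fun_sum _ fun j _ => hy.measurable_centered_snd i (hN i) j
  · exact (hy.measurable_cov i (hN i)).comp measurable_fst

lemma integral_centered (hy : IsSample P y η Γ) (i : Fin k) (j : Fin (N i)) (t : T) :
    ∫ ω, y i j t ω - η i t ∂P = 0 := by
  rw [integral_sub ((hy.memLp i j t).integrable (by norm_num)) (integrable_const _), hy.mean]
  simp

lemma hasGaussianLaw_centered (hG : ∀ i j, IsGaussianProcess (y i j) P) (i : Fin k)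
    (j : Fin (N i)) {n : ℕ} (t : Fin n → T) :
    HasGaussianLaw (fun ω m => y i j (t m) ω - η i (t m)) P :=
  hasGaussianLaw_sub_const (hasGaussianLaw_fin_of_isGaussianProcess (hG i j) t)
    (fun m => η i (t m))

lemma hasGaussianLaw_centered_eval (hG : ∀ i j, IsGaussianProcess (y i j) P) (i : Fin k)
    (j : Fin (N i)) (t : T) : HasGaussianLaw (fun ω => y i j t ω - η i t) P :=
  hasGaussianLaw_sub_const ((hG i j).hasGaussianLaw_eval t) (η i t)

/-- Gaussian variables have all finite moments, so Hölder's inequality with exponents 2p, 2p and p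
applies. -/
lemma memLp_centered_mul (hG : ∀ i j, IsGaussianProcess (y i j) P) (i : Fin k)
    (j : Fin (N i)) (s t : T) (p : ENNReal) (hp : p ≠ ⊤) :
    MemLp (fun ω => (y i j s ω - η i s) * (y i j t ω - η i t)) p P := by
  have h := fun t => (hasGaussianLaw_centered_eval (η := η) hG i j t).memLp (p := 2 * p)
    (by finiteness)
  have : ENNReal.HolderTriple (2 * p) (2 * p) p := ⟨by
    rw [← two_mul]
    rcases eq_or_ne p 0 with rfl | h0
    · simp
    rw [ENNReal.mul_inv (by simp) (by simp), ← mul_assoc, ENNReal.mul_inv_cancel (by simp) (by simp),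
      one_mul]⟩
  exact (h t).mul (h s)

lemma memLp_prodDev (hG : ∀ i j, IsGaussianProcess (y i j) P) (α : (i : Fin k) × Fin (N i))
    (p : T × T) (r : ENNReal) (hr : r ≠ ⊤) : MemLp (fun ω => prodDev y η Γ α (p, ω)) r P :=
  (memLp_centered_mul hG α.1 α.2 p.1 p.2 r hr).sub (memLp_const (Γ α.1 p.1 p.2))

lemma integral_prodDev (hy : IsSample P y η Γ) (hG : ∀ i j, IsGaussianProcess (y i j) P)
    (α : (i : Fin k) × Fin (N i)) (p : T × T) : ∫ ω, prodDev y η Γ α (p, ω) ∂P = 0 := by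
  simp only [prodDev]
  rw [integral_sub ((memLp_centered_mul (η := η) hG α.1 α.2 p.1 p.2 1 (by simp)).integrable le_rfl)
    (integrable_const _), hy.cov_eq_integral]
  simp

/-- The fourth moment of a centred Gaussian vector has three pairings. The one inside each product
is cancelled by the subtracted means, and the two crossed ones form `varpi`. -/
lemma integral_prodDev_mul_self (hy : IsSample P y η Γ) (hG : ∀ i j, IsGaussianProcess (y i j) P)
    (α : (i : Fin k) × Fin (N i)) (p q : T × T) :
    ∫ ω, prodDev y η Γ α (p, ω) * prodDev y η Γ α (q, ω) ∂P = varpi (Γ α.1) p q := by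
  obtain ⟨hi, he⟩ := integral_mul_four_of_hasGaussianLaw
    (X := fun m ω => y α.1 α.2 (![p.1, p.2, q.1, q.2] m) ω - η α.1 (![p.1, p.2, q.1, q.2] m))
    (hasGaussianLaw_centered hG α.1 α.2 ![p.1, p.2, q.1, q.2])
    (fun m => hy.integral_centered α.1 α.2 _)
  simp only [Fin.isValue, Matrix.cons_val_zero, Matrix.cons_val_one, Matrix.cons_val,
    hy.cov_eq_integral] at he hi
  have hip := (memLp_centered_mul (η := η) hG α.1 α.2 p.1 p.2 1 (by simp)).integrable le_rfl
  have hiq := (memLp_centered_mul (η := η) hG α.1 α.2 q.1 q.2 1 (by simp)).integrable le_rfl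
  have e : ∀ ω, prodDev y η Γ α (p, ω) * prodDev y η Γ α (q, ω) =
      (y α.1 α.2 p.1 ω - η α.1 p.1) * (y α.1 α.2 p.2 ω - η α.1 p.2) *
        ((y α.1 α.2 q.1 ω - η α.1 q.1) * (y α.1 α.2 q.2 ω - η α.1 q.2))
      + Γ α.1 p.1 p.2 * Γ α.1 q.1 q.2
      - (Γ α.1 q.1 q.2 * ((y α.1 α.2 p.1 ω - η α.1 p.1) * (y α.1 α.2 p.2 ω - η α.1 p.2))
      + Γ α.1 p.1 p.2 * ((y α.1 α.2 q.1 ω - η α.1 q.1) * (y α.1 α.2 q.2 ω - η α.1 q.2))) := by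
    intro ω; unfold prodDev; ring
  have hsum := (hip.const_mul (Γ α.1 q.1 q.2)).fun_add (hiq.const_mul (Γ α.1 p.1 p.2))
  simp_rw [e]
  rw [integral_sub (hi.fun_add (integrable_const _)) hsum, integral_add hi (integrable_const _),
    integral_add (hip.const_mul _) (hiq.const_mul _), he]
  simp only [integral_const_mul, hy.cov_eq_integral]
  -- The crossed pairing arises with its arguments in the other order than in `varpi`.
  have hsymm : Γ α.1 p.2 q.1 = Γ α.1 q.1 p.2 := by
    rw [← hy.cov_eq_integral α.1 α.2, ← hy.cov_eq_integral α.1 α.2]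
    congr with ω; ring
  simp [varpi, hsymm]
  ring

lemma indepFun_prodDev (hy : IsSample P y η Γ) {α β : (i : Fin k) × Fin (N i)} (h : α ≠ β)
    (p q : T × T) :
    IndepFun (fun ω => prodDev y η Γ α (p, ω)) (fun ω => prodDev y η Γ β (q, ω)) P := by
  have := (hy.indep.indepFun h).comp
    (φ := fun u : T → ℝ => (u p.1 - η α.1 p.1) * (u p.2 - η α.1 p.2) - Γ α.1 p.1 p.2)
    (ψ := fun u : T → ℝ => (u q.1 - η β.1 q.1) * (u q.2 - η β.1 q.2) - Γ β.1 q.1 q.2)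
    (by fun_prop) (by fun_prop)
  exact this

lemma integral_prodDev_mul_of_ne (hy : IsSample P y η Γ) (hG : ∀ i j, IsGaussianProcess (y i j) P)
    {α β : (i : Fin k) × Fin (N i)} (h : α ≠ β) (p q : T × T) :
    ∫ ω, prodDev y η Γ α (p, ω) * prodDev y η Γ β (q, ω) ∂P = 0 := by
  have e := (hy.indepFun_prodDev h p q).integral_mul_eq_mul_integral
    (memLp_prodDev hG α p 1 (by simp)).1 (memLp_prodDev hG β q 1 (by simp)).1
  simp only [Pi.mul_apply] at e
  rw [e, hy.integral_prodDev hG, zero_mul]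

lemma memLp_sumDev (hG : ∀ i j, IsGaussianProcess (y i j) P) (i : Fin k) (p : T × T) :
    MemLp (fun ω => sumDev y η Γ i (p, ω)) 2 P :=
  memLp_finsetSum _ fun j _ => (memLp_prodDev hG ⟨i, j⟩ p 2 (by simp)).const_mul _

lemma integral_sumDev (hy : IsSample P y η Γ) (hG : ∀ i j, IsGaussianProcess (y i j) P)
    (i : Fin k) (p : T × T) : ∫ ω, sumDev y η Γ i (p, ω) ∂P = 0 := by
  unfold sumDev
  rw [integral_finsetSum _ fun j _ =>
    ((memLp_prodDev hG ⟨i, j⟩ p 1 (by simp)).integrable le_rfl).const_mul _]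
  simp [integral_const_mul, hy.integral_prodDev hG]

lemma integral_sumDev_mul_of_ne (hy : IsSample P y η Γ) (hG : ∀ i j, IsGaussianProcess (y i j) P)
    {i i' : Fin k} (h : i ≠ i') (p q : T × T) :
    ∫ ω, sumDev y η Γ i (p, ω) * sumDev y η Γ i' (q, ω) ∂P = 0 := by
  unfold sumDev
  simp_rw [Finset.sum_mul_sum]
  have hint : ∀ j j', Integrable (fun ω => (√((N i : ℝ) - 1))⁻¹ * prodDev y η Γ ⟨i, j⟩ (p, ω) *
      ((√((N i' : ℝ) - 1))⁻¹ * prodDev y η Γ ⟨i', j'⟩ (q, ω))) P := fun j j' =>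
    ((memLp_prodDev hG ⟨i, j⟩ p 2 (by simp)).const_mul _).integrable_mul
      ((memLp_prodDev hG ⟨i', j'⟩ q 2 (by simp)).const_mul _)
  rw [integral_finsetSum _ fun j _ => integrable_finsetSum _ fun j' _ => hint j j']
  refine Finset.sum_eq_zero fun j _ => ?_
  rw [integral_finsetSum _ fun j' _ => hint j j']
  refine Finset.sum_eq_zero fun j' _ => ?_
  simp_rw [mul_mul_mul_comm _ (prodDev y η Γ ⟨i, j⟩ _)]
  rw [integral_const_mul, hy.integral_prodDev_mul_of_ne hG (by simp [h]), mul_zero]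

lemma integral_sumDev_mul_self (hy : IsSample P y η Γ) (hG : ∀ i j, IsGaussianProcess (y i j) P)
    (hN : ∀ i, 2 ≤ N i) (i : Fin k) (p q : T × T) :
    ∫ ω, sumDev y η Γ i (p, ω) * sumDev y η Γ i (q, ω) ∂P =
      (N i : ℝ) / ((N i : ℝ) - 1) * varpi (Γ i) p q := by
  have hN1 : (0 : ℝ) ≤ (N i : ℝ) - 1 := by
    have : (2 : ℝ) ≤ N i := by exact_mod_cast hN i
    linarith
  unfold sumDev
  rw [integral_sum_mul_sum_of_orthogonal
    (fun j => (memLp_prodDev hG ⟨i, j⟩ p 2 (by simp)).const_mul _)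
    (fun j => (memLp_prodDev hG ⟨i, j⟩ q 2 (by simp)).const_mul _)]
  · simp_rw [mul_mul_mul_comm _ (prodDev y η Γ ⟨i, _⟩ _), integral_const_mul,
      hy.integral_prodDev_mul_self hG, ← mul_inv, Real.mul_self_sqrt hN1]
    simp
    ring
  · intro j j' hj
    simp_rw [mul_mul_mul_comm _ (prodDev y η Γ ⟨i, j⟩ _)]
    rw [integral_const_mul, hy.integral_prodDev_mul_of_ne hG (by simpa using hj), mul_zero]

/-- Only uniformity in p and in the sample size matters, so the eighth moment of the standard normal
is left unevaluated. -/
lemma integral_prodDev_pow_four_le (hy : IsSample P y η Γ)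
    (hG : ∀ i j, IsGaussianProcess (y i j) P) {C : ℝ} (hC : ∀ i s t, |Γ i s t| ≤ C)
    (α : (i : Fin k) × Fin (N i)) (p : T × T) :
    ∫ ω, prodDev y η Γ α (p, ω) ^ 4 ∂P ≤
      8 * C ^ 4 * (∫ x, x ^ 8 ∂(gaussianReal 0 1)) + 8 * C ^ 4 := by
  have hC0 : 0 ≤ C := (abs_nonneg _).trans (hC α.1 p.1 p.1)
  have hg : ∀ t, HasGaussianLaw (fun ω => y α.1 α.2 t ω - η α.1 t) P :=
    fun t => hasGaussianLaw_centered_eval hG α.1 α.2 t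
  have h8 : ∀ t, ∫ ω, (y α.1 α.2 t ω - η α.1 t) ^ 8 ∂P =
      Γ α.1 t t ^ 4 * ∫ x, x ^ 8 ∂(gaussianReal 0 1) := by
    intro t
    have := integral_pow_of_hasGaussianLaw (hg t) (hy.integral_centered α.1 α.2 t) 4
    rw [show 2 * 4 = 8 from rfl] at this
    rw [this]
    congr 2
    rw [← hy.cov_eq_integral α.1 α.2]
    congr with ω; ring
  have h8i : ∀ t, Integrable (fun ω => (y α.1 α.2 t ω - η α.1 t) ^ 8) P :=
    fun t => integrable_pow_of_hasGaussianLaw (hg t) 8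
  have hM : 0 ≤ ∫ x, x ^ 8 ∂(gaussianReal 0 1) := integral_nonneg fun x => by positivity
  have hΓ4 : ∀ s t, Γ α.1 s t ^ 4 ≤ C ^ 4 := fun s t => by
    have := pow_le_pow_left₀ (abs_nonneg _) (hC α.1 s t) 4
    rwa [Even.pow_abs (by decide)] at this
  calc ∫ ω, prodDev y η Γ α (p, ω) ^ 4 ∂P
      ≤ ∫ ω, (4 * (y α.1 α.2 p.1 ω - η α.1 p.1) ^ 8 + 4 * (y α.1 α.2 p.2 ω - η α.1 p.2) ^ 8
          + 8 * C ^ 4) ∂P := by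
        refine integral_mono_of_nonneg (ae_of_all _ fun ω => by positivity)
          ((((h8i _).const_mul 4).add ((h8i _).const_mul 4)).add (integrable_const _))
          (ae_of_all _ fun ω => ?_)
        -- Convexity of the fourth power, then 2u⁴v⁴ ≤ u⁸ + v⁸.
        have key : ∀ u v g : ℝ, (u * v - g) ^ 4 ≤ 4 * u ^ 8 + 4 * v ^ 8 + 8 * g ^ 4 := by
          intro u v g
          have k1 : (u * v - g) ^ 4 ≤ 8 * (u * v) ^ 4 + 8 * g ^ 4 := by
            nlinarith [sq_nonneg (u * v + g), sq_nonneg (u * v - g), sq_nonneg ((u * v) ^ 2 - g ^ 2),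
              sq_nonneg ((u * v - g) ^ 2), sq_nonneg ((u * v + g) ^ 2),
              mul_nonneg (sq_nonneg (u * v + g)) (sq_nonneg (u * v - g))]
          have k2 : 2 * (u * v) ^ 4 ≤ u ^ 8 + v ^ 8 := by
            nlinarith [sq_nonneg (u ^ 4 - v ^ 4)]
          linarith
        have := key (y α.1 α.2 p.1 ω - η α.1 p.1) (y α.1 α.2 p.2 ω - η α.1 p.2) (Γ α.1 p.1 p.2)
        have h4 := hΓ4 p.1 p.2
        simp only [prodDev]
        linarith
    _ ≤ _ := by
        rw [integral_add (((h8i _).const_mul 4).fun_add ((h8i _).const_mul 4)) (integrable_const _),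
          integral_add ((h8i _).const_mul 4) ((h8i _).const_mul 4), integral_const_mul,
          integral_const_mul, h8, h8]
        simp only [integral_const, probReal_univ, smul_eq_mul, one_mul]
        have := mul_le_mul_of_nonneg_right (hΓ4 p.1 p.1) hM
        have := mul_le_mul_of_nonneg_right (hΓ4 p.2 p.2) hM
        linarith

/-- The sum of the centred curves at a point is Gaussian with variance `N i * Γ i t t`, so its
fourth moment divided by (N i)² is at most 3C². The two points contribute 3C² each and the
subtracted covariance 2C², hence the 8; the prefactor gives the decay. -/
lemma meanDev_moments (hy : IsSample P y η Γ) (hG : ∀ i j, IsGaussianProcess (y i j) P)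
    (hN : ∀ i, 2 ≤ N i) {C : ℝ} (hC : ∀ i s t, |Γ i s t| ≤ C) (i : Fin k) (p : T × T) :
    MemLp (fun ω => meanDev y η Γ i (p, ω)) 2 P ∧
    ∫ ω, meanDev y η Γ i (p, ω) ^ 2 ∂P ≤ 8 * C ^ 2 / ((N i : ℝ) - 1) := by
  have hN2 : (2 : ℝ) ≤ N i := by exact_mod_cast hN i
  have hN1 : (0 : ℝ) < (N i : ℝ) - 1 := by linarith
  have hC0 : 0 ≤ C := (abs_nonneg _).trans (hC i p.1 p.1)
  set Z : T → Ω → ℝ := fun t ω => ∑ j, (y i j t ω - η i t) with hZ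
  have hind : ∀ t, iIndepFun (fun j ω => y i j t ω - η i t) P := by
    intro t
    have h1 : iIndepFun (fun (j : Fin (N i)) ω t => y i j t ω) P :=
      hy.indep.precomp (g := fun j : Fin (N i) => (⟨i, j⟩ : (i : Fin k) × Fin (N i)))
        (fun j j' h => by simpa using h)
    exact h1.comp (fun _ u => u t - η i t) (fun _ => by fun_prop)
  have hgj : ∀ t j, HasGaussianLaw (fun ω => y i j t ω - η i t) P :=
    fun t j => hasGaussianLaw_centered_eval hG i j t
  have hgZ : ∀ t, HasGaussianLaw (Z t) P := fun t => (hind t).hasGaussianLaw_fun_sum (hgj t)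
  have hZ0 : ∀ t, ∫ ω, Z t ω ∂P = 0 := by
    intro t
    simp only [hZ]
    rw [integral_finsetSum _ fun j _ => (hgj t j).integrable]
    simp [hy.integral_centered]
  have hZ2 : ∀ t, ∫ ω, Z t ω ^ 2 ∂P = N i * Γ i t t := by
    intro t
    simp only [hZ, sq]
    rw [integral_sum_mul_sum_of_orthogonal (fun j => (hgj t j).memLp (by simp))
      (fun j => (hgj t j).memLp (by simp))]
    · simp [hy.cov_eq_integral]
    · intro j j' hj
      have e := ((hind t).indepFun hj).integral_mul_eq_mul_integral (hgj t j).integrable.1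
        (hgj t j').integrable.1
      simp only [Pi.mul_apply] at e
      rw [e, hy.integral_centered, zero_mul]
  have hZ4 : ∀ t, ∫ ω, Z t ω ^ 4 ∂P = 3 * (N i * Γ i t t) ^ 2 := by
    intro t
    rw [integral_pow_four_of_hasGaussianLaw (hgZ t) (hZ0 t), hZ2]
  have hZ4i : ∀ t, Integrable (fun ω => Z t ω ^ 4) P :=
    fun t => integrable_pow_of_hasGaussianLaw (hgZ t) 4
  have hΓ2 : ∀ s t, Γ i s t ^ 2 ≤ C ^ 2 := fun s t => sq_le_sq' (abs_le.1 (hC i s t)).1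
    (abs_le.1 (hC i s t)).2
  have hpt : ∀ ω, meanDev y η Γ i (p, ω) ^ 2 ≤ ((N i : ℝ) - 1)⁻¹ *
      (((N i : ℝ)⁻¹) ^ 2 * (Z p.1 ω ^ 4 + Z p.2 ω ^ 4) + 2 * C ^ 2) := by
    intro ω
    have e : meanDev y η Γ i (p, ω) ^ 2 = ((N i : ℝ) - 1)⁻¹ *
        ((N i : ℝ)⁻¹ * (Z p.1 ω * Z p.2 ω) - Γ i p.1 p.2) ^ 2 := by
      unfold meanDev
      rw [mul_pow, inv_pow, Real.sq_sqrt hN1.le]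
    rw [e]
    refine mul_le_mul_of_nonneg_left ?_ (by positivity)
    have h1 := hΓ2 p.1 p.2
    have h2 : ((N i : ℝ)⁻¹ * (Z p.1 ω * Z p.2 ω) - Γ i p.1 p.2) ^ 2 ≤
        2 * ((N i : ℝ)⁻¹ * (Z p.1 ω * Z p.2 ω)) ^ 2 + 2 * Γ i p.1 p.2 ^ 2 := by
      nlinarith [sq_nonneg ((N i : ℝ)⁻¹ * (Z p.1 ω * Z p.2 ω) + Γ i p.1 p.2)]
    have h3 : 2 * (Z p.1 ω * Z p.2 ω) ^ 2 ≤ Z p.1 ω ^ 4 + Z p.2 ω ^ 4 := by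
      nlinarith [sq_nonneg (Z p.1 ω ^ 2 - Z p.2 ω ^ 2)]
    have h4 := mul_le_mul_of_nonneg_left h3 (sq_nonneg ((N i : ℝ)⁻¹))
    nlinarith
  have hbi : Integrable (fun ω => ((N i : ℝ) - 1)⁻¹ *
      (((N i : ℝ)⁻¹) ^ 2 * (Z p.1 ω ^ 4 + Z p.2 ω ^ 4) + 2 * C ^ 2)) P :=
    ((((hZ4i _).add (hZ4i _)).const_mul _).add (integrable_const _)).const_mul _
  have hm : AEStronglyMeasurable (fun ω => meanDev y η Γ i (p, ω)) P :=
    ((hy.measurable_meanDev hN i).comp measurable_prodMk_left).aestronglyMeasurable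
  refine ⟨(memLp_two_iff_integrable_sq hm).2 (hbi.mono' (hm.pow 2) (ae_of_all _ fun ω => ?_)), ?_⟩
  · rw [Real.norm_eq_abs, abs_of_nonneg (sq_nonneg _)]
    exact hpt ω
  · refine (integral_mono_of_nonneg (ae_of_all _ fun ω => sq_nonneg _) hbi
      (ae_of_all _ hpt)).trans ?_
    rw [integral_const_mul, integral_add (((hZ4i _).fun_add (hZ4i _)).const_mul _)
      (integrable_const _), integral_const_mul, integral_add (hZ4i _) (hZ4i _), hZ4, hZ4]
    simp only [integral_const, probReal_univ, smul_eq_mul, one_mul]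
    rw [div_eq_inv_mul]
    refine mul_le_mul_of_nonneg_left ?_ (by positivity)
    have h1 := hΓ2 p.1 p.1
    have h2 := hΓ2 p.2 p.2
    have hN0 : (N i : ℝ) ≠ 0 := by linarith
    have e : ((N i : ℝ)⁻¹) ^ 2 * (3 * (N i * Γ i p.1 p.1) ^ 2 + 3 * (N i * Γ i p.2 p.2) ^ 2) =
        3 * Γ i p.1 p.1 ^ 2 + 3 * Γ i p.2 p.2 ^ 2 := by
      field_simp
    rw [e]
    linarith

end IsSample

end Stage


/-! ### Noncentral chi-squared laws and the limiting series -/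

section LimitLaw

open Complex in
-- Completing the square in a Gaussian integral with complex coefficient iu − 1/2. Only the shape
-- matters: the mean enters through the exponential of a multiple of its square, so a product over
-- coordinates depends on the means only through their sum of squares.
lemma exists_integral_exp_sq_gaussianReal (u : ℝ) :
    ∃ A κ : ℂ, ∀ m : ℝ, ∫ x, cexp ((u * x ^ 2 : ℝ) * I) ∂(gaussianReal m 1) =
      A * cexp (κ * (m ^ 2 : ℝ)) := by
  have hb : ((u : ℂ) * I - 1 / 2).re < 0 := by simp
  refine ⟨((√(2 * Real.pi * (1 : NNReal)))⁻¹ : ℝ) * (Real.pi / -((u : ℂ) * I - 1 / 2)) ^ (1 / 2 : ℂ),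
    -1 / 2 - 1 / (4 * ((u : ℂ) * I - 1 / 2)), fun m => ?_⟩
  rw [integral_gaussianReal_eq_integral_smul (by simp)]
  have e : ∀ x : ℝ, gaussianPDFReal m 1 x • cexp ((u * x ^ 2 : ℝ) * I) =
      ((√(2 * Real.pi * (1 : NNReal)))⁻¹ : ℝ) *
        cexp (((u : ℂ) * I - 1 / 2) * x ^ 2 + m * x + (-(m ^ 2) / 2 : ℂ)) := by
    intro x
    rw [gaussianPDFReal_def, real_smul, ofReal_mul, mul_assoc, ofReal_exp, ← Complex.exp_add]
    congr 2
    push_cast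
    ring
  simp_rw [e]
  rw [integral_const_mul, integral_cexp_quadratic hb, ← mul_assoc]
  congr 2
  push_cast
  ring

variable {n : ℕ}

lemma sum_sq_noncentrality (hn : n ≠ 0) {c : ℝ} (hc : 0 ≤ c) :
    ∑ l : Fin n, (if (l : ℕ) = 0 then √c else 0) ^ 2 = c := by
  obtain ⟨m, rfl⟩ := Nat.exists_eq_succ_of_ne_zero hn
  rw [Fin.sum_univ_succ]
  simp [Real.sq_sqrt hc]

lemma measurable_sum_sq {ι : Type*} [Fintype ι] :
    Measurable fun z : ι → ℝ => ∑ l, z l ^ 2 := by fun_prop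

lemma gaussianReal_eq_map_sqrt_mul {v : NNReal} (hv : v ≠ 0) (m : ℝ) :
    gaussianReal m v = (gaussianReal (m / √v) 1).map (√(v : ℝ) * ·) := by
  have hv' : (0 : ℝ) < v := by positivity
  rw [gaussianReal_map_const_mul]
  congr 1
  · rw [mul_div_cancel₀]; positivity
  · ext; simp

open Complex in
/-- The characteristic function of a multiple of a noncentral chi-squared variable. -/
lemma integral_exp_noncentralChiSq (hn : n ≠ 0) {v : NNReal} (hv : v ≠ 0) (m : Fin n → ℝ) (s : ℝ) :
    ∫ x, cexp ((s * (v * x) : ℝ) * I) ∂(noncentralChiSq n ((v : ℝ)⁻¹ * ∑ l, m l ^ 2)) =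
      ∏ l, ∫ w, cexp ((s * w ^ 2 : ℝ) * I) ∂(gaussianReal (m l) v) := by
  obtain ⟨A, κ, h⟩ := exists_integral_exp_sq_gaussianReal (s * v)
  have hv' : (0 : ℝ) < v := by positivity
  have hr : ∀ l, ∫ w, cexp ((s * w ^ 2 : ℝ) * I) ∂(gaussianReal (m l) v) =
      A * cexp (κ * ((m l / √v) ^ 2 : ℝ)) := by
    intro l
    rw [gaussianReal_eq_map_sqrt_mul hv, integral_map (by fun_prop) (by fun_prop), ← h]
    congr with x
    rw [mul_pow, Real.sq_sqrt hv'.le]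
    ring_nf
  simp_rw [hr]
  unfold noncentralChiSq
  rw [integral_map measurable_sum_sq.aemeasurable (by fun_prop)]
  have e : ∀ z : Fin n → ℝ, cexp ((s * (v * ∑ l, z l ^ 2) : ℝ) * I) =
      ∏ l, cexp ((s * v * z l ^ 2 : ℝ) * I) := by
    intro z
    rw [← Complex.exp_sum, ← Finset.sum_mul, ← ofReal_sum, ← Finset.mul_sum, mul_assoc]
  simp_rw [e]
  rw [integral_fintype_prod_eq_prod (f := fun l x => cexp ((s * v * x ^ 2 : ℝ) * I))]
  -- Both sides now depend on the means through their sum of squares only, so concentrating the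
  -- whole noncentrality in the first coordinate changes nothing.
  simp_rw [h, Finset.prod_mul_distrib, ← Complex.exp_sum, ← Finset.mul_sum, ← ofReal_sum]
  rw [sum_sq_noncentrality hn (by positivity)]
  congr 4
  rw [Finset.mul_sum]
  refine Finset.sum_congr rfl fun l _ => ?_
  rw [div_pow, Real.sq_sqrt hv'.le]
  ring

lemma integral_sq_gaussianReal (m : ℝ) (v : NNReal) :
    Integrable (fun x => x ^ 2) (gaussianReal m v) ∧
      ∫ x, x ^ 2 ∂(gaussianReal m v) = v + m ^ 2 := by
  have h2 : MemLp id 2 (gaussianReal m v) := memLp_id_gaussianReal' 2 (by simp)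
  refine ⟨h2.integrable_sq, ?_⟩
  have h := variance_eq_sub h2
  rw [variance_id_gaussianReal] at h
  simp only [Pi.pow_apply, id, integral_id_gaussianReal] at h
  linarith

lemma noncentralChiSq_moments (hn : n ≠ 0) {c : ℝ} (hc : 0 ≤ c) :
    Integrable id (noncentralChiSq n c) ∧ ∫ x, x ∂(noncentralChiSq n c) = n + c ∧
      ∀ᵐ x ∂(noncentralChiSq n c), 0 ≤ x := by
  have hi : ∀ l : Fin n, Integrable (fun z : Fin n → ℝ => z l ^ 2)
      (Measure.pi fun l : Fin n => gaussianReal (if (l : ℕ) = 0 then √c else 0) 1) := by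
    intro l
    exact (measurePreserving_eval (fun l : Fin n =>
      gaussianReal (if (l : ℕ) = 0 then √c else 0) 1) l).integrable_comp_of_integrable
      (integral_sq_gaussianReal _ 1).1
  unfold noncentralChiSq
  refine ⟨?_, ?_, ?_⟩
  · rw [integrable_map_measure (by fun_prop) measurable_sum_sq.aemeasurable]
    exact (integrable_finsetSum Finset.univ fun l _ => hi l :)
  · rw [integral_map measurable_sum_sq.aemeasurable (by fun_prop), integral_finsetSum _ fun l _ => hi l]
    have : ∀ l : Fin n, ∫ z : Fin n → ℝ, z l ^ 2
        ∂(Measure.pi fun l : Fin n => gaussianReal (if (l : ℕ) = 0 then √c else 0) 1) =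
        1 + (if (l : ℕ) = 0 then √c else 0) ^ 2 := by
      intro l
      have h := (measurePreserving_eval
        (fun l : Fin n => gaussianReal (if (l : ℕ) = 0 then √c else 0) 1) l).map_eq
      have h2 := (integral_sq_gaussianReal (if (l : ℕ) = 0 then √c else 0) 1).2
      rw [← h, integral_map (measurable_pi_apply l).aemeasurable (by fun_prop)] at h2
      simpa using h2
    simp_rw [this, Finset.sum_add_distrib, sum_sq_noncentrality hn hc]
    simp
  · rw [ae_map_iff measurable_sum_sq.aemeasurable measurableSet_Ici]
    exact ae_of_all _ fun z => Finset.sum_nonneg fun l _ => sq_nonneg _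

variable {Ω' : Type*} [MeasurableSpace Ω'] {P' : Measure Ω'} [IsProbabilityMeasure P']
  {lam : ℕ → ℝ} {δ : ℕ → ℝ} {A : {r : ℕ // 0 < lam r} → Ω' → ℝ}

/-- The `r`-th term of the limiting series. -/
noncomputable def limitTerm (lam δ : ℕ → ℝ) (A : {r : ℕ // 0 < lam r} → Ω' → ℝ) (r : ℕ) (ω : Ω') :
    ℝ :=
  if h : 0 < lam r then lam r * A ⟨r, h⟩ ω else δ r

/-- A noncentral chi-squared variable has mean n plus its noncentrality; after scaling by λ_r the
formula for the mean also covers the constant terms with λ_r = 0. -/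
lemma limitTerm_moments (hn : n ≠ 0) (hlam : ∀ r, 0 ≤ lam r) (hδ : ∀ r, 0 ≤ δ r)
    (hA : ∀ r : {r : ℕ // 0 < lam r},
      HasLaw (A r) (noncentralChiSq n ((lam r)⁻¹ * δ r)) P') (r : ℕ) :
    Integrable (limitTerm lam δ A r) P' ∧ ∫ ω, limitTerm lam δ A r ω ∂P' = n * lam r + δ r ∧
      ∀ᵐ ω ∂P', 0 ≤ limitTerm lam δ A r ω := by
  unfold limitTerm
  by_cases h : 0 < lam r
  · simp only [h, dite_true]
    obtain ⟨h1, h2, h3⟩ := noncentralChiSq_moments hn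
      (c := (lam r)⁻¹ * δ r) (mul_nonneg (inv_nonneg.2 h.le) (hδ r))
    have hl := hA ⟨r, h⟩
    rw [← hl.map_eq] at h1 h2 h3
    rw [integrable_map_measure (by fun_prop) hl.aemeasurable] at h1
    rw [integral_map hl.aemeasurable (by fun_prop)] at h2
    refine ⟨h1.const_mul _, ?_, ?_⟩
    · rw [integral_const_mul, h2]; field_simp
    · filter_upwards [ae_of_ae_map hl.aemeasurable h3] with ω hω
      exact mul_nonneg h.le hω
  · have h0 : lam r = 0 := le_antisymm (not_lt.1 h) (hlam r)
    simp only [h, dite_false]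
    exact ⟨integrable_const _, by simp [h0], ae_of_all _ fun _ => hδ r⟩

/-- Tonelli: the terms are almost surely nonnegative and their expectations are summable, so the sum
has finite expectation. -/
lemma ae_summable_limitTerm (hn : n ≠ 0) (hlam : ∀ r, 0 ≤ lam r) (hδ : ∀ r, 0 ≤ δ r)
    (hA : ∀ r : {r : ℕ // 0 < lam r},
      HasLaw (A r) (noncentralChiSq n ((lam r)⁻¹ * δ r)) P')
    (hs : Summable fun r => n * lam r + δ r) :
    ∀ᵐ ω ∂P', Summable fun r => limitTerm lam δ A r ω := by
  have hm := fun r => limitTerm_moments hn hlam hδ hA r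
  have hfin : ∑' r, ∫⁻ ω, ENNReal.ofReal (limitTerm lam δ A r ω) ∂P' ≠ ⊤ := by
    have : ∀ r, ∫⁻ ω, ENNReal.ofReal (limitTerm lam δ A r ω) ∂P' =
        ENNReal.ofReal (n * lam r + δ r) := by
      intro r
      rw [← ofReal_integral_eq_lintegral_ofReal (hm r).1 (hm r).2.2, (hm r).2.1]
    simp_rw [this]
    rw [← ENNReal.ofReal_tsum_of_nonneg
      (fun r => add_nonneg (mul_nonneg n.cast_nonneg (hlam r)) (hδ r)) hs]
    simp
  rw [← lintegral_tsum fun r => (hm r).1.1.aemeasurable.ennreal_ofReal] at hfin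
  have hae := ae_lt_top' (AEMeasurable.tsum fun r =>
    (hm r).1.1.aemeasurable.ennreal_ofReal) hfin
  filter_upwards [hae, ae_all_iff.2 fun r => (hm r).2.2] with ω h1 h2
  have := ENNReal.summable_toReal h1.ne
  refine this.congr fun r => ?_
  rw [ENNReal.toReal_ofReal (h2 r)]

/-- The limiting series, split according to the positivity of the eigenvalue. -/
lemma tsum_limitTerm_eq (hlam : ∀ r, 0 ≤ lam r) {ω : Ω'}
    (hs : Summable fun r => limitTerm lam δ A r ω) :
    (Summable fun r : {r : ℕ // 0 < lam r} => lam r * A r ω) ∧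
    (Summable fun r : {r : ℕ // lam r = 0} => δ r) ∧
    (∑' r : {r : ℕ // 0 < lam r}, lam r * A r ω) + ∑' r : {r : ℕ // lam r = 0}, δ r =
      ∑' r, limitTerm lam δ A r ω := by
  have e1 : (fun r : {r : ℕ // 0 < lam r} => lam r * A r ω) =
      (fun r => limitTerm lam δ A r ω) ∘ (Subtype.val : {r : ℕ | 0 < lam r} → ℕ) := by
    ext r
    have h : 0 < lam (r : ℕ) := r.2
    simp only [limitTerm, Function.comp, h, dite_true]
  have hc : {r : ℕ | 0 < lam r}ᶜ = {r : ℕ | lam r = 0} := by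
    ext r
    simp only [Set.mem_compl_iff, Set.mem_ofPred_eq, not_lt]
    exact ⟨fun h => le_antisymm h (hlam r), fun h => h.le⟩
  have e2 : (fun r : {r : ℕ // lam r = 0} => δ r) =
      (fun r => limitTerm lam δ A r ω) ∘ (Subtype.val : {r : ℕ | lam r = 0} → ℕ) := by
    ext r
    have h : lam (r : ℕ) = 0 := r.2
    simp [limitTerm, h]
  have s1 : Summable fun r : {r : ℕ // 0 < lam r} => lam r * A r ω := by
    rw [e1]; exact hs.subtype _
  have s2 : Summable fun r : {r : ℕ // lam r = 0} => δ r := by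
    rw [e2]; exact hs.subtype _
  refine ⟨s1, s2, ?_⟩
  have h := hs.tsum_subtype_add_tsum_subtype_compl {r : ℕ | 0 < lam r}
  rw [hc] at h
  rw [← h]
  congr 1
  · exact congrArg tsum e1
  · exact congrArg tsum e2

open Complex in
-- A normal law of variance 0 is a Dirac mass, so a null eigenvalue contributes the deterministic
-- factor exp(is Σ m²), and one product formula covers both kinds of index.
lemma integral_exp_sum_limitTerm (hn : n ≠ 0) (hlam : ∀ r, 0 ≤ lam r) {m : Fin n → ℕ → ℝ}
    (hind : iIndepFun A P')
    (hA : ∀ r : {r : ℕ // 0 < lam r},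
      HasLaw (A r) (noncentralChiSq n ((lam r)⁻¹ * ∑ l, m l r ^ 2)) P') (R : ℕ) (s : ℝ) :
    ∫ ω, cexp ((s * ∑ r ∈ Finset.range R, limitTerm lam (fun r => ∑ l, m l r ^ 2) A r ω : ℝ) * I)
        ∂P' =
      ∏ r ∈ Finset.range R, ∏ l,
        ∫ w, cexp ((s * w ^ 2 : ℝ) * I) ∂(gaussianReal (m l r) (lam r).toNNReal) := by
  classical
  have hterm : ∀ r, ∫ ω, cexp ((s * limitTerm lam (fun r => ∑ l, m l r ^ 2) A r ω : ℝ) * I) ∂P' =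
      ∏ l, ∫ w, cexp ((s * w ^ 2 : ℝ) * I) ∂(gaussianReal (m l r) (lam r).toNNReal) := by
    intro r
    by_cases h : 0 < lam r
    · have e := integral_exp_noncentralChiSq hn (v := (lam r).toNNReal) (by simpa using h)
        (fun l => m l r) s
      rw [Real.coe_toNNReal _ h.le, ← (hA ⟨r, h⟩).map_eq,
        integral_map (hA ⟨r, h⟩).aemeasurable (by fun_prop)] at e
      rw [← e]
      simp [limitTerm, h]
    · have h0 : lam r = 0 := le_antisymm (not_lt.1 h) (hlam r)
      simp only [limitTerm, h0, lt_irrefl, dite_false, Real.toNNReal_zero, gaussianReal_zero_var,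
        integral_dirac, integral_const, probReal_univ, one_smul]
      rw [← Complex.exp_sum, ← Finset.sum_mul, ← ofReal_sum, Finset.mul_sum]
  simp_rw [← hterm]
  set g : ℕ → Ω' → ℂ := fun r ω =>
    cexp ((s * limitTerm lam (fun r => ∑ l, m l r ^ 2) A r ω : ℝ) * I) with hg
  have e : ∀ ω, cexp ((s * ∑ r ∈ Finset.range R,
      limitTerm lam (fun r => ∑ l, m l r ^ 2) A r ω : ℝ) * I) = ∏ r ∈ Finset.range R, g r ω := by
    intro ω
    rw [hg, ← Complex.exp_sum, ← Finset.sum_mul, ← ofReal_sum, Finset.mul_sum]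
  simp_rw [e]
  -- Independence is available at positive eigenvalues only; the other factors are constants and
  -- leave the expectation.
  have hnot : ∀ r ∈ (Finset.range R).filter (fun r => ¬ 0 < lam r), ∀ ω,
      g r ω = ∫ ω, g r ω ∂P' := by
    intro r hr ω
    have h := (Finset.mem_filter.1 hr).2
    simp [hg, limitTerm, h]
  have hpos : ∫ ω, ∏ r ∈ (Finset.range R).filter (fun r => 0 < lam r), g r ω ∂P' =
      ∏ r ∈ (Finset.range R).filter (fun r => 0 < lam r), ∫ ω, g r ω ∂P' := by
    have hsub : ∀ f : ℕ → ℂ, ∏ r ∈ (Finset.range R).filter (fun r => 0 < lam r), f r =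
        ∏ r : ↥(Finset.subtype (fun r => 0 < lam r) (Finset.range R)), f r := by
      intro f
      rw [← Finset.prod_subtype_eq_prod_filter,
        Finset.prod_coe_sort _ (fun r : {r : ℕ // 0 < lam r} => f r)]
    simp_rw [hsub]
    have hi : iIndepFun (fun (r : {r : ℕ // 0 < lam r}) ω => g r ω) P' := by
      have h := hind.comp (fun r x => cexp ((s * (lam r * x) : ℝ) * I)) (fun r => by fun_prop)
      convert! h using 2 with r
      ext ω
      have hr : 0 < lam (r : ℕ) := r.2
      simp [hg, limitTerm, hr]
    refine (hi.restrict (Finset.subtype (fun r => 0 < lam r)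
      (Finset.range R))).integral_fun_prod_eq_prod_integral fun r => ?_
    have hr : 0 < lam (r : ℕ) := r.1.2
    have := (hA ⟨r, hr⟩).aemeasurable
    simp only [Finset.restrict_def, hg, limitTerm, hr, dite_true]
    exact AEMeasurable.aestronglyMeasurable (by fun_prop)
  simp_rw [← Finset.prod_filter_mul_prod_filter_not (Finset.range R) (fun r => 0 < lam r)]
  rw [← hpos, ← integral_mul_const]
  congr with ω
  rw [Finset.prod_congr rfl fun r hr => hnot r hr ω]

open Complex in
/-- The characteristic functions of the partial sums converge to that of the limiting series. -/
lemma tendsto_integral_exp_sum_limitTerm (hm : ∀ r, AEMeasurable (limitTerm lam δ A r) P')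
    (hs : ∀ᵐ ω ∂P', Summable fun r => limitTerm lam δ A r ω) (s : ℝ) :
    Tendsto (fun R => ∫ ω, cexp ((s * ∑ r ∈ Finset.range R, limitTerm lam δ A r ω : ℝ) * I) ∂P')
      atTop (𝓝 (∫ ω, cexp ((s * ∑' r, limitTerm lam δ A r ω : ℝ) * I) ∂P')) := by
  refine tendsto_integral_of_dominated_convergence (fun _ => 1) (fun R => ?_)
    (integrable_const _) (fun R => ae_of_all _ fun ω => ?_) ?_
  · have := Finset.aemeasurable_fun_sum (Finset.range R) fun r _ => hm r
    exact AEMeasurable.aestronglyMeasurable (by fun_prop)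
  · simp [Complex.norm_exp]
  · filter_upwards [hs] with ω hω
    have h := hω.hasSum.tendsto_sum_nat
    exact (Continuous.tendsto (f := fun x : ℝ => cexp ((s * x : ℝ) * I)) (by fun_prop) _).comp h

end LimitLaw

/-! ### Quadratic forms of bounded kernels and the trace formula -/

section Kernels

variable {S : Type*} [MeasurableSpace S] {μ : Measure S} [IsFiniteMeasure μ]

lemma integrable_kernel_mul {K : S → S → ℝ} (hK : Measurable fun z : S × S => K z.1 z.2) {C : ℝ}
    (hC : ∀ p q, |K p q| ≤ C) {ψ χ : S → ℝ} (hψ : MemLp ψ 2 μ) (hχ : MemLp χ 2 μ) :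
    Integrable (fun z : S × S => K z.1 z.2 * (ψ z.1 * χ z.2)) (μ.prod μ) :=
  ((hψ.integrable (by norm_num)).mul_prod (hχ.integrable (by norm_num))).bdd_mul
    hK.aestronglyMeasurable (ae_of_all _ fun z => hC z.1 z.2)

lemma tendsto_quadForm {K : ℕ → S → S → ℝ} {K' : S → S → ℝ}
    (hK : ∀ ν, Measurable fun z : S × S => K ν z.1 z.2) {C : ℝ} (hC : ∀ ν p q, |K ν p q| ≤ C)
    (hlim : ∀ p q, Tendsto (fun ν => K ν p q) atTop (𝓝 (K' p q))) {ψ : S → ℝ} (hψ : MemLp ψ 2 μ) :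
    Tendsto (fun ν => quadForm μ (K ν) ψ) atTop (𝓝 (quadForm μ K' ψ)) := by
  have hi := (hψ.integrable (by norm_num)).mul_prod (hψ.integrable (by norm_num))
  refine tendsto_integral_of_dominated_convergence (fun z => C * ‖ψ z.1 * ψ z.2‖)
    (fun ν => (integrable_kernel_mul (hK ν) (hC ν) hψ hψ).1) (hi.norm.const_mul C)
    (fun ν => ae_of_all _ fun z => ?_) (ae_of_all _ fun z => (hlim z.1 z.2).mul_const _)
  rw [norm_mul]
  exact mul_le_mul_of_nonneg_right (hC ν z.1 z.2) (norm_nonneg _)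

lemma tendsto_integral_diag {K : ℕ → S → S → ℝ} {K' : S → S → ℝ}
    (hK : ∀ ν, Measurable fun z : S × S => K ν z.1 z.2) {C : ℝ} (hC : ∀ ν p q, |K ν p q| ≤ C)
    (hlim : ∀ p q, Tendsto (fun ν => K ν p q) atTop (𝓝 (K' p q))) :
    Tendsto (fun ν => ∫ p, K ν p p ∂μ) atTop (𝓝 (∫ p, K' p p ∂μ)) :=
  tendsto_integral_of_dominated_convergence (fun _ => C)
    (fun ν => ((hK ν).comp (measurable_id.prodMk measurable_id)).aestronglyMeasurable)
    (integrable_const C) (fun ν => ae_of_all _ fun p => hC ν p p) (ae_of_all _ fun p => hlim p p)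

lemma quadForm_sum_mul {ι : Type*} [Fintype ι] (c : ι → ℝ) {K : ι → S → S → ℝ}
    (hK : ∀ a, Measurable fun z : S × S => K a z.1 z.2) {C : ι → ℝ}
    (hC : ∀ a p q, |K a p q| ≤ C a) {ψ : S → ℝ} (hψ : MemLp ψ 2 μ) :
    quadForm μ (fun p q => ∑ a, c a * K a p q) ψ = ∑ a, c a * quadForm μ (K a) ψ := by
  unfold quadForm
  simp_rw [Finset.sum_mul, mul_assoc]
  rw [integral_finsetSum _ fun a _ => (integrable_kernel_mul (hK a) (hC a) hψ hψ).const_mul _]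
  simp_rw [integral_const_mul]

lemma quadForm_add {K K' : S → S → ℝ} (hK : Measurable fun z : S × S => K z.1 z.2) {C C' : ℝ}
    (hC : ∀ p q, |K p q| ≤ C) (hK' : Measurable fun z : S × S => K' z.1 z.2)
    (hC' : ∀ p q, |K' p q| ≤ C') {ψ : S → ℝ} (hψ : MemLp ψ 2 μ) :
    quadForm μ (fun p q => K p q + K' p q) ψ = quadForm μ K ψ + quadForm μ K' ψ := by
  unfold quadForm
  simp_rw [add_mul]
  exact integral_add (integrable_kernel_mul hK hC hψ hψ) (integrable_kernel_mul hK' hC' hψ hψ)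

lemma quadForm_mul_self (g ψ : S → ℝ) :
    quadForm μ (fun p q => g p * g q) ψ = (∫ p, g p * ψ p ∂μ) ^ 2 := by
  unfold quadForm
  rw [sq, ← integral_prod_mul]
  congr with z
  ring

variable {Ω : Type*} [MeasurableSpace Ω] {P : Measure Ω} [IsProbabilityMeasure P]

lemma integral_integral_sq_eq {F : S × Ω → ℝ} (hF2 : MemLp F 2 (μ.prod P)) {K : S → S → ℝ}
    (hFK : ∀ p q, ∫ ω, F (p, ω) * F (q, ω) ∂P = K p q) :
    ∫ ω, ∫ p, F (p, ω) ^ 2 ∂μ ∂P = ∫ p, K p p ∂μ := by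
  rw [← integral_integral_swap (f := fun p ω => F (p, ω) ^ 2) hF2.integrable_sq]
  congr with p
  rw [← hFK]
  congr with ω
  ring

/-- The trace formula for the covariance kernel of a second order process. -/
lemma hasSum_quadForm (φ : HilbertBasis ℕ ℝ (Lp ℝ 2 μ)) {F : S × Ω → ℝ}
    (hF : Measurable F) (hF2 : MemLp F 2 (μ.prod P)) {K : S → S → ℝ}
    (hFK : ∀ p q, ∫ ω, F (p, ω) * F (q, ω) ∂P = K p q) :
    HasSum (fun r => quadForm μ K (φ r)) (∫ p, K p p ∂μ) := by
  have h := hasSum_integral_sq_integral φ hF hF2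
  rw [integral_integral_sq_eq hF2 hFK] at h
  convert! h using 2 with r
  rw [integral_sq_integral_eq_quadForm hF hF2 (Lp.memLp (φ r))]
  simp_rw [hFK]

end Kernels


/-! ### Diagonalization by the eigenfunctions -/

section Eigen

variable {T : Type*} [MeasureSpace T] [IsFiniteMeasure (volume : Measure T)]
  {lam : ℕ → ℝ} {φ : HilbertBasis ℕ ℝ (Lp ℝ 2 (volume : Measure (T × T)))}
  {K : T × T → T × T → ℝ}

lemma integral_kernel_mul_eigen (hφ : IsEigensystem K lam φ)
    (hK : Measurable fun z : (T × T) × (T × T) => K z.1 z.2) {C : ℝ}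
    (hC : ∀ p q, |K p q| ≤ C) {ψ : T × T → ℝ} (hψ : MemLp ψ 2) (r : ℕ) :
    ∫ z : (T × T) × (T × T), K z.1 z.2 * (ψ z.1 * φ r z.2) ∂(volume.prod volume) =
      lam r * ∫ p, ψ p * φ r p := by
  have hi := integrable_kernel_mul (μ := volume) hK hC hψ (Lp.memLp (φ r))
  rw [integral_prod _ hi, ← integral_const_mul]
  refine integral_congr_ae ?_
  filter_upwards [hφ r] with p hp
  have : ∀ q, K p q * (ψ p * φ r q) = ψ p * (K p q * φ r q) := fun q => by ring
  simp_rw [this, integral_const_mul]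
  rw [hp]
  ring

lemma quadForm_eigen (hφ : IsEigensystem K lam φ)
    (hK : Measurable fun z : (T × T) × (T × T) => K z.1 z.2) {C : ℝ}
    (hC : ∀ p q, |K p q| ≤ C) (r : ℕ) : quadForm volume K (φ r) = lam r := by
  have := integral_kernel_mul_eigen hφ hK hC (Lp.memLp (φ r)) r
  rw [integral_basis_mul_basis] at this
  simpa [quadForm] using this

lemma memLp_sum_mul_basis (R : ℕ) (c : Fin R → ℝ) :
    MemLp (fun p => ∑ r : Fin R, c r * φ r p) 2 :=
  memLp_finsetSum _ fun r _ => (Lp.memLp (φ r)).const_mul _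

lemma integral_sum_mul_basis {R : ℕ} (c : Fin R → ℝ) (r : Fin R) :
    ∫ p, (∑ r' : Fin R, c r' * φ r' p) * φ r p = c r := by
  simp_rw [Finset.sum_mul, mul_assoc]
  rw [integral_finsetSum _ fun (r' : Fin R) _ =>
    (integrable_mul_of_memLp_two (Lp.memLp (φ r')) (Lp.memLp (φ r))).const_mul _]
  simp_rw [integral_const_mul, integral_basis_mul_basis]
  simp [Fin.val_inj]

/-- Applied to `varpi γ`, the vanishing of the mixed terms is what makes limiting coefficients along
different eigenfunctions uncorrelated. -/
lemma quadForm_sum_eigen (hφ : IsEigensystem K lam φ)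
    (hK : Measurable fun z : (T × T) × (T × T) => K z.1 z.2) {C : ℝ}
    (hC : ∀ p q, |K p q| ≤ C) {R : ℕ} (c : Fin R → ℝ) :
    quadForm volume K (fun p => ∑ r : Fin R, c r * φ r p) = ∑ r : Fin R, lam r * c r ^ 2 := by
  have e : ∀ z : (T × T) × (T × T), K z.1 z.2 * ((∑ r : Fin R, c r * φ r z.1) *
      ∑ r : Fin R, c r * φ r z.2) = ∑ r : Fin R, c r * (K z.1 z.2 *
        ((∑ r : Fin R, c r * φ r z.1) * φ r z.2)) := by
    intro z
    rw [Finset.mul_sum, Finset.mul_sum]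
    exact Finset.sum_congr rfl fun r _ => by ring
  unfold quadForm
  simp_rw [e]
  rw [integral_finsetSum _ fun (r : Fin R) _ => (integrable_kernel_mul hK hC
    (memLp_sum_mul_basis (φ := φ) R c) (Lp.memLp (φ r))).const_mul _]
  refine Finset.sum_congr rfl fun r _ => ?_
  rw [integral_const_mul]
  have := integral_kernel_mul_eigen hφ hK hC (memLp_sum_mul_basis (φ := φ) R c) r
  rw [this, integral_sum_mul_basis]
  ring

end Eigen

/-! ### The kernel `varpi` along a line of covariance functions -/

section Varpi

variable {T : Type*}

lemma measurable_varpi [MeasurableSpace T] {γ : T → T → ℝ}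
    (hγ : Measurable fun p : T × T => γ p.1 p.2) :
    Measurable fun z : (T × T) × (T × T) => varpi γ z.1 z.2 := by
  unfold varpi
  have h : ∀ f : (T × T) × (T × T) → T × T, Measurable f →
      Measurable fun z => γ (f z).1 (f z).2 := fun f hf => hγ.comp hf
  exact ((h (fun z => (z.1.1, z.2.1)) (by fun_prop)).mul
    (h (fun z => (z.1.2, z.2.2)) (by fun_prop))).add
    ((h (fun z => (z.1.1, z.2.2)) (by fun_prop)).mul
    (h (fun z => (z.2.1, z.1.2)) (by fun_prop)))

/-- Lagrange interpolation of `varpi` along the line `γ + c d`. -/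
lemma varpi_eq_sum_lagrange (γ d : T → T → ℝ) {c₁ c₂ c₃ : ℝ} (h₁₂ : c₁ ≠ c₂) (h₁₃ : c₁ ≠ c₃)
    (h₂₃ : c₂ ≠ c₃) (p q : T × T) :
    varpi γ p q = c₂ * c₃ / ((c₁ - c₂) * (c₁ - c₃)) * varpi (fun s t => γ s t + c₁ * d s t) p q +
      c₁ * c₃ / ((c₂ - c₁) * (c₂ - c₃)) * varpi (fun s t => γ s t + c₂ * d s t) p q +
      c₁ * c₂ / ((c₃ - c₁) * (c₃ - c₂)) * varpi (fun s t => γ s t + c₃ * d s t) p q := by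
  -- The kernel of γ + c d is a polynomial of degree at most two in c, so its value at c = 0 is
  -- determined by three distinct nodes; the coefficients are the Lagrange weights at 0.
  have a := sub_ne_zero.2 h₁₂
  have b := sub_ne_zero.2 h₁₃
  have c := sub_ne_zero.2 h₂₃
  have a' := sub_ne_zero.2 h₁₂.symm
  have b' := sub_ne_zero.2 h₁₃.symm
  have c' := sub_ne_zero.2 h₂₃.symm
  rw [show c₂ - c₁ = -(c₁ - c₂) by ring, show c₃ - c₁ = -(c₁ - c₃) by ring,
    show c₃ - c₂ = -(c₂ - c₃) by ring]
  unfold varpi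
  field_simp
  ring

end Varpi

/-! ### Moments of integral functionals -/

section Functionals

variable {S : Type*} [MeasurableSpace S] {μ : Measure S} [IsFiniteMeasure μ]
  {Ω : Type*} [MeasurableSpace Ω] {P : Measure Ω} [IsProbabilityMeasure P]

lemma integral_integral_mul_eq_zero {F : S × Ω → ℝ} (hF2 : MemLp F 2 (μ.prod P))
    (h0 : ∀ p, ∫ ω, F (p, ω) ∂P = 0) {ψ : S → ℝ} (hψ : MemLp ψ 2 μ) :
    ∫ ω, ∫ p, F (p, ω) * ψ p ∂μ ∂P = 0 := by
  have hψ' : MemLp (fun z : S × Ω => ψ z.1) 2 (μ.prod P) := hψ.comp_fst P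
  rw [← integral_integral_swap (f := fun p ω => F (p, ω) * ψ p) (hF2.integrable_mul hψ')]
  simp [integral_mul_const, h0]

/-- Cauchy–Schwarz twice: once against ψ, once against the constant 1 on a finite measure space. -/
lemma integral_integral_mul_pow_four_le {F : S × Ω → ℝ} (hF : Measurable F)
    (hF2 : MemLp F 2 (μ.prod P)) (hi : ∀ p, Integrable (fun ω => F (p, ω) ^ 4) P) {C : ℝ}
    (hC : ∀ p, ∫ ω, F (p, ω) ^ 4 ∂P ≤ C) {ψ : S → ℝ} (hψ : MemLp ψ 2 μ) :
    Integrable (fun ω => (∫ p, F (p, ω) * ψ p ∂μ) ^ 4) P ∧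
    ∫ ω, (∫ p, F (p, ω) * ψ p ∂μ) ^ 4 ∂P ≤
      (∫ p, ψ p ^ 2 ∂μ) ^ 2 * (μ.real Set.univ * (μ.real Set.univ * C)) := by
  have hF4 : Integrable (fun z => F z ^ 4) (μ.prod P) :=
    integrable_prod_of_integral_le (hF.pow_const 4) (fun z => by positivity) hi hC
  have hF4ω : Integrable (fun ω => ∫ p, F (p, ω) ^ 4 ∂μ) P := hF4.integral_prod_right
  have hpt : ∀ᵐ ω ∂P, (∫ p, F (p, ω) * ψ p ∂μ) ^ 4 ≤
      (∫ p, ψ p ^ 2 ∂μ) ^ 2 * (μ.real Set.univ * ∫ p, F (p, ω) ^ 4 ∂μ) := by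
    filter_upwards [memLp_two_section hF hF2, hF4.prod_left_ae] with ω h2 h4
    have a1 := sq_integral_mul_le h2 hψ
    have h22 : MemLp (fun p => F (p, ω) ^ 2) 2 μ := by
      refine (memLp_two_iff_integrable_sq
        ((hF.comp measurable_prodMk_right).pow_const 2).aestronglyMeasurable).2 ?_
      simp only [Function.comp_apply, ← pow_mul]
      exact h4
    have a2 := sq_integral_mul_le h22 (memLp_const (1 : ℝ))
    simp only [mul_one, ← pow_mul, one_pow, integral_const, smul_eq_mul] at a2
    have a3 := pow_le_pow_left₀ (sq_nonneg _) a1 2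
    rw [← pow_mul, mul_pow] at a3
    refine a3.trans ?_
    rw [mul_comm]
    refine mul_le_mul_of_nonneg_left ?_ (sq_nonneg _)
    rw [mul_comm (μ.real Set.univ)]
    exact a2
  have hb : Integrable (fun ω => (∫ p, ψ p ^ 2 ∂μ) ^ 2 *
      (μ.real Set.univ * ∫ p, F (p, ω) ^ 4 ∂μ)) P := (hF4ω.const_mul _).const_mul _
  have hm := (memLp_two_integral_mul hF hF2 hψ).1.pow 4
  refine ⟨hb.mono' hm ?_, ?_⟩
  · filter_upwards [hpt] with ω hω
    rw [Real.norm_eq_abs, abs_of_nonneg (by positivity)]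
    exact hω
  · refine (integral_mono_of_nonneg (ae_of_all _ fun ω => by positivity) hb hpt).trans ?_
    rw [integral_const_mul, integral_const_mul,
      ← integral_integral_swap (f := fun p ω => F (p, ω) ^ 4) hF4]
    gcongr
    have := integral_mono_of_nonneg (μ := μ) (f := fun p => ∫ ω, F (p, ω) ^ 4 ∂P) (g := fun _ => C)
      (ae_of_all _ fun p => integral_nonneg fun ω => by positivity) (integrable_const C)
      (ae_of_all _ hC)
    simpa using this

end Functionals

/-! ### Normal approximation and rotated fluctuations at fixed sample sizes -/

section StageLimit

variable {T Ω : Type*} [MeasureSpace T] [IsFiniteMeasure (volume : Measure T)]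
  [MeasurableSpace Ω] {k : ℕ} {N : Fin k → ℕ} {P : Measure Ω} [IsProbabilityMeasure P]
  {y : (i : Fin k) → Fin (N i) → T → Ω → ℝ} {η : Fin k → T → ℝ} {Γ : Fin k → T → T → ℝ}
  {d : Fin k → T → T → ℝ} {U : Matrix (Fin k) (Fin k) ℝ}

lemma two_le_cast {n : ℕ} (hn : 2 ≤ n) : (2 : ℝ) ≤ n := by exact_mod_cast hn

lemma div_sub_one_mem {n : ℕ} (hn : 2 ≤ n) :
    0 ≤ (n : ℝ) / ((n : ℝ) - 1) ∧ (n : ℝ) / ((n : ℝ) - 1) ≤ 2 := by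
  have := two_le_cast hn
  constructor
  · exact div_nonneg (by linarith) (by linarith)
  · rw [div_le_iff₀ (by linarith)]; linarith

namespace IsSample

lemma memLp_prodDev_prod (hy : IsSample P y η Γ) (hG : ∀ i j, IsGaussianProcess (y i j) P)
    (hN : ∀ i, 2 ≤ N i) {C : ℝ} (hC : ∀ i s t, |Γ i s t| ≤ C) (α : (i : Fin k) × Fin (N i)) :
    MemLp (prodDev y η Γ α) 2 ((volume : Measure (T × T)).prod P) := by
  refine memLp_two_prod (hy.measurable_prodDev hN α)
    (fun p => memLp_prodDev hG α p 2 (by simp)) (C := 2 * C ^ 2) fun p => ?_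
  have := hy.integral_prodDev_mul_self hG α p p
  simp_rw [sq]
  rw [this, ← sq]
  exact (le_abs_self _).trans (abs_varpi_le (hC α.1) p p)

lemma memLp_sumDev_prod (hy : IsSample P y η Γ) (hG : ∀ i j, IsGaussianProcess (y i j) P)
    (hN : ∀ i, 2 ≤ N i) {C : ℝ} (hC : ∀ i s t, |Γ i s t| ≤ C) (i : Fin k) :
    MemLp (sumDev y η Γ i) 2 ((volume : Measure (T × T)).prod P) :=
  memLp_finsetSum _ fun j _ => (hy.memLp_prodDev_prod hG hN hC ⟨i, j⟩).const_mul _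

lemma iIndepFun_integral_prodDev (hy : IsSample P y η Γ)
    (hG : ∀ i j, IsGaussianProcess (y i j) P) (hN : ∀ i, 2 ≤ N i) {C : ℝ}
    (hC : ∀ i s t, |Γ i s t| ≤ C) {ψ : Fin k → T × T → ℝ} (hψ : ∀ i, MemLp (ψ i) 2) :
    iIndepFun (fun (α : (i : Fin k) × Fin (N i)) ω =>
      ∫ p, prodDev y η Γ α (p, ω) * ψ α.1 p) P := by
  refine iIndepFun_integral_mul (Y := fun α ω t => y α.1 α.2 t ω) (fun α => ?_) hy.indep
    (fun α => hy.measurable_prodDev hN α) (fun α => hy.memLp_prodDev_prod hG hN hC α)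
    (fun α p => ?_) (fun α => hψ α.1)
  · exact measurable_pi_lambda _ fun t => (hy.measurable α.1 α.2).comp measurable_prodMk_left
  · have : Measurable fun u : T → ℝ =>
        (u p.1 - η α.1 p.1) * (u p.2 - η α.1 p.2) - Γ α.1 p.1 p.2 := by fun_prop
    exact this.comp (comap_measurable (fun ω t => y α.1 α.2 t ω))

open Complex in
/-- Normal approximation for a linear functional of the fluctuations. -/
lemma norm_integral_exp_sumDev_sub_le (hy : IsSample P y η Γ)
    (hG : ∀ i j, IsGaussianProcess (y i j) P) (hN : ∀ i, 2 ≤ N i) {C : ℝ}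
    (hC : ∀ i s t, |Γ i s t| ≤ C) {ψ : Fin k → T × T → ℝ} (hψ : ∀ i, MemLp (ψ i) 2) :
    ‖∫ ω, cexp ((∑ i, ∫ p, sumDev y η Γ i (p, ω) * ψ i p : ℝ) * I) ∂P -
      cexp ((-(∑ i, (N i : ℝ) / ((N i : ℝ) - 1) * quadForm volume (varpi (Γ i)) (ψ i)) / 2 : ℝ))‖ ≤
    ∑ i, (N i : ℝ) * (2 * (√((N i : ℝ) - 1))⁻¹ ^ 3 * (quadForm volume (varpi (Γ i)) (ψ i) +
      (∫ p, ψ i p ^ 2) ^ 2 * (volume.real (Set.univ : Set (T × T)) *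
        (volume.real (Set.univ : Set (T × T)) *
          (8 * C ^ 4 * (∫ x, x ^ 8 ∂(gaussianReal 0 1)) + 8 * C ^ 4)))) +
      (√((N i : ℝ) - 1))⁻¹ ^ 4 * quadForm volume (varpi (Γ i)) (ψ i) ^ 2) := by
  have hF := fun α => hy.measurable_prodDev hN α
  have hF2 := fun α => hy.memLp_prodDev_prod hG hN hC α
  set ξ : (i : Fin k) × Fin (N i) → Ω → ℝ := fun α ω => ∫ p, prodDev y η Γ α (p, ω) * ψ α.1 p
    with hξ
  have h4 := fun α : (i : Fin k) × Fin (N i) => integral_integral_mul_pow_four_le (hF α) (hF2 α)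
    (fun p => by
      have := (memLp_prodDev (Γ := Γ) (η := η) hG α p 4 (by simp)).integrable_norm_pow'
      refine this.mono' (((hF α).comp measurable_prodMk_left).pow_const 4).aestronglyMeasurable
        (ae_of_all _ fun ω => ?_)
      simp)
    (fun p => hy.integral_prodDev_pow_four_le hG hC α p) (hψ α.1)
  have h2 : ∀ α, ∫ ω, ξ α ω ^ 2 ∂P = quadForm volume (varpi (Γ α.1)) (ψ α.1) := by
    intro α
    rw [hξ, integral_sq_integral_eq_quadForm (hF α) (hF2 α) (hψ α.1)]
    simp_rw [hy.integral_prodDev_mul_self hG α]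
  have key := norm_integral_exp_sum_sub_le (a := fun α => (√((N α.1 : ℝ) - 1))⁻¹)
    (hy.iIndepFun_integral_prodDev hG hN hC hψ)
    (fun α => (memLp_two_integral_mul (hF α) (hF2 α) (hψ α.1)).1.aemeasurable)
    (fun α => integral_integral_mul_eq_zero (hF2 α) (hy.integral_prodDev hG α) (hψ α.1)) h2
    (fun α => (h4 α).1) (fun α => (h4 α).2)
  -- Interchanging the finite sum with the integral requires square integrable sections, which holds
  -- for almost every ω.
  have e1 : ∫ ω, cexp ((∑ i, ∫ p, sumDev y η Γ i (p, ω) * ψ i p : ℝ) * I) ∂P =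
      ∫ ω, cexp ((∑ α : (i : Fin k) × Fin (N i), (√((N α.1 : ℝ) - 1))⁻¹ * ξ α ω : ℝ) * I) ∂P := by
    refine integral_congr_ae ?_
    have hsec : ∀ᵐ ω ∂P, ∀ α, MemLp (fun p => prodDev y η Γ α (p, ω)) 2 volume :=
      ae_all_iff.2 fun α => memLp_two_section (hF α) (hF2 α)
    filter_upwards [hsec] with ω hω
    congr 3
    rw [Fintype.sum_sigma]
    refine Finset.sum_congr rfl fun i _ => ?_
    unfold sumDev
    simp_rw [Finset.sum_mul, mul_assoc]
    rw [integral_finsetSum _ fun j _ =>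
      (integrable_mul_of_memLp_two (hω ⟨i, j⟩) (hψ i)).const_mul _]
    simp_rw [integral_const_mul]
    rfl
  have hsq : ∀ i, (√((N i : ℝ) - 1))⁻¹ ^ 2 = ((N i : ℝ) - 1)⁻¹ := fun i => by
    have := two_le_cast (hN i)
    rw [inv_pow, Real.sq_sqrt (by linarith)]
  have e2 : ∑ α : (i : Fin k) × Fin (N i), (√((N α.1 : ℝ) - 1))⁻¹ ^ 2 *
      quadForm volume (varpi (Γ α.1)) (ψ α.1) =
      ∑ i, (N i : ℝ) / ((N i : ℝ) - 1) * quadForm volume (varpi (Γ i)) (ψ i) := by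
    rw [Fintype.sum_sigma]
    refine Finset.sum_congr rfl fun i _ => ?_
    simp only [Finset.sum_const, Finset.card_univ, Fintype.card_fin, nsmul_eq_mul, hsq]
    ring
  rw [e1, ← e2]
  refine key.trans (le_of_eq ?_)
  rw [Fintype.sum_sigma]
  refine Finset.sum_congr rfl fun i _ => ?_
  simp only [Finset.sum_const, Finset.card_univ, Fintype.card_fin, nsmul_eq_mul, abs_inv,
    abs_of_nonneg (Real.sqrt_nonneg _)]

end IsSample

/-- The rotated fluctuations of the sample covariance functions, with their deterministic part. -/
noncomputable def rotatedSum (U : Matrix (Fin k) (Fin k) ℝ)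
    (y : (i : Fin k) → Fin (N i) → T → Ω → ℝ) (η : Fin k → T → ℝ) (Γ d : Fin k → T → T → ℝ)
    (l : Fin (k - 1)) (z : (T × T) × Ω) : ℝ :=
  ∑ i, U i (Fin.castLE (Nat.sub_le k 1) l) * sumDev y η Γ i z + rotatedDev U d l z.1

/-- The second moment kernel of `rotatedSum`. -/
noncomputable def rotatedKernel (U : Matrix (Fin k) (Fin k) ℝ) (N : Fin k → ℕ)
    (Γ d : Fin k → T → T → ℝ) (l : Fin (k - 1)) (p q : T × T) : ℝ :=
  ∑ i, U i (Fin.castLE (Nat.sub_le k 1) l) ^ 2 * ((N i : ℝ) / ((N i : ℝ) - 1)) * varpi (Γ i) p q +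
    rotatedDev U d l p * rotatedDev U d l q

lemma rotatedDev_eq (l : Fin (k - 1)) (p : T × T) :
    rotatedDev U d l p = ∑ i, U i (Fin.castLE (Nat.sub_le k 1) l) * d i p.1 p.2 := rfl

lemma rotatedSum_eq (l : Fin (k - 1)) (z : (T × T) × Ω) :
    rotatedSum U y η Γ d l z = ∑ i, U i (Fin.castLE (Nat.sub_le k 1) l) *
      (sumDev y η Γ i z + d i z.1.1 z.1.2) := by
  simp_rw [rotatedSum, rotatedDev_eq, mul_add, Finset.sum_add_distrib]

lemma measurable_rotatedDev (hd : ∀ i, Measurable fun p : T × T => d i p.1 p.2)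
    (l : Fin (k - 1)) : Measurable (rotatedDev U d l) := by
  have : rotatedDev U d l = fun p => ∑ i, U i (Fin.castLE (Nat.sub_le k 1) l) * d i p.1 p.2 := rfl
  rw [this]
  exact Finset.measurable_fun_sum _ fun i _ => (hd i).const_mul _

lemma abs_rotatedDev_le {D : ℝ} (hD : ∀ i s t, |d i s t| ≤ D) (l : Fin (k - 1)) (p : T × T) :
    |rotatedDev U d l p| ≤ ∑ i, |U i (Fin.castLE (Nat.sub_le k 1) l)| * D := by
  rw [rotatedDev_eq]
  refine (Finset.abs_sum_le_sum_abs _ _).trans (Finset.sum_le_sum fun i _ => ?_)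
  rw [abs_mul]
  exact mul_le_mul_of_nonneg_left (hD i _ _) (abs_nonneg _)

lemma abs_rotatedKernel_le (hN : ∀ i, 2 ≤ N i) {C D : ℝ} (hC : ∀ i s t, |Γ i s t| ≤ C)
    (hD : ∀ i s t, |d i s t| ≤ D) (l : Fin (k - 1)) (p q : T × T) :
    |rotatedKernel U N Γ d l p q| ≤
      ∑ i, U i (Fin.castLE (Nat.sub_le k 1) l) ^ 2 * 2 * (2 * C ^ 2) +
        (∑ i, |U i (Fin.castLE (Nat.sub_le k 1) l)| * D) ^ 2 := by
  unfold rotatedKernel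
  refine (abs_add_le _ _).trans (add_le_add ?_ ?_)
  · refine (Finset.abs_sum_le_sum_abs _ _).trans (Finset.sum_le_sum fun i _ => ?_)
    obtain ⟨h0, h2⟩ := div_sub_one_mem (hN i)
    rw [abs_mul, abs_mul, abs_of_nonneg (sq_nonneg _), abs_of_nonneg h0]
    have := abs_varpi_le (hC i) p q
    gcongr
  · rw [abs_mul, sq]
    exact mul_le_mul (abs_rotatedDev_le hD l p) (abs_rotatedDev_le hD l q) (abs_nonneg _)
      ((abs_nonneg _).trans (abs_rotatedDev_le hD l p))

namespace IsSample

lemma measurable_rotatedKernel (hy : IsSample P y η Γ) (hN : ∀ i, 2 ≤ N i)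
    (hd : ∀ i, Measurable fun p : T × T => d i p.1 p.2) (l : Fin (k - 1)) :
    Measurable fun z : (T × T) × (T × T) => rotatedKernel U N Γ d l z.1 z.2 :=
  (Finset.measurable_fun_sum _ fun i _ =>
    (measurable_varpi (hy.measurable_cov i (hN i))).const_mul _).add
    (((measurable_rotatedDev hd l).comp measurable_fst).mul
      ((measurable_rotatedDev hd l).comp measurable_snd))

lemma measurable_rotatedSum (hy : IsSample P y η Γ) (hN : ∀ i, 2 ≤ N i)
    (hd : ∀ i, Measurable fun p : T × T => d i p.1 p.2) (l : Fin (k - 1)) :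
    Measurable (rotatedSum U y η Γ d l) :=
  (Finset.measurable_fun_sum _ fun i _ => (hy.measurable_sumDev hN i).const_mul _).add
    ((measurable_rotatedDev hd l).comp measurable_fst)

lemma memLp_rotatedSum (hG : ∀ i j, IsGaussianProcess (y i j) P) (l : Fin (k - 1)) (p : T × T) :
    MemLp (fun ω => rotatedSum U y η Γ d l (p, ω)) 2 P := by
  have h : MemLp (fun ω => ∑ i, U i (Fin.castLE (Nat.sub_le k 1) l) * sumDev y η Γ i (p, ω)) 2 P :=
    memLp_finsetSum _ fun i _ => (memLp_sumDev hG i p).const_mul _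
  exact h.add (memLp_const (rotatedDev U d l p))

/-- Distinct samples are uncorrelated and the random part is centred, so only the diagonal terms and
the product of the deterministic parts survive. -/
lemma integral_rotatedSum_mul (hy : IsSample P y η Γ) (hG : ∀ i j, IsGaussianProcess (y i j) P)
    (hN : ∀ i, 2 ≤ N i) (l : Fin (k - 1)) (p q : T × T) :
    ∫ ω, rotatedSum U y η Γ d l (p, ω) * rotatedSum U y η Γ d l (q, ω) ∂P =
      rotatedKernel U N Γ d l p q := by
  set V : T × T → Ω → ℝ := fun p ω =>
    ∑ i, U i (Fin.castLE (Nat.sub_le k 1) l) * sumDev y η Γ i (p, ω) with hV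
  have hV2 : ∀ p, MemLp (V p) 2 P := fun p =>
    memLp_finsetSum _ fun i _ => (memLp_sumDev hG i p).const_mul _
  have hVi : ∀ p, Integrable (V p) P := fun p => (hV2 p).integrable (by norm_num)
  have hV0 : ∀ p, ∫ ω, V p ω ∂P = 0 := by
    intro p
    simp only [hV]
    rw [integral_finsetSum _ fun i _ =>
      ((memLp_sumDev hG i p).integrable (by norm_num)).const_mul _]
    simp [integral_const_mul, hy.integral_sumDev hG]
  have hVV : ∫ ω, V p ω * V q ω ∂P = ∑ i, U i (Fin.castLE (Nat.sub_le k 1) l) ^ 2 *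
      ((N i : ℝ) / ((N i : ℝ) - 1)) * varpi (Γ i) p q := by
    simp only [hV]
    rw [integral_sum_mul_sum_of_orthogonal (fun i => (memLp_sumDev hG i p).const_mul _)
      (fun i => (memLp_sumDev hG i q).const_mul _)]
    · refine Finset.sum_congr rfl fun i _ => ?_
      simp_rw [mul_mul_mul_comm _ (sumDev y η Γ i _)]
      rw [integral_const_mul, hy.integral_sumDev_mul_self hG hN]
      ring
    · intro i j hij
      simp_rw [mul_mul_mul_comm _ (sumDev y η Γ i _)]
      rw [integral_const_mul, hy.integral_sumDev_mul_of_ne hG hij, mul_zero]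
  have e : ∀ ω, rotatedSum U y η Γ d l (p, ω) * rotatedSum U y η Γ d l (q, ω) =
      V p ω * V q ω + (rotatedDev U d l q * V p ω + rotatedDev U d l p * V q ω) +
        rotatedDev U d l p * rotatedDev U d l q := by
    intro ω
    simp only [rotatedSum, hV]
    ring
  have i1 := integrable_mul_of_memLp_two (hV2 p) (hV2 q)
  have i2 := ((hVi p).const_mul (rotatedDev U d l q)).fun_add
    ((hVi q).const_mul (rotatedDev U d l p))
  simp_rw [e]
  rw [integral_add (i1.fun_add i2) (integrable_const _), integral_add i1 i2,
    integral_add ((hVi p).const_mul _) ((hVi q).const_mul _), hVV]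
  simp [integral_const_mul, hV0, rotatedKernel]

lemma memLp_rotatedSum_prod (hy : IsSample P y η Γ) (hG : ∀ i j, IsGaussianProcess (y i j) P)
    (hN : ∀ i, 2 ≤ N i) {C D : ℝ} (hC : ∀ i s t, |Γ i s t| ≤ C)
    (hd : ∀ i, Measurable fun p : T × T => d i p.1 p.2)
    (hD : ∀ i s t, |d i s t| ≤ D) (l : Fin (k - 1)) :
    MemLp (rotatedSum U y η Γ d l) 2 ((volume : Measure (T × T)).prod P) := by
  refine memLp_two_prod (hy.measurable_rotatedSum hN hd l) (fun p => memLp_rotatedSum hG l p)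
    (C := ∑ i, U i (Fin.castLE (Nat.sub_le k 1) l) ^ 2 * 2 * (2 * C ^ 2) +
        (∑ i, |U i (Fin.castLE (Nat.sub_le k 1) l)| * D) ^ 2) fun p => ?_
  have := hy.integral_rotatedSum_mul (U := U) (d := d) hG hN l p p
  simp_rw [sq (rotatedSum U y η Γ d l _)]
  rw [this]
  exact (le_abs_self _).trans (abs_rotatedKernel_le hN hC hD l p p)

end IsSample

end StageLimit

/-- The asymptotic regime of `k` Gaussian samples under a local alternative. -/
structure IsLocalAlternative {T : Type*} [MeasureSpace T] {k : ℕ} (N : ℕ → Fin k → ℕ)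
    (τ : Fin k → ℝ) {Ω : ℕ → Type*} [∀ ν, MeasurableSpace (Ω ν)] (P : (ν : ℕ) → Measure (Ω ν))
    (y : (ν : ℕ) → (i : Fin k) → Fin (N ν i) → T → Ω ν → ℝ) (η : Fin k → T → ℝ)
    (Γ : ℕ → Fin k → T → T → ℝ) (γ : T → T → ℝ) (d : Fin k → T → T → ℝ) : Prop where
  two_le : ∀ ν i, 2 ≤ N ν i
  tendsto_sum : Tendsto (fun ν => ∑ i, N ν i) atTop atTop
  pos : ∀ i, 0 < τ i
  tendsto_ratio : ∀ i, Tendsto (fun ν => (N ν i : ℝ) / ∑ i', (N ν i' : ℝ)) atTop (𝓝 (τ i))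
  isSample : ∀ ν, IsSample (P ν) (y ν) η (Γ ν)
  gaussian : ∀ ν i j, IsGaussianProcess (y ν i j) (P ν)
  bounded : ∃ C : ℝ, ∀ ν i s t, |Γ ν i s t| ≤ C
  cov_eq : ∀ ν i s t, Γ ν i s t = γ s t + (√((N ν i : ℝ) - 1))⁻¹ * d i s t

/-! ### Elementary limits and regularity under the local alternative -/

namespace IsLocalAlternative

variable {T : Type*} [MeasureSpace T] [IsFiniteMeasure (volume : Measure T)] {k : ℕ}
  {N : ℕ → Fin k → ℕ} {τ : Fin k → ℝ} {Ω : ℕ → Type*} [∀ ν, MeasurableSpace (Ω ν)]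
  {P : (ν : ℕ) → Measure (Ω ν)} [∀ ν, IsProbabilityMeasure (P ν)]
  {y : (ν : ℕ) → (i : Fin k) → Fin (N ν i) → T → Ω ν → ℝ} {η : Fin k → T → ℝ}
  {Γ : ℕ → Fin k → T → T → ℝ} {γ : T → T → ℝ} {d : Fin k → T → T → ℝ}

lemma tendsto_sum_cast (h : IsLocalAlternative N τ P y η Γ γ d) :
    Tendsto (fun ν => ∑ i, (N ν i : ℝ)) atTop atTop := by
  have := tendsto_natCast_atTop_atTop (R := ℝ).comp h.tendsto_sum
  refine this.congr fun ν => ?_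
  simp

lemma tendsto_size (h : IsLocalAlternative N τ P y η Γ γ d) (i : Fin k) :
    Tendsto (fun ν => (N ν i : ℝ)) atTop atTop := by
  refine ((h.tendsto_ratio i).pos_mul_atTop (h.pos i) h.tendsto_sum_cast).congr' ?_
  filter_upwards [h.tendsto_sum_cast.eventually_gt_atTop 0] with ν hν
  rw [div_mul_cancel₀ _ hν.ne']

lemma sum_eq_one (h : IsLocalAlternative N τ P y η Γ γ d) : ∑ i, τ i = 1 := by
  refine tendsto_nhds_unique (tendsto_finsetSum _ fun i _ => h.tendsto_ratio i)
    (tendsto_const_nhds.congr' ?_)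
  filter_upwards [h.tendsto_sum_cast.eventually_gt_atTop 0] with ν hν
  rw [← Finset.sum_div, div_self hν.ne']

lemma nonempty (h : IsLocalAlternative N τ P y η Γ γ d) : Nonempty (Fin k) := by
  by_contra hk
  rw [not_nonempty_iff] at hk
  simpa using h.sum_eq_one

lemma tendsto_inv_sqrt (h : IsLocalAlternative N τ P y η Γ γ d) (i : Fin k) :
    Tendsto (fun ν => (√((N ν i : ℝ) - 1))⁻¹) atTop (𝓝 0) :=
  tendsto_inv_atTop_zero.comp (Real.tendsto_sqrt_atTop.comp
    (tendsto_atTop_add_const_right _ (-1) (h.tendsto_size i)))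

lemma inv_sqrt_pos (h : IsLocalAlternative N τ P y η Γ γ d) (ν : ℕ) (i : Fin k) :
    0 < (√((N ν i : ℝ) - 1))⁻¹ := by
  have := two_le_cast (h.two_le ν i)
  exact inv_pos.2 (Real.sqrt_pos.2 (by linarith))

/-- The factors are positive and tend to 0, so distinct ones always exist; they serve as
interpolation nodes. -/
lemma exists_inv_sqrt_lt (h : IsLocalAlternative N τ P y η Γ γ d) (ν : ℕ) (i : Fin k) :
    ∃ ν', (√((N ν' i : ℝ) - 1))⁻¹ < (√((N ν i : ℝ) - 1))⁻¹ :=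
  ((h.tendsto_inv_sqrt i).eventually_lt_const (h.inv_sqrt_pos ν i)).exists

lemma tendsto_size_div (h : IsLocalAlternative N τ P y η Γ γ d) (i : Fin k) :
    Tendsto (fun ν => (N ν i : ℝ) / ((N ν i : ℝ) - 1)) atTop (𝓝 1) := by
  have h1 : Tendsto (fun ν => 1 + (√((N ν i : ℝ) - 1))⁻¹ ^ 2) atTop (𝓝 1) := by
    simpa using tendsto_const_nhds.add ((h.tendsto_inv_sqrt i).pow 2)
  refine h1.congr fun ν => ?_
  have := two_le_cast (h.two_le ν i)
  rw [inv_pow, Real.sq_sqrt (by linarith)]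
  have : (N ν i : ℝ) - 1 ≠ 0 := by linarith
  field_simp
  ring

lemma tendsto_cov (h : IsLocalAlternative N τ P y η Γ γ d) (i : Fin k) (s t : T) :
    Tendsto (fun ν => Γ ν i s t) atTop (𝓝 (γ s t)) := by
  simp_rw [h.cov_eq]
  simpa using tendsto_const_nhds.add ((h.tendsto_inv_sqrt i).mul_const (d i s t))

lemma tendsto_varpi (h : IsLocalAlternative N τ P y η Γ γ d) (i : Fin k) (p q : T × T) :
    Tendsto (fun ν => varpi (Γ ν i) p q) atTop (𝓝 (varpi γ p q)) :=
  ((h.tendsto_cov i _ _).mul (h.tendsto_cov i _ _)).add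
    ((h.tendsto_cov i _ _).mul (h.tendsto_cov i _ _))

/-- Two stages with different sample sizes determine d by subtraction. Hence d inherits from the Γ's
the measurability and boundedness that are not assumed of it. -/
lemma exists_dev_eq (h : IsLocalAlternative N τ P y η Γ γ d) (i : Fin k) :
    ∃ ν ν' c, ∀ s t, d i s t = c * (Γ ν i s t - Γ ν' i s t) := by
  obtain ⟨ν, hν⟩ := h.exists_inv_sqrt_lt 0 i
  refine ⟨ν, 0, ((√((N ν i : ℝ) - 1))⁻¹ - (√((N 0 i : ℝ) - 1))⁻¹)⁻¹, fun s t => ?_⟩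
  rw [eq_inv_mul_iff_mul_eq₀ (sub_ne_zero.2 hν.ne), h.cov_eq ν, h.cov_eq 0]
  ring

lemma measurable_cov (h : IsLocalAlternative N τ P y η Γ γ d) (ν : ℕ) (i : Fin k) :
    Measurable fun p : T × T => Γ ν i p.1 p.2 :=
  (h.isSample ν).measurable_cov i (h.two_le ν i)

lemma measurable_dev (h : IsLocalAlternative N τ P y η Γ γ d) (i : Fin k) :
    Measurable fun p : T × T => d i p.1 p.2 := by
  obtain ⟨ν, ν', c, hc⟩ := h.exists_dev_eq i
  simp_rw [hc]
  exact ((h.measurable_cov ν i).sub (h.measurable_cov ν' i)).const_mul c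

lemma measurable_limit_cov (h : IsLocalAlternative N τ P y η Γ γ d) :
    Measurable fun p : T × T => γ p.1 p.2 := by
  obtain ⟨i⟩ := h.nonempty
  exact measurable_of_tendsto_metrizable (fun ν => h.measurable_cov ν i)
    (tendsto_pi_nhds.2 fun p => h.tendsto_cov i p.1 p.2)

lemma exists_bound (h : IsLocalAlternative N τ P y η Γ γ d) :
    ∃ C D : ℝ, 0 ≤ C ∧ 0 ≤ D ∧ (∀ ν i s t, |Γ ν i s t| ≤ C) ∧ (∀ s t, |γ s t| ≤ C) ∧
      ∀ i s t, |d i s t| ≤ D := by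
  obtain ⟨C, hC⟩ := h.bounded
  choose ν ν' c hc using h.exists_dev_eq
  have hD : ∀ i s t, |d i s t| ≤ ∑ i, |c i| * (|C| + |C|) := by
    intro i s t
    have h1 : |d i s t| ≤ |c i| * (|C| + |C|) := by
      rw [hc, abs_mul]
      refine mul_le_mul_of_nonneg_left ((abs_sub _ _).trans ?_) (abs_nonneg _)
      exact add_le_add ((hC _ _ _ _).trans (le_abs_self _)) ((hC _ _ _ _).trans (le_abs_self _))
    exact h1.trans (Finset.single_le_sum (f := fun i => |c i| * (|C| + |C|))
      (fun i _ => by positivity) (Finset.mem_univ i))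
  refine ⟨|C|, _, abs_nonneg _, Finset.sum_nonneg fun i _ => by positivity,
    fun ν i s t => (hC ν i s t).trans (le_abs_self _), fun s t => ?_, hD⟩
  obtain ⟨i⟩ := h.nonempty
  exact le_of_tendsto (h.tendsto_cov i s t).abs (Eventually.of_forall fun ν =>
    (hC ν i s t).trans (le_abs_self _))

lemma tendsto_rotatedKernel (h : IsLocalAlternative N τ P y η Γ γ d)
    {U : Matrix (Fin k) (Fin k) ℝ} (hU : U ∈ Matrix.orthogonalGroup (Fin k) ℝ)
    (l : Fin (k - 1)) (p q : T × T) :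
    Tendsto (fun ν => rotatedKernel U (N ν) (Γ ν) d l p q) atTop
      (𝓝 (varpi γ p q + rotatedDev U d l p * rotatedDev U d l q)) := by
  -- Columns of an orthogonal matrix are unit vectors, so the limiting random kernel has total
  -- weight 1 for every l.
  have hsum : ∑ i, U i (Fin.castLE (Nat.sub_le k 1) l) ^ 2 = 1 := by
    have := congrFun₂ ((Matrix.mem_orthogonalGroup_iff' (Fin k) ℝ).1 hU)
      (Fin.castLE (Nat.sub_le k 1) l) (Fin.castLE (Nat.sub_le k 1) l)
    simpa [Matrix.mul_apply, sq] using this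
  have h1 : Tendsto (fun ν => ∑ i, U i (Fin.castLE (Nat.sub_le k 1) l) ^ 2 *
      ((N ν i : ℝ) / ((N ν i : ℝ) - 1)) * varpi (Γ ν i) p q) atTop
      (𝓝 (∑ i, U i (Fin.castLE (Nat.sub_le k 1) l) ^ 2 * 1 * varpi γ p q)) :=
    tendsto_finsetSum _ fun i _ =>
      ((h.tendsto_size_div i).const_mul _).mul (h.tendsto_varpi i p q)
  simp_rw [mul_one, ← Finset.sum_mul] at h1
  rw [hsum, one_mul] at h1
  exact h1.add tendsto_const_nhds

/-! ### Positivity and summability of the eigenvalues -/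

section Trace

variable {lam : ℕ → ℝ} {φ : HilbertBasis ℕ ℝ (Lp ℝ 2 (volume : Measure (T × T)))}

/-- The trace formula applies because `prodDev` of the first curve of the sample is a jointly
measurable process with this covariance kernel. -/
lemma hasSum_quadForm_cov (h : IsLocalAlternative N τ P y η Γ γ d) (ν : ℕ) (i : Fin k)
    (φ : HilbertBasis ℕ ℝ (Lp ℝ 2 (volume : Measure (T × T)))) :
    HasSum (fun r => quadForm volume (varpi (Γ ν i)) (φ r)) (∫ p, varpi (Γ ν i) p p) := by
  obtain ⟨C, D, hC0, hD0, hC, -, -⟩ := h.exists_bound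
  have hpos : 0 < N ν i := lt_of_lt_of_le two_pos (h.two_le ν i)
  exact hasSum_quadForm φ ((h.isSample ν).measurable_prodDev (h.two_le ν) ⟨i, ⟨0, hpos⟩⟩)
    ((h.isSample ν).memLp_prodDev_prod (h.gaussian ν) (h.two_le ν) (hC ν) ⟨i, ⟨0, hpos⟩⟩)
    ((h.isSample ν).integral_prodDev_mul_self (h.gaussian ν) ⟨i, ⟨0, hpos⟩⟩)

lemma quadForm_cov_nonneg (h : IsLocalAlternative N τ P y η Γ γ d) (ν : ℕ) (i : Fin k)
    {ψ : T × T → ℝ} (hψ : MemLp ψ 2) : 0 ≤ quadForm volume (varpi (Γ ν i)) ψ := by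
  obtain ⟨C, D, hC0, hD0, hC, -, -⟩ := h.exists_bound
  have hpos : 0 < N ν i := lt_of_lt_of_le two_pos (h.two_le ν i)
  have := integral_sq_integral_eq_quadForm
    ((h.isSample ν).measurable_prodDev (h.two_le ν) ⟨i, ⟨0, hpos⟩⟩)
    ((h.isSample ν).memLp_prodDev_prod (h.gaussian ν) (h.two_le ν) (hC ν) ⟨i, ⟨0, hpos⟩⟩) hψ
  simp_rw [(h.isSample ν).integral_prodDev_mul_self (h.gaussian ν) ⟨i, ⟨0, hpos⟩⟩] at this
  rw [← this]
  exact integral_nonneg fun ω => sq_nonneg _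

lemma tendsto_quadForm_varpi (h : IsLocalAlternative N τ P y η Γ γ d) (i : Fin k)
    {ψ : T × T → ℝ} (hψ : MemLp ψ 2) :
    Tendsto (fun ν => quadForm volume (varpi (Γ ν i)) ψ) atTop
      (𝓝 (quadForm volume (varpi γ) ψ)) := by
  obtain ⟨C, D, hC0, hD0, hC, -, -⟩ := h.exists_bound
  exact tendsto_quadForm (fun ν => measurable_varpi (h.measurable_cov ν i))
    (fun ν p q => abs_varpi_le (hC ν i) p q) (h.tendsto_varpi i) hψ

lemma quadForm_varpi_eigen (h : IsLocalAlternative N τ P y η Γ γ d)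
    (hφ : IsEigensystem (varpi γ) lam φ) (r : ℕ) : quadForm volume (varpi γ) (φ r) = lam r := by
  obtain ⟨C, D, hC0, hD0, -, hC, -⟩ := h.exists_bound
  exact quadForm_eigen hφ (measurable_varpi h.measurable_limit_cov)
    (fun p q => abs_varpi_le hC p q) r

/-- Each eigenvalue is a value of the limiting quadratic form, hence a limit of second moments of
random variables. -/
lemma eigenvalue_nonneg (h : IsLocalAlternative N τ P y η Γ γ d)
    (hφ : IsEigensystem (varpi γ) lam φ) (r : ℕ) : 0 ≤ lam r := by
  obtain ⟨i⟩ := h.nonempty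
  rw [← h.quadForm_varpi_eigen hφ r]
  exact ge_of_tendsto' (h.tendsto_quadForm_varpi i (Lp.memLp (φ r)))
    fun ν => h.quadForm_cov_nonneg ν i (Lp.memLp (φ r))

/-- The eigenvalues of the limiting covariance operator sum up to its trace. -/
lemma hasSum_eigenvalue (h : IsLocalAlternative N τ P y η Γ γ d)
    (hφ : IsEigensystem (varpi γ) lam φ) : HasSum lam (∫ p : T × T, varpi γ p p) := by
  obtain ⟨C, D, hC0, hD0, hC, hCγ, -⟩ := h.exists_bound
  obtain ⟨i⟩ := h.nonempty
  -- The trace formula is available for the kernels of the sampled processes, not directly for the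
  -- limit kernel. Three stages with distinct sizes express the limit kernel linearly through
  -- theirs, and both sides of the formula are linear in the kernel.
  obtain ⟨ν₂, h₂⟩ := h.exists_inv_sqrt_lt 0 i
  obtain ⟨ν₃, h₃⟩ := h.exists_inv_sqrt_lt ν₂ i
  have hΓ : ∀ ν, (fun s t => γ s t + (√((N ν i : ℝ) - 1))⁻¹ * d i s t) = Γ ν i := fun ν =>
    funext₂ fun s t => (h.cov_eq ν i s t).symm
  have hL := varpi_eq_sum_lagrange γ (d i) h₂.ne' (h₃.trans h₂).ne' h₃.ne'
  simp_rw [hΓ] at hL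
  set a : Fin 3 → ℝ := ![_, _, _] with ha
  set n : Fin 3 → ℕ := ![0, ν₂, ν₃] with hn
  have hsum : ∀ p q, varpi γ p q = ∑ e : Fin 3, a e * varpi (Γ (n e) i) p q := by
    intro p q
    rw [hL, Fin.sum_univ_three]
    rfl
  have hm : ∀ e, Measurable fun z : (T × T) × (T × T) => varpi (Γ (n e) i) z.1 z.2 := fun e =>
    measurable_varpi (h.measurable_cov (n e) i)
  have hb : ∀ e (p q : T × T), |varpi (Γ (n e) i) p q| ≤ 2 * C ^ 2 := fun e p q =>
    abs_varpi_le (hC (n e) i) p q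
  have key : HasSum (fun r => ∑ e : Fin 3, a e * quadForm volume (varpi (Γ (n e) i)) (φ r))
      (∑ e : Fin 3, a e * ∫ p, varpi (Γ (n e) i) p p) :=
    hasSum_sum fun e _ => (h.hasSum_quadForm_cov (n e) i φ).mul_left (a e)
  convert! key using 1
  · ext r
    rw [← quadForm_sum_mul a hm hb (Lp.memLp (φ r)), ← h.quadForm_varpi_eigen hφ r]
    congr 1
    ext p q
    exact hsum p q
  · simp_rw [hsum]
    rw [integral_finsetSum]
    · simp_rw [integral_const_mul]
    · intro e _
      refine (Integrable.of_bound (C := 2 * C ^ 2)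
        ((hm e).comp (measurable_id.prodMk measurable_id)).aestronglyMeasurable
        (ae_of_all _ fun p => hb e p p)).const_mul _

lemma memLp_rotatedDev (h : IsLocalAlternative N τ P y η Γ γ d)
    (U : Matrix (Fin k) (Fin k) ℝ) (l : Fin (k - 1)) : MemLp (rotatedDev U d l) 2 := by
  obtain ⟨C, D, hC0, hD0, hC, hCγ, hD⟩ := h.exists_bound
  exact MemLp.of_bound (measurable_rotatedDev h.measurable_dev l).aestronglyMeasurable _
    (ae_of_all _ fun p => abs_rotatedDev_le hD l p)

lemma hasSum_rotated (h : IsLocalAlternative N τ P y η Γ γ d)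
    (hφ : IsEigensystem (varpi γ) lam φ) (U : Matrix (Fin k) (Fin k) ℝ) (l : Fin (k - 1)) :
    HasSum (fun r => lam r + (∫ p, rotatedDev U d l p * φ r p) ^ 2)
      (∫ p : T × T, (varpi γ p p + rotatedDev U d l p * rotatedDev U d l p)) := by
  obtain ⟨C, D, hC0, hD0, hC, hCγ, hD⟩ := h.exists_bound
  have h2 := h.memLp_rotatedDev U l
  rw [integral_add]
  · refine (h.hasSum_eigenvalue hφ).add ?_
    simpa only [sq] using hasSum_sq_integral φ h2
  · exact Integrable.of_bound (C := 2 * C ^ 2) ((measurable_varpi h.measurable_limit_cov).comp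
      (measurable_id.prodMk measurable_id)).aestronglyMeasurable
      (ae_of_all _ fun p => abs_varpi_le hCγ p p)
  · exact integrable_mul_of_memLp_two h2 h2

lemma summable_deltaSq (h : IsLocalAlternative N τ P y η Γ γ d) (U : Matrix (Fin k) (Fin k) ℝ)
    (φ : HilbertBasis ℕ ℝ (Lp ℝ 2 (volume : Measure (T × T)))) :
    Summable fun r => deltaSq U d (φ r) :=
  summable_sum fun l _ => (hasSum_sq_integral φ (h.memLp_rotatedDev U l)).summable

end Trace

end IsLocalAlternative

/-! ### Central limit theorem for the coefficients and their squares -/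

open Complex in
/-- If a random vector converges in law to a Gaussian vector with independent coordinates, then
the characteristic function of its squared norm converges. -/
lemma tendsto_integral_exp_sum_sq {ι : Type*} [Fintype ι] {Ω : ℕ → Type*}
    [∀ ν, MeasurableSpace (Ω ν)] {P : (ν : ℕ) → Measure (Ω ν)} [∀ ν, IsProbabilityMeasure (P ν)]
    {X : (ν : ℕ) → ι → Ω ν → ℝ} (hX : ∀ ν a, AEMeasurable (X ν a) (P ν)) (m : ι → ℝ)
    (v : ι → NNReal)
    (h : ∀ t : ι → ℝ, Tendsto (fun ν => ∫ ω, cexp ((∑ a, t a * X ν a ω : ℝ) * I) ∂P ν) atTop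
      (𝓝 (∏ a, cexp (t a * m a * I - v a * t a ^ 2 / 2)))) (s : ℝ) :
    Tendsto (fun ν => ∫ ω, cexp ((s * ∑ a, X ν a ω ^ 2 : ℝ) * I) ∂P ν) atTop
      (𝓝 (∏ a, ∫ w, cexp ((s * w ^ 2 : ℝ) * I) ∂(gaussianReal (m a) (v a)))) := by
  have hY : ∀ ν, AEMeasurable (fun ω => WithLp.toLp 2 fun a => X ν a ω : Ω ν → EuclideanSpace ℝ ι)
      (P ν) := fun ν =>
    (WithLp.measurable_toLp 2 _).comp_aemeasurable (aemeasurable_pi_lambda _ (hX ν))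
  let μ : ℕ → ProbabilityMeasure (EuclideanSpace ℝ ι) := fun ν =>
    ⟨(P ν).map (fun ω => WithLp.toLp 2 fun a => X ν a ω), Measure.isProbabilityMeasure_map (hY ν)⟩
  have hm : Measurable (WithLp.toLp 2 : (ι → ℝ) → EuclideanSpace ℝ ι) := WithLp.measurable_toLp 2 _
  let μ₀ : ProbabilityMeasure (EuclideanSpace ℝ ι) :=
    ⟨(Measure.pi fun a => gaussianReal (m a) (v a)).map (WithLp.toLp 2),
      Measure.isProbabilityMeasure_map hm.aemeasurable⟩
  -- Lévy's continuity theorem upgrades the pointwise limit of characteristic functions to weak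
  -- convergence.
  have hlim : Tendsto μ atTop (𝓝 μ₀) := by
    refine ProbabilityMeasure.tendsto_of_tendsto_charFun fun t => ?_
    have e0 : charFun (μ₀ : Measure (EuclideanSpace ℝ ι)) t =
        ∏ a, cexp (t a * m a * I - v a * t a ^ 2 / 2) := by
      refine (charFun_pi (μ := fun a => gaussianReal (m a) (v a)) t).trans ?_
      simp_rw [charFun_gaussianReal]
    rw [e0]
    refine (h t).congr fun ν => ?_
    change _ = charFun ((P ν).map (fun ω => WithLp.toLp 2 fun a => X ν a ω)) t
    rw [charFun_apply, integral_map (hY ν) (by fun_prop)]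
    simp [PiLp.inner_apply, mul_comm]
  -- The characteristic function of the squared norm is the integral of a bounded continuous
  -- function of the vector.
  let g : BoundedContinuousFunction (EuclideanSpace ℝ ι) ℂ :=
    BoundedContinuousFunction.ofNormedAddCommGroup (fun x => cexp ((s * ∑ a, x a ^ 2 : ℝ) * I))
      (by fun_prop) 1 (fun x => by rw [Complex.norm_exp_ofReal_mul_I])
  have hg := (ProbabilityMeasure.tendsto_iff_forall_integral_rclike_tendsto ℂ).1 hlim g
  have e1 : ∀ ν, ∫ x, g x ∂(μ ν : Measure (EuclideanSpace ℝ ι)) =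
      ∫ ω, cexp ((s * ∑ a, X ν a ω ^ 2 : ℝ) * I) ∂P ν := fun ν =>
    integral_map (hY ν) g.continuous.aestronglyMeasurable
  have e2 : ∫ x, g x ∂(μ₀ : Measure (EuclideanSpace ℝ ι)) =
      ∏ a, ∫ w, cexp ((s * w ^ 2 : ℝ) * I) ∂(gaussianReal (m a) (v a)) := by
    rw [← integral_fintype_prod_eq_prod]
    refine (integral_map hm.aemeasurable g.continuous.aestronglyMeasurable).trans ?_
    congr with x
    change cexp ((s * ∑ a, x a ^ 2 : ℝ) * I) = _
    rw [← Complex.exp_sum, Finset.mul_sum, ofReal_sum, Finset.sum_mul]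
  rw [e2] at hg
  exact hg.congr e1

namespace IsLocalAlternative

variable {T : Type*} [MeasureSpace T] [IsFiniteMeasure (volume : Measure T)] {k : ℕ}
  {N : ℕ → Fin k → ℕ} {τ : Fin k → ℝ} {Ω : ℕ → Type*} [∀ ν, MeasurableSpace (Ω ν)]
  {P : (ν : ℕ) → Measure (Ω ν)} [∀ ν, IsProbabilityMeasure (P ν)]
  {y : (ν : ℕ) → (i : Fin k) → Fin (N ν i) → T → Ω ν → ℝ} {η : Fin k → T → ℝ}
  {Γ : ℕ → Fin k → T → T → ℝ} {γ : T → T → ℝ} {d : Fin k → T → T → ℝ}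
  {lam : ℕ → ℝ} {φ : HilbertBasis ℕ ℝ (Lp ℝ 2 (volume : Measure (T × T)))}
  {U : Matrix (Fin k) (Fin k) ℝ}

open Complex in
/-- The central limit theorem for linear functionals of the fluctuations. -/
lemma tendsto_integral_exp_sumDev (h : IsLocalAlternative N τ P y η Γ γ d)
    {ψ : Fin k → T × T → ℝ} (hψ : ∀ i, MemLp (ψ i) 2) :
    Tendsto (fun ν => ∫ ω, cexp ((∑ i, ∫ p, sumDev (y ν) η (Γ ν) i (p, ω) * ψ i p : ℝ) * I) ∂P ν)
      atTop (𝓝 (cexp ((-(∑ i, quadForm volume (varpi γ) (ψ i)) / 2 : ℝ)))) := by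
  obtain ⟨C, D, hC0, hD0, hC, hCγ, hD⟩ := h.exists_bound
  have hb := fun ν => (h.isSample ν).norm_integral_exp_sumDev_sub_le (h.gaussian ν) (h.two_le ν)
    (hC ν) hψ
  set B : Fin k → ℝ := fun i => (∫ p, ψ i p ^ 2) ^ 2 * (volume.real (Set.univ : Set (T × T)) *
        (volume.real (Set.univ : Set (T × T)) *
          (8 * C ^ 4 * (∫ x, x ^ 8 ∂(gaussianReal 0 1)) + 8 * C ^ 4))) with hB
  have hq := fun i => h.tendsto_quadForm_varpi i (hψ i)
  -- Each of the `N ν i` summands contributes an error of order (N ν i − 1)^(−3/2), so the total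
  -- error vanishes.
  have h0 : Tendsto (fun ν => ∑ i, (N ν i : ℝ) * (2 * (√((N ν i : ℝ) - 1))⁻¹ ^ 3 *
      (quadForm volume (varpi (Γ ν i)) (ψ i) + B i) +
      (√((N ν i : ℝ) - 1))⁻¹ ^ 4 * quadForm volume (varpi (Γ ν i)) (ψ i) ^ 2)) atTop (𝓝 0) := by
    have : Tendsto (fun ν => ∑ i, ((N ν i : ℝ) / ((N ν i : ℝ) - 1)) *
        (2 * (√((N ν i : ℝ) - 1))⁻¹ * (quadForm volume (varpi (Γ ν i)) (ψ i) + B i) +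
        (√((N ν i : ℝ) - 1))⁻¹ ^ 2 * quadForm volume (varpi (Γ ν i)) (ψ i) ^ 2)) atTop
        (𝓝 (∑ i, 1 * (2 * 0 * (quadForm volume (varpi γ) (ψ i) + B i) +
          0 ^ 2 * quadForm volume (varpi γ) (ψ i) ^ 2))) := by
      refine tendsto_finsetSum _ fun i _ => (h.tendsto_size_div i).mul (Tendsto.add ?_ ?_)
      · exact ((h.tendsto_inv_sqrt i).const_mul 2).mul ((hq i).add_const _)
      · exact ((h.tendsto_inv_sqrt i).pow 2).mul ((hq i).pow 2)
    simp only [mul_zero, zero_mul, ne_eq, OfNat.ofNat_ne_zero, not_false_eq_true, zero_pow,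
      add_zero, Finset.sum_const_zero] at this
    refine this.congr fun ν => Finset.sum_congr rfl fun i _ => ?_
    have h2 := two_le_cast (h.two_le ν i)
    have hsq : (√((N ν i : ℝ) - 1))⁻¹ ^ 2 = ((N ν i : ℝ) - 1)⁻¹ := by
      rw [inv_pow, Real.sq_sqrt (by linarith)]
    rw [div_eq_mul_inv, ← hsq]
    ring
  have h1 := squeeze_zero_norm hb h0
  have h2 : Tendsto (fun ν => cexp ((-(∑ i, (N ν i : ℝ) / ((N ν i : ℝ) - 1) *
      quadForm volume (varpi (Γ ν i)) (ψ i)) / 2 : ℝ))) atTop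
      (𝓝 (cexp ((-(∑ i, 1 * quadForm volume (varpi γ) (ψ i)) / 2 : ℝ)))) := by
    have : Tendsto (fun ν => -(∑ i, (N ν i : ℝ) / ((N ν i : ℝ) - 1) *
        quadForm volume (varpi (Γ ν i)) (ψ i)) / 2) atTop
        (𝓝 (-(∑ i, 1 * quadForm volume (varpi γ) (ψ i)) / 2)) :=
      (tendsto_finsetSum _ fun i _ => (h.tendsto_size_div i).mul (hq i)).neg.div_const 2
    exact (Continuous.tendsto (f := fun x : ℝ => cexp (x : ℂ)) (by fun_prop) _).comp this
  simp_rw [one_mul] at h2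
  simpa using h1.add h2

lemma sum_mul_of_mem_orthogonalGroup (hU : U ∈ Matrix.orthogonalGroup (Fin k) ℝ) (j j' : Fin k) :
    ∑ i, U i j * U i j' = if j = j' then 1 else 0 := by
  have := congrFun₂ ((Matrix.mem_orthogonalGroup_iff' (Fin k) ℝ).1 hU) j j'
  simpa [Matrix.mul_apply, Matrix.one_apply] using this

/-- The first k − 1 columns of U are orthonormal. This makes the rotated functions asymptotically
uncorrelated for different l. -/
lemma sum_sq_sum_rotation (hU : U ∈ Matrix.orthogonalGroup (Fin k) ℝ) (t : Fin (k - 1) → ℝ) :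
    ∑ i, (∑ l, t l * U i (Fin.castLE (Nat.sub_le k 1) l)) ^ 2 = ∑ l, t l ^ 2 := by
  simp_rw [sq, Finset.sum_mul_sum]
  rw [Finset.sum_comm]
  refine Finset.sum_congr rfl fun l _ => ?_
  rw [Finset.sum_comm]
  have : ∀ l', ∑ i, t l * U i (Fin.castLE (Nat.sub_le k 1) l) *
      (t l' * U i (Fin.castLE (Nat.sub_le k 1) l')) = if l = l' then t l * t l' else 0 := by
    intro l'
    simp_rw [mul_mul_mul_comm]
    rw [← Finset.mul_sum, sum_mul_of_mem_orthogonalGroup hU]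
    simp [(Fin.castLE_injective (Nat.sub_le k 1)).eq_iff]
  simp [this]

/-- The coefficients of `rotatedSum` in the eigenbasis. -/
noncomputable def coeff (U : Matrix (Fin k) (Fin k) ℝ)
    (y : (ν : ℕ) → (i : Fin k) → Fin (N ν i) → T → Ω ν → ℝ) (η : Fin k → T → ℝ)
    (Γ : ℕ → Fin k → T → T → ℝ) (d : Fin k → T → T → ℝ)
    (φ : HilbertBasis ℕ ℝ (Lp ℝ 2 (volume : Measure (T × T)))) (ν : ℕ) (l : Fin (k - 1)) (r : ℕ)
    (ω : Ω ν) : ℝ :=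
  ∫ p, rotatedSum U (y ν) η (Γ ν) d l (p, ω) * φ r p

lemma memLp_coeff (h : IsLocalAlternative N τ P y η Γ γ d) (ν : ℕ) (l : Fin (k - 1)) (r : ℕ) :
    MemLp (coeff U y η Γ d φ ν l r) 2 (P ν) := by
  obtain ⟨C, D, hC0, hD0, hC, hCγ, hD⟩ := h.exists_bound
  exact memLp_two_integral_mul
    ((h.isSample ν).measurable_rotatedSum (h.two_le ν) h.measurable_dev l)
    ((h.isSample ν).memLp_rotatedSum_prod (h.gaussian ν) (h.two_le ν) (hC ν) h.measurable_dev hD l)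
    (Lp.memLp (φ r))

open Complex in
-- Cramér–Wold: a linear combination of coefficients is one linear functional of the fluctuations
-- plus a constant, with test function ψ_i obtained by rotating the weights. Its limiting variance
-- is diagonal, so the limit factorizes over r and l.
lemma tendsto_integral_exp_coeff (h : IsLocalAlternative N τ P y η Γ γ d)
    (hU : U ∈ Matrix.orthogonalGroup (Fin k) ℝ) (hφ : IsEigensystem (varpi γ) lam φ) (R : ℕ)
    (t : Fin R × Fin (k - 1) → ℝ) :
    Tendsto (fun ν => ∫ ω, cexp ((∑ a, t a * coeff U y η Γ d φ ν a.2 a.1 ω : ℝ) * I) ∂P ν) atTop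
      (𝓝 (∏ a, cexp (t a * (∫ p, rotatedDev U d a.2 p * φ a.1 p : ℝ) * I -
        (lam a.1).toNNReal * t a ^ 2 / 2))) := by
  obtain ⟨C, D, hC0, hD0, hC, hCγ, hD⟩ := h.exists_bound
  set c : Fin k → Fin R → ℝ := fun i r => ∑ l, t (r, l) * U i (Fin.castLE (Nat.sub_le k 1) l)
    with hc
  set ψ : Fin k → T × T → ℝ := fun i p => ∑ r : Fin R, c i r * φ r p with hψdef
  have hψ : ∀ i, MemLp (ψ i) 2 := fun i => memLp_sum_mul_basis R (c i)
  have key := h.tendsto_integral_exp_sumDev hψ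
  have hq : ∑ i, quadForm volume (varpi γ) (ψ i) = ∑ a, lam a.1 * t a ^ 2 := by
    have : ∀ i, quadForm volume (varpi γ) (ψ i) = ∑ r : Fin R, lam r * c i r ^ 2 := fun i =>
      quadForm_sum_eigen hφ (measurable_varpi h.measurable_limit_cov)
        (fun p q => abs_varpi_le hCγ p q) (c i)
    simp_rw [this]
    rw [Finset.sum_comm, Fintype.sum_prod_type]
    refine Finset.sum_congr rfl fun r _ => ?_
    simp only [hc]
    rw [← Finset.mul_sum, sum_sq_sum_rotation hU fun l => t (r, l), Finset.mul_sum]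
  rw [hq] at key
  set m : ℝ := ∑ a, t a * ∫ p, rotatedDev U d a.2 p * φ a.1 p with hm
  have e : ∀ ν, ∀ᵐ ω ∂P ν, ∑ a, t a * coeff U y η Γ d φ ν a.2 a.1 ω =
      (∑ i, ∫ p, sumDev (y ν) η (Γ ν) i (p, ω) * ψ i p) + m := by
    intro ν
    have hs : ∀ᵐ ω ∂P ν, ∀ i, MemLp (fun p => sumDev (y ν) η (Γ ν) i (p, ω)) 2 volume :=
      ae_all_iff.2 fun i => memLp_two_section ((h.isSample ν).measurable_sumDev (h.two_le ν) i)
        ((h.isSample ν).memLp_sumDev_prod (h.gaussian ν) (h.two_le ν) (hC ν) i)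
    filter_upwards [hs] with ω hω
    have hcoeff : ∀ l r, coeff U y η Γ d φ ν l r ω = ∑ i, U i (Fin.castLE (Nat.sub_le k 1) l) *
        (∫ p, sumDev (y ν) η (Γ ν) i (p, ω) * φ r p) + ∫ p, rotatedDev U d l p * φ r p := by
      intro l r
      unfold coeff rotatedSum
      simp_rw [add_mul, Finset.sum_mul, mul_assoc]
      have hi : ∀ i, Integrable (fun p => U i (Fin.castLE (Nat.sub_le k 1) l) *
          (sumDev (y ν) η (Γ ν) i (p, ω) * φ r p)) volume := fun i =>
        (integrable_mul_of_memLp_two (hω i) (Lp.memLp (φ r))).const_mul _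
      rw [integral_add (integrable_finsetSum _ fun i _ => hi i)
        (integrable_mul_of_memLp_two (h.memLp_rotatedDev U l) (Lp.memLp (φ r))),
        integral_finsetSum _ fun i _ => hi i]
      simp_rw [integral_const_mul]
    have hψi : ∀ i, ∫ p, sumDev (y ν) η (Γ ν) i (p, ω) * ψ i p =
        ∑ r : Fin R, c i r * ∫ p, sumDev (y ν) η (Γ ν) i (p, ω) * φ r p := by
      intro i
      simp only [hψdef, Finset.mul_sum, mul_left_comm _ (c i _)]
      rw [integral_finsetSum _ fun (r : Fin R) _ =>
        (integrable_mul_of_memLp_two (hω i) (Lp.memLp (φ r))).const_mul _]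
      simp_rw [integral_const_mul]
    simp_rw [hcoeff, hψi, mul_add, Finset.sum_add_distrib]
    rw [hm, add_left_inj, Fintype.sum_prod_type, Finset.sum_comm (s := Finset.univ (α := Fin k))]
    refine Finset.sum_congr rfl fun r _ => ?_
    simp only [hc, Finset.mul_sum, Finset.sum_mul]
    rw [Finset.sum_comm]
    exact Finset.sum_congr rfl fun i _ => Finset.sum_congr rfl fun l _ => by ring
  have hlim := key.mul_const (cexp (m * I))
  have e2 : cexp ((-(∑ a, lam a.1 * t a ^ 2) / 2 : ℝ)) * cexp (m * I) =
      ∏ a, cexp (t a * (∫ p, rotatedDev U d a.2 p * φ a.1 p : ℝ) * I -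
        (lam a.1).toNNReal * t a ^ 2 / 2) := by
    rw [← Complex.exp_add, ← Complex.exp_sum, Finset.sum_sub_distrib, hm]
    congr 1
    have hl : ∀ a : Fin R × Fin (k - 1), (((lam a.1).toNNReal : ℝ) : ℂ) = (lam a.1 : ℂ) :=
      fun a => by
      rw [Real.coe_toNNReal _ (h.eigenvalue_nonneg hφ a.1)]
    push_cast
    simp_rw [hl, Finset.sum_mul, ← Finset.sum_div]
    ring
  rw [e2] at hlim
  refine hlim.congr fun ν => ?_
  rw [← integral_mul_const]
  refine integral_congr_ae ?_
  filter_upwards [e ν] with ω hω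
  rw [hω, ← Complex.exp_add]
  push_cast
  ring_nf

open Complex in
/-- The characteristic function of the truncated statistic converges. -/
lemma tendsto_integral_exp_sum_coeff_sq (h : IsLocalAlternative N τ P y η Γ γ d)
    (hU : U ∈ Matrix.orthogonalGroup (Fin k) ℝ) (hφ : IsEigensystem (varpi γ) lam φ) (R : ℕ)
    (s : ℝ) :
    Tendsto (fun ν => ∫ ω, cexp ((s * ∑ r ∈ Finset.range R, ∑ l,
      coeff U y η Γ d φ ν l r ω ^ 2 : ℝ) * I) ∂P ν) atTop
      (𝓝 (∏ r ∈ Finset.range R, ∏ l, ∫ w, cexp ((s * w ^ 2 : ℝ) * I)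
        ∂(gaussianReal (∫ p, rotatedDev U d l p * φ r p) (lam r).toNNReal))) := by
  have key := tendsto_integral_exp_sum_sq (P := P) (ι := Fin R × Fin (k - 1))
    (X := fun ν a => coeff U y η Γ d φ ν a.2 a.1)
    (fun ν a => (h.memLp_coeff ν a.2 a.1).1.aemeasurable) _ _
    (h.tendsto_integral_exp_coeff hU hφ R) s
  simp_rw [Fintype.sum_prod_type] at key
  rw [Fintype.prod_prod_type] at key
  simp_rw [Finset.sum_range, Finset.prod_range]
  exact key

end IsLocalAlternative

/-! ### Truncation of the eigenfunction expansion -/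

namespace IsLocalAlternative

variable {T : Type*} [MeasureSpace T] [IsFiniteMeasure (volume : Measure T)] {k : ℕ}
  {N : ℕ → Fin k → ℕ} {τ : Fin k → ℝ} {Ω : ℕ → Type*} [∀ ν, MeasurableSpace (Ω ν)]
  {P : (ν : ℕ) → Measure (Ω ν)} [∀ ν, IsProbabilityMeasure (P ν)]
  {y : (ν : ℕ) → (i : Fin k) → Fin (N ν i) → T → Ω ν → ℝ} {η : Fin k → T → ℝ}
  {Γ : ℕ → Fin k → T → T → ℝ} {γ : T → T → ℝ} {d : Fin k → T → T → ℝ}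
  {lam : ℕ → ℝ} {φ : HilbertBasis ℕ ℝ (Lp ℝ 2 (volume : Measure (T × T)))}
  {U : Matrix (Fin k) (Fin k) ℝ}

lemma measurable_rotatedSum (h : IsLocalAlternative N τ P y η Γ γ d) (ν : ℕ) (l : Fin (k - 1)) :
    Measurable (rotatedSum U (y ν) η (Γ ν) d l) :=
  (h.isSample ν).measurable_rotatedSum (h.two_le ν) h.measurable_dev l

lemma memLp_rotatedSum (h : IsLocalAlternative N τ P y η Γ γ d) (ν : ℕ) (l : Fin (k - 1)) :
    MemLp (rotatedSum U (y ν) η (Γ ν) d l) 2 ((volume : Measure (T × T)).prod (P ν)) := by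
  obtain ⟨C, D, hC0, hD0, hC, hCγ, hD⟩ := h.exists_bound
  exact (h.isSample ν).memLp_rotatedSum_prod (h.gaussian ν) (h.two_le ν) (hC ν)
    h.measurable_dev hD l

lemma integrable_integral_rotatedSum_sq (h : IsLocalAlternative N τ P y η Γ γ d) (ν : ℕ)
    (l : Fin (k - 1)) :
    Integrable (fun ω => ∫ p, rotatedSum U (y ν) η (Γ ν) d l (p, ω) ^ 2) (P ν) :=
  (h.memLp_rotatedSum ν l).integrable_sq.integral_prod_right

lemma integral_coeff_sq (h : IsLocalAlternative N τ P y η Γ γ d) (ν : ℕ) (l : Fin (k - 1))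
    (r : ℕ) : ∫ ω, coeff U y η Γ d φ ν l r ω ^ 2 ∂P ν =
      quadForm volume (rotatedKernel U (N ν) (Γ ν) d l) (φ r) := by
  unfold coeff
  rw [integral_sq_integral_eq_quadForm (h.measurable_rotatedSum ν l) (h.memLp_rotatedSum ν l)
    (Lp.memLp (φ r))]
  simp_rw [(h.isSample ν).integral_rotatedSum_mul (h.gaussian ν) (h.two_le ν)]

lemma tendsto_integral_coeff_sq (h : IsLocalAlternative N τ P y η Γ γ d)
    (hU : U ∈ Matrix.orthogonalGroup (Fin k) ℝ) (hφ : IsEigensystem (varpi γ) lam φ)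
    (l : Fin (k - 1)) (r : ℕ) :
    Tendsto (fun ν => ∫ ω, coeff U y η Γ d φ ν l r ω ^ 2 ∂P ν) atTop
      (𝓝 (lam r + (∫ p, rotatedDev U d l p * φ r p) ^ 2)) := by
  obtain ⟨C, D, hC0, hD0, hC, hCγ, hD⟩ := h.exists_bound
  simp_rw [h.integral_coeff_sq]
  have hm := measurable_rotatedDev (U := U) h.measurable_dev l
  have key := tendsto_quadForm (μ := volume)
    (fun ν => (h.isSample ν).measurable_rotatedKernel (U := U) (h.two_le ν) h.measurable_dev l)
    (fun ν p q => abs_rotatedKernel_le (h.two_le ν) (hC ν) hD l p q)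
    (h.tendsto_rotatedKernel hU l) (Lp.memLp (φ r))
  rwa [quadForm_add (measurable_varpi h.measurable_limit_cov) (fun p q => abs_varpi_le hCγ p q)
    ((hm.comp measurable_fst).mul (hm.comp measurable_snd))
    (C' := (∑ i, |U i (Fin.castLE (Nat.sub_le k 1) l)| * D) *
      (∑ i, |U i (Fin.castLE (Nat.sub_le k 1) l)| * D)) (fun p q => by
        rw [abs_mul]
        exact mul_le_mul (abs_rotatedDev_le hD l p) (abs_rotatedDev_le hD l q) (abs_nonneg _)
          ((abs_nonneg _).trans (abs_rotatedDev_le hD l p))) (Lp.memLp (φ r)),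
    quadForm_mul_self, h.quadForm_varpi_eigen hφ] at key

lemma tendsto_integral_integral_rotatedSum_sq (h : IsLocalAlternative N τ P y η Γ γ d)
    (hU : U ∈ Matrix.orthogonalGroup (Fin k) ℝ) (l : Fin (k - 1)) :
    Tendsto (fun ν => ∫ ω, ∫ p, rotatedSum U (y ν) η (Γ ν) d l (p, ω) ^ 2 ∂volume ∂P ν) atTop
      (𝓝 (∫ p : T × T, (varpi γ p p + rotatedDev U d l p * rotatedDev U d l p))) := by
  obtain ⟨C, D, hC0, hD0, hC, hCγ, hD⟩ := h.exists_bound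
  have e : ∀ ν, ∫ ω, ∫ p, rotatedSum U (y ν) η (Γ ν) d l (p, ω) ^ 2 ∂volume ∂P ν =
      ∫ p, rotatedKernel U (N ν) (Γ ν) d l p p := fun ν =>
    integral_integral_sq_eq (h.memLp_rotatedSum ν l)
      ((h.isSample ν).integral_rotatedSum_mul (h.gaussian ν) (h.two_le ν) l)
  simp_rw [e]
  exact tendsto_integral_diag
    (fun ν => (h.isSample ν).measurable_rotatedKernel (U := U) (h.two_le ν) h.measurable_dev l)
    (fun ν p q => abs_rotatedKernel_le (h.two_le ν) (hC ν) hD l p q)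
    (h.tendsto_rotatedKernel hU l)

/-- The rotated statistic is uniformly approximated by its truncations. -/
lemma exists_tendsto_integral_abs_sub_truncation (h : IsLocalAlternative N τ P y η Γ γ d)
    (hU : U ∈ Matrix.orthogonalGroup (Fin k) ℝ) (hφ : IsEigensystem (varpi γ) lam φ) :
    ∃ ε : ℕ → ℝ, Tendsto ε atTop (𝓝 0) ∧ ∀ R, Tendsto (fun ν =>
      ∫ ω, |(∑ l, ∫ p, rotatedSum U (y ν) η (Γ ν) d l (p, ω) ^ 2) -
        ∑ r ∈ Finset.range R, ∑ l, coeff U y η Γ d φ ν l r ω ^ 2| ∂P ν) atTop (𝓝 (ε R)) := by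
  -- The limiting total energy minus the first R limiting terms, that is, the tail of a convergent
  -- series.
  refine ⟨fun R => ∑ l, ((∫ p : T × T, (varpi γ p p + rotatedDev U d l p * rotatedDev U d l p)) -
    ∑ r ∈ Finset.range R, (lam r + (∫ p, rotatedDev U d l p * φ r p) ^ 2)), ?_, fun R => ?_⟩
  · have : Tendsto (fun R => ∑ l, ((∫ p : T × T, (varpi γ p p +
        rotatedDev U d l p * rotatedDev U d l p)) -
        ∑ r ∈ Finset.range R, (lam r + (∫ p, rotatedDev U d l p * φ r p) ^ 2))) atTop
        (𝓝 (∑ l, ((∫ p : T × T, (varpi γ p p + rotatedDev U d l p * rotatedDev U d l p)) -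
          ∫ p : T × T, (varpi γ p p + rotatedDev U d l p * rotatedDev U d l p)))) :=
      tendsto_finsetSum _ fun l _ => tendsto_const_nhds.sub
        (h.hasSum_rotated hφ U l).tendsto_sum_nat
    simpa using this
  · refine (tendsto_finsetSum _ fun l _ => (h.tendsto_integral_integral_rotatedSum_sq hU l).sub
      (tendsto_finsetSum (Finset.range R) fun r _ =>
        h.tendsto_integral_coeff_sq hU hφ l r)).congr fun ν => ?_
    have hc : ∀ l r, Integrable (fun ω => coeff U y η Γ d φ ν l r ω ^ 2) (P ν) := fun l r =>
      (h.memLp_coeff ν l r).integrable_sq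
    have hi : ∀ l, Integrable (fun ω => (∫ p, rotatedSum U (y ν) η (Γ ν) d l (p, ω) ^ 2) -
        ∑ r ∈ Finset.range R, coeff U y η Γ d φ ν l r ω ^ 2) (P ν) := fun l =>
      (h.integrable_integral_rotatedSum_sq ν l).sub
        (integrable_finsetSum _ fun r _ => hc l r)
    have e1 : ∀ l, (∫ ω, ∫ p, rotatedSum U (y ν) η (Γ ν) d l (p, ω) ^ 2 ∂volume ∂P ν) -
        ∑ r ∈ Finset.range R, ∫ ω, coeff U y η Γ d φ ν l r ω ^ 2 ∂P ν =
        ∫ ω, ((∫ p, rotatedSum U (y ν) η (Γ ν) d l (p, ω) ^ 2) -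
          ∑ r ∈ Finset.range R, coeff U y η Γ d φ ν l r ω ^ 2) ∂P ν := by
      intro l
      rw [integral_sub (h.integrable_integral_rotatedSum_sq ν l)
        (integrable_finsetSum _ fun r _ => hc l r), integral_finsetSum _ fun r _ => hc l r]
    simp_rw [e1]
    rw [← integral_finsetSum _ fun l _ => hi l]
    refine integral_congr_ae ?_
    have hs : ∀ᵐ ω ∂P ν, ∀ l, MemLp (fun p => rotatedSum U (y ν) η (Γ ν) d l (p, ω)) 2 volume :=
      ae_all_iff.2 fun l => memLp_two_section (h.measurable_rotatedSum ν l) (h.memLp_rotatedSum ν l)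
    filter_upwards [hs] with ω hω
    -- By Bessel's inequality the truncation error is nonnegative, so its L¹ norm is a difference of
    -- expectations.
    rw [Finset.sum_comm (s := Finset.range R), ← Finset.sum_sub_distrib, abs_of_nonneg]
    refine Finset.sum_nonneg fun l _ => sub_nonneg.2 ?_
    exact sum_le_hasSum _ (fun r _ => sq_nonneg _) (hasSum_sq_integral φ (hω l))

end IsLocalAlternative

/-! ### The quadratic form I − bbᵀ -/

section Algebra

variable {k : ℕ}

/-- Pythagoras for the projection onto the orthogonal complement of a unit vector. -/
lemma sum_sq_sub_mul_sum {b z : Fin k → ℝ} (hb : ∑ i, b i ^ 2 = 1) :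
    ∑ i, (z i - b i * ∑ j, b j * z j) ^ 2 = ∑ i, z i ^ 2 - (∑ i, b i * z i) ^ 2 := by
  set m := ∑ j, b j * z j with hm
  have : ∀ i, (z i - b i * m) ^ 2 = z i ^ 2 - 2 * m * (b i * z i) + b i ^ 2 * m ^ 2 := fun i => by
    ring
  simp_rw [this, Finset.sum_add_distrib, Finset.sum_sub_distrib, ← Finset.mul_sum,
    ← Finset.sum_mul, hb, ← hm]
  ring

/-- The sum of squares of the first `k - 1` rotated coordinates. -/
lemma sum_sq_rotation {τ : Fin k → ℝ} {U : Matrix (Fin k) (Fin k) ℝ}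
    (hW : limitW τ = U * diagOneZero k * U.transpose) (q : Fin k → ℝ) :
    ∑ l, (∑ i, U i (Fin.castLE (Nat.sub_le k 1) l) * q i) ^ 2 =
      ∑ i, q i ^ 2 - (∑ i, √(τ i) * q i) ^ 2 := by
  have h1 : q ⬝ᵥ (limitW τ).mulVec q = ∑ i, q i ^ 2 - (∑ i, √(τ i) * q i) ^ 2 := by
    rw [limitW, Matrix.sub_mulVec, Matrix.one_mulVec, dotProduct_sub, Matrix.vecMulVec_mulVec,
      dotProduct_smul]
    simp only [dotProduct, sq, MulOpposite.smul_eq_mul_unop, MulOpposite.unop_op]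
    simp_rw [mul_comm (q _) (√(τ _))]
  rw [← h1, hW, ← Matrix.mulVec_mulVec, ← Matrix.mulVec_mulVec, Matrix.dotProduct_mulVec,
    ← Matrix.mulVec_transpose]
  simp only [dotProduct, diagOneZero, Matrix.mulVec_diagonal]
  obtain _ | m := k
  · simp
  · rw [Fin.sum_univ_castSucc]
    simp only [Fin.val_castSucc, add_lt_add_iff_right, Fin.is_lt, if_true, one_mul, Fin.val_last,
      lt_self_iff_false, if_false, zero_mul, mul_zero, add_zero, ← sq]
    rfl

/-- Young's inequality with weight ε on 2|f − g||g|: a large constant falls on the small difference,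
and a small one on the merely bounded term. -/
lemma abs_sq_sub_sq_le {ε : ℝ} (hε : 0 < ε) (f g : ℝ) :
    |f ^ 2 - g ^ 2| ≤ (1 + ε⁻¹) * (f - g) ^ 2 + ε * g ^ 2 := by
  have key : 2 * (|f - g| * |g|) ≤ ε⁻¹ * (f - g) ^ 2 + ε * g ^ 2 := by
    have h0 : 0 ≤ ε⁻¹ * (|f - g| - ε * |g|) ^ 2 := by positivity
    have e : ε⁻¹ * (|f - g| - ε * |g|) ^ 2 =
        ε⁻¹ * |f - g| ^ 2 - 2 * (|f - g| * |g|) + ε * |g| ^ 2 := by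
      field_simp
      ring
    rw [e, sq_abs, sq_abs] at h0
    linarith
  have e : f ^ 2 - g ^ 2 = (f - g) ^ 2 + 2 * ((f - g) * g) := by ring
  rw [e]
  refine (abs_add_le _ _).trans ?_
  rw [abs_of_nonneg (sq_nonneg _), abs_mul, abs_mul, abs_two]
  linarith

/-- Stability of the quadratic form `I - b bᵀ` under perturbation of `b` and of the vector. -/
lemma abs_quadratic_sub_le {b c : Fin k → ℝ} (hb : ∀ i, |b i| ≤ 1) (hc : ∀ i, |c i| ≤ 1) {ε : ℝ}
    (hε : 0 < ε) (q e : Fin k → ℝ) :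
    |(∑ i, (q i - e i) ^ 2 - (∑ i, b i * (q i - e i)) ^ 2) -
      (∑ i, q i ^ 2 - (∑ i, c i * q i) ^ 2)| ≤
    ∑ i, ((1 + ε⁻¹) * (1 + 2 * k) * e i ^ 2 +
      ((1 + ε⁻¹) * (2 * k) * (b i - c i) ^ 2 + ε * (1 + k)) * q i ^ 2) := by
  have hε' : 0 < 1 + ε⁻¹ := by positivity
  have h1 : |∑ i, (q i - e i) ^ 2 - ∑ i, q i ^ 2| ≤
      ∑ i, ((1 + ε⁻¹) * e i ^ 2 + ε * q i ^ 2) := by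
    rw [← Finset.sum_sub_distrib]
    refine (Finset.abs_sum_le_sum_abs _ _).trans (Finset.sum_le_sum fun i _ => ?_)
    have := abs_sq_sub_sq_le hε (q i - e i) (q i)
    simpa using this
  have cs : ∀ f : Fin k → ℝ, (∑ i, f i) ^ 2 ≤ k * ∑ i, f i ^ 2 := fun f => by
    simpa using sq_sum_le_card_mul_sum_sq (s := Finset.univ) (f := f)
  have hsq : ∀ x : ℝ, |x| ≤ 1 → x ^ 2 ≤ 1 := fun x hx => by
    rw [← sq_abs]; exact pow_le_one₀ (abs_nonneg _) hx
  have h2 : (∑ i, b i * (q i - e i) - ∑ i, c i * q i) ^ 2 ≤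
      ∑ i, (2 * k * (b i - c i) ^ 2 * q i ^ 2 + 2 * k * e i ^ 2) := by
    rw [← Finset.sum_sub_distrib]
    refine (cs _).trans ?_
    rw [Finset.mul_sum]
    refine Finset.sum_le_sum fun i _ => ?_
    have e1 : (b i * (q i - e i) - c i * q i) ^ 2 ≤
        2 * ((b i - c i) ^ 2 * q i ^ 2 + e i ^ 2) := by
      have a1 : (b i * (q i - e i) - c i * q i) ^ 2 ≤
          2 * (((b i - c i) * q i) ^ 2 + (b i * e i) ^ 2) := by
        nlinarith [sq_nonneg ((b i - c i) * q i + b i * e i)]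
      have a2 : (b i * e i) ^ 2 ≤ e i ^ 2 := by
        rw [mul_pow]
        exact mul_le_of_le_one_left (sq_nonneg _) (hsq _ (hb i))
      rw [mul_pow] at a1
      linarith
    have := mul_le_mul_of_nonneg_left e1 (Nat.cast_nonneg (α := ℝ) k)
    linarith
  have h3 : (∑ i, c i * q i) ^ 2 ≤ ∑ i, k * q i ^ 2 := by
    refine (cs _).trans ?_
    rw [Finset.mul_sum]
    refine Finset.sum_le_sum fun i _ => mul_le_mul_of_nonneg_left ?_ (Nat.cast_nonneg _)
    rw [mul_pow]
    exact mul_le_of_le_one_left (sq_nonneg _) (hsq _ (hc i))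
  have h4 := abs_sq_sub_sq_le hε (∑ i, b i * (q i - e i)) (∑ i, c i * q i)
  have h5 := mul_le_mul_of_nonneg_left h2 hε'.le
  have h6 := mul_le_mul_of_nonneg_left h3 hε.le
  have e0 : (∑ i, (q i - e i) ^ 2 - (∑ i, b i * (q i - e i)) ^ 2) -
      (∑ i, q i ^ 2 - (∑ i, c i * q i) ^ 2) = (∑ i, (q i - e i) ^ 2 - ∑ i, q i ^ 2) -
      ((∑ i, b i * (q i - e i)) ^ 2 - (∑ i, c i * q i) ^ 2) := by ring
  rw [e0]
  refine (abs_sub _ _).trans ?_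
  refine (add_le_add h1 (h4.trans (add_le_add h5 h6))).trans (le_of_eq ?_)
  rw [Finset.mul_sum, Finset.mul_sum, ← Finset.sum_add_distrib, ← Finset.sum_add_distrib]
  refine Finset.sum_congr rfl fun i _ => ?_
  ring

end Algebra

/-! ### The pooled covariance as a weighted mean -/

section Pooled

variable {T Ω : Type*} {k : ℕ} {N : Fin k → ℕ}

/-- The weight of the `i`-th sample in the pooled covariance function. -/
noncomputable def poolWeight (N : Fin k → ℕ) (i : Fin k) : ℝ :=
  √((N i : ℝ) - 1) / √((∑ i, (N i : ℝ)) - k)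

lemma sum_sub_card_eq (N : Fin k → ℕ) : (∑ i, (N i : ℝ)) - k = ∑ i, ((N i : ℝ) - 1) := by
  simp

lemma sum_sub_card_pos [Nonempty (Fin k)] (hN : ∀ i, 2 ≤ N i) : 0 < (∑ i, (N i : ℝ)) - k := by
  rw [sum_sub_card_eq]
  refine Finset.sum_pos (fun i _ => ?_) Finset.univ_nonempty
  have := two_le_cast (hN i)
  linarith

lemma poolWeight_sq (hN : ∀ i, 2 ≤ N i) (i : Fin k) :
    poolWeight N i ^ 2 = ((N i : ℝ) - 1) / ((∑ i, (N i : ℝ)) - k) := by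
  have : Nonempty (Fin k) := ⟨i⟩
  have h1 := two_le_cast (hN i)
  rw [poolWeight, div_pow, Real.sq_sqrt (by linarith), Real.sq_sqrt (sum_sub_card_pos hN).le]

lemma sum_poolWeight_sq [Nonempty (Fin k)] (hN : ∀ i, 2 ≤ N i) :
    ∑ i, poolWeight N i ^ 2 = 1 := by
  simp_rw [poolWeight_sq hN, ← Finset.sum_div]
  rw [← sum_sub_card_eq, div_self (sum_sub_card_pos hN).ne']

lemma abs_poolWeight_le (hN : ∀ i, 2 ≤ N i) (i : Fin k) : |poolWeight N i| ≤ 1 := by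
  have : Nonempty (Fin k) := ⟨i⟩
  rw [← sq_le_one_iff_abs_le_one, ← sum_poolWeight_sq hN]
  exact Finset.single_le_sum (f := fun i => poolWeight N i ^ 2) (fun i _ => sq_nonneg _)
    (Finset.mem_univ i)

lemma sqrt_mul_pooledCov_sub [Nonempty (Fin k)] (hN : ∀ i, 2 ≤ N i)
    (y : (i : Fin k) → Fin (N i) → T → Ω → ℝ) (s t : T) (ω : Ω) (c : ℝ) :
    √((∑ i, (N i : ℝ)) - k) * (pooledCov y s t ω - c) =
      ∑ i, poolWeight N i * (√((N i : ℝ) - 1) * (sampleCov (y i) s t ω - c)) := by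
  have h0 := sum_sub_card_pos hN
  have hs : √((∑ i, (N i : ℝ)) - k) ≠ 0 := (Real.sqrt_pos.2 h0).ne'
  have e : ∀ i, poolWeight N i * (√((N i : ℝ) - 1) * (sampleCov (y i) s t ω - c)) =
      (√((∑ i, (N i : ℝ)) - k))⁻¹ *
        (((N i : ℝ) - 1) * sampleCov (y i) s t ω - ((N i : ℝ) - 1) * c) := by
    intro i
    have h1 := two_le_cast (hN i)
    have h2 := Real.mul_self_sqrt (show (0 : ℝ) ≤ (N i : ℝ) - 1 by linarith)
    rw [poolWeight, div_eq_mul_inv]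
    linear_combination (√((∑ i, (N i : ℝ)) - k))⁻¹ * (sampleCov (y i) s t ω - c) * h2
  simp_rw [e]
  rw [← Finset.mul_sum, Finset.sum_sub_distrib, ← Finset.sum_mul, ← sum_sub_card_eq, pooledCov,
    eq_inv_mul_iff_mul_eq₀ hs, ← mul_assoc, Real.mul_self_sqrt h0.le, mul_sub,
    mul_div_cancel₀ _ h0.ne']

/-- With b the unit vector of pooling weights, the residual vector is z − b⟨b, z⟩. The reference
value c is free, and is later taken to be γ(s, t). -/
lemma sqrt_mul_sampleCov_sub_pooledCov [Nonempty (Fin k)] (hN : ∀ i, 2 ≤ N i)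
    (y : (i : Fin k) → Fin (N i) → T → Ω → ℝ) (s t : T) (ω : Ω) (c : ℝ) (i : Fin k) :
    √((N i : ℝ) - 1) * (sampleCov (y i) s t ω - pooledCov y s t ω) =
      √((N i : ℝ) - 1) * (sampleCov (y i) s t ω - c) - poolWeight N i *
        ∑ j, poolWeight N j * (√((N j : ℝ) - 1) * (sampleCov (y j) s t ω - c)) := by
  rw [← sqrt_mul_pooledCov_sub hN, poolWeight, ← mul_assoc,
    div_mul_cancel₀ _ (Real.sqrt_pos.2 (sum_sub_card_pos hN)).ne']
  ring

end Pooled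

lemma integral_sq_prod_le {S Ω : Type*} [MeasurableSpace S] {μ : Measure S} [IsFiniteMeasure μ]
    [MeasurableSpace Ω] {P : Measure Ω} [IsProbabilityMeasure P] {F : S × Ω → ℝ}
    (hF2 : MemLp F 2 (μ.prod P)) {C : ℝ} (hC : ∀ p, ∫ ω, F (p, ω) ^ 2 ∂P ≤ C) :
    ∫ z, F z ^ 2 ∂(μ.prod P) ≤ μ.real Set.univ * C := by
  rw [integral_prod _ hF2.integrable_sq]
  have := integral_mono_of_nonneg (μ := μ) (f := fun p => ∫ ω, F (p, ω) ^ 2 ∂P) (g := fun _ => C)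
    (ae_of_all _ fun p => integral_nonneg fun ω => sq_nonneg _) (integrable_const C)
    (ae_of_all _ hC)
  simpa using this

/-! ### Asymptotic equivalence of the test statistic and the rotated statistic -/

namespace IsLocalAlternative

variable {T : Type*} [MeasureSpace T] [IsFiniteMeasure (volume : Measure T)] {k : ℕ}
  {N : ℕ → Fin k → ℕ} {τ : Fin k → ℝ} {Ω : ℕ → Type*} [∀ ν, MeasurableSpace (Ω ν)]
  {P : (ν : ℕ) → Measure (Ω ν)} [∀ ν, IsProbabilityMeasure (P ν)]
  {y : (ν : ℕ) → (i : Fin k) → Fin (N ν i) → T → Ω ν → ℝ} {η : Fin k → T → ℝ}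
  {Γ : ℕ → Fin k → T → T → ℝ} {γ : T → T → ℝ} {d : Fin k → T → T → ℝ}
  {U : Matrix (Fin k) (Fin k) ℝ}

lemma sqrt_mul_sampleCov_sub (h : IsLocalAlternative N τ P y η Γ γ d) (ν : ℕ) (i : Fin k)
    (p : T × T) (ω : Ω ν) :
    √((N ν i : ℝ) - 1) * (sampleCov (y ν i) p.1 p.2 ω - γ p.1 p.2) =
      (sumDev (y ν) η (Γ ν) i (p, ω) + d i p.1 p.2) - meanDev (y ν) η (Γ ν) i (p, ω) := by
  have h1 := sampleCov_eq (y ν) η (Γ ν) (h.two_le ν i) p ω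
  have h2 : √((N ν i : ℝ) - 1) * (√((N ν i : ℝ) - 1))⁻¹ = 1 :=
    mul_inv_cancel₀ (inv_pos.1 (h.inv_sqrt_pos ν i)).ne'
  have h3 := h.cov_eq ν i p.1 p.2
  rw [h3] at h1
  linear_combination h1 + d i p.1 p.2 * h2

lemma tendsto_poolWeight (h : IsLocalAlternative N τ P y η Γ γ d) (i : Fin k) :
    Tendsto (fun ν => poolWeight (N ν) i) atTop (𝓝 √(τ i)) := by
  have hinv : Tendsto (fun ν => (∑ i, (N ν i : ℝ))⁻¹) atTop (𝓝 0) :=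
    tendsto_inv_atTop_zero.comp h.tendsto_sum_cast
  -- Numerator and denominator of the squared weight, divided by the total sample size.
  have h1 : Tendsto (fun ν => ((N ν i : ℝ) / (∑ i, (N ν i : ℝ)) - (∑ i, (N ν i : ℝ))⁻¹) /
      (1 - k * (∑ i, (N ν i : ℝ))⁻¹)) atTop (𝓝 ((τ i - 0) / (1 - k * 0))) :=
    ((h.tendsto_ratio i).sub hinv).div (tendsto_const_nhds.sub (hinv.const_mul _)) (by simp)
  simp only [sub_zero, mul_zero, div_one] at h1
  refine h1.sqrt.congr' ?_
  filter_upwards [h.tendsto_sum_cast.eventually_gt_atTop 0] with ν hν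
  have h2 := two_le_cast (h.two_le ν i)
  rw [poolWeight, ← Real.sqrt_div (by linarith)]
  congr 1
  rw [← mul_div_mul_left _ _ hν.ne']
  congr 1 <;> field_simp

lemma abs_sqrt_ratio_le (h : IsLocalAlternative N τ P y η Γ γ d) (i : Fin k) : |√(τ i)| ≤ 1 := by
  rw [abs_of_nonneg (Real.sqrt_nonneg _)]
  refine Real.sqrt_le_iff.2 ⟨zero_le_one, ?_⟩
  rw [one_pow, ← h.sum_eq_one]
  exact Finset.single_le_sum (f := τ) (fun i _ => (h.pos i).le) (Finset.mem_univ i)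

lemma measurable_shiftedDev (h : IsLocalAlternative N τ P y η Γ γ d) (ν : ℕ) (i : Fin k) :
    Measurable fun z : (T × T) × Ω ν => sumDev (y ν) η (Γ ν) i z + d i z.1.1 z.1.2 :=
  ((h.isSample ν).measurable_sumDev (h.two_le ν) i).add ((h.measurable_dev i).comp measurable_fst)

lemma memLp_shiftedDev_eval (h : IsLocalAlternative N τ P y η Γ γ d) (ν : ℕ) (i : Fin k)
    (p : T × T) : MemLp (fun ω => sumDev (y ν) η (Γ ν) i (p, ω) + d i p.1 p.2) 2 (P ν) :=
  (IsSample.memLp_sumDev (h.gaussian ν) i p).add (memLp_const _)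

lemma integral_shiftedDev_sq_le (h : IsLocalAlternative N τ P y η Γ γ d) {C D : ℝ}
    (hC : ∀ ν i s t, |Γ ν i s t| ≤ C) (hD : ∀ i s t, |d i s t| ≤ D) (ν : ℕ) (i : Fin k)
    (p : T × T) :
    ∫ ω, (sumDev (y ν) η (Γ ν) i (p, ω) + d i p.1 p.2) ^ 2 ∂P ν ≤ 8 * C ^ 2 + 2 * D ^ 2 := by
  have hv := IsSample.memLp_sumDev (η := η) (Γ := Γ ν) (h.gaussian ν) i p
  have h1 : ∫ ω, (sumDev (y ν) η (Γ ν) i (p, ω) + d i p.1 p.2) ^ 2 ∂P ν ≤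
      ∫ ω, (2 * sumDev (y ν) η (Γ ν) i (p, ω) ^ 2 + 2 * d i p.1 p.2 ^ 2) ∂P ν := by
    refine integral_mono (h.memLp_shiftedDev_eval ν i p).integrable_sq
      ((hv.integrable_sq.const_mul 2).add (integrable_const _)) fun ω => ?_
    have := sq_nonneg (sumDev (y ν) η (Γ ν) i (p, ω) - d i p.1 p.2)
    simp only
    linarith
  rw [integral_add (hv.integrable_sq.const_mul 2) (integrable_const _), integral_const_mul] at h1
  simp_rw [sq (sumDev (y ν) η (Γ ν) i _)] at h1
  rw [(h.isSample ν).integral_sumDev_mul_self (h.gaussian ν) (h.two_le ν)] at h1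
  simp only [integral_const, probReal_univ, smul_eq_mul, one_mul] at h1
  refine h1.trans ?_
  obtain ⟨a0, a2⟩ := div_sub_one_mem (h.two_le ν i)
  have b1 : (N ν i : ℝ) / ((N ν i : ℝ) - 1) * varpi (Γ ν i) p p ≤ 2 * (2 * C ^ 2) :=
    (mul_le_mul_of_nonneg_left ((le_abs_self _).trans (abs_varpi_le (hC ν i) p p)) a0).trans
      (mul_le_mul_of_nonneg_right a2 (by positivity))
  have b2 : d i p.1 p.2 ^ 2 ≤ D ^ 2 := sq_le_sq' (abs_le.1 (hD i _ _)).1 (abs_le.1 (hD i _ _)).2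
  linarith

lemma memLp_shiftedDev (h : IsLocalAlternative N τ P y η Γ γ d) (ν : ℕ) (i : Fin k) :
    MemLp (fun z : (T × T) × Ω ν => sumDev (y ν) η (Γ ν) i z + d i z.1.1 z.1.2) 2
      ((volume : Measure (T × T)).prod (P ν)) := by
  obtain ⟨C, D, hC0, hD0, hC, hCγ, hD⟩ := h.exists_bound
  exact memLp_two_prod (h.measurable_shiftedDev ν i) (h.memLp_shiftedDev_eval ν i)
    (h.integral_shiftedDev_sq_le hC hD ν i)

lemma measurable_meanDev (h : IsLocalAlternative N τ P y η Γ γ d) (ν : ℕ) (i : Fin k) :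
    Measurable (meanDev (y ν) η (Γ ν) i) := (h.isSample ν).measurable_meanDev (h.two_le ν) i

lemma memLp_meanDev (h : IsLocalAlternative N τ P y η Γ γ d) (ν : ℕ) (i : Fin k) :
    MemLp (meanDev (y ν) η (Γ ν) i) 2 ((volume : Measure (T × T)).prod (P ν)) := by
  obtain ⟨C, D, hC0, hD0, hC, hCγ, hD⟩ := h.exists_bound
  have := (h.isSample ν).meanDev_moments (h.gaussian ν) (h.two_le ν) (hC ν) i
  exact memLp_two_prod (h.measurable_meanDev ν i) (fun p => (this p).1) (fun p => (this p).2)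

/-- The scaled deviation of the `i`-th sample covariance function from the pooled one. -/
noncomputable def residual (y : (ν : ℕ) → (i : Fin k) → Fin (N ν i) → T → Ω ν → ℝ) (ν : ℕ)
    (i : Fin k) (z : (T × T) × Ω ν) : ℝ :=
  √((N ν i : ℝ) - 1) *
    (sampleCov (y ν i) z.1.1 z.1.2 z.2 - pooledCov (y ν) z.1.1 z.1.2 z.2)

lemma residual_eq (h : IsLocalAlternative N τ P y η Γ γ d) (ν : ℕ) (i : Fin k)
    (z : (T × T) × Ω ν) : residual y ν i z =
      ((sumDev (y ν) η (Γ ν) i z + d i z.1.1 z.1.2) - meanDev (y ν) η (Γ ν) i z) -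
        poolWeight (N ν) i * ∑ j, poolWeight (N ν) j *
          ((sumDev (y ν) η (Γ ν) j z + d j z.1.1 z.1.2) - meanDev (y ν) η (Γ ν) j z) := by
  have := h.nonempty
  rw [residual, sqrt_mul_sampleCov_sub_pooledCov (h.two_le ν) (y ν) _ _ _ (γ z.1.1 z.1.2)]
  simp_rw [h.sqrt_mul_sampleCov_sub]

lemma measurable_residual (h : IsLocalAlternative N τ P y η Γ γ d) (ν : ℕ) (i : Fin k) :
    Measurable (residual y ν i) := by
  have e : residual y ν i = fun z => _ := funext fun z => h.residual_eq ν i z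
  rw [e]
  have hm := fun i => (h.measurable_shiftedDev ν i).sub (h.measurable_meanDev ν i)
  exact (hm i).sub ((Finset.measurable_fun_sum _ fun j _ => (hm j).const_mul _).const_mul _)

lemma memLp_residual (h : IsLocalAlternative N τ P y η Γ γ d) (ν : ℕ) (i : Fin k) :
    MemLp (residual y ν i) 2 ((volume : Measure (T × T)).prod (P ν)) := by
  have e : residual y ν i = fun z => _ := funext fun z => h.residual_eq ν i z
  rw [e]
  have hm := fun i => (h.memLp_shiftedDev ν i).sub (h.memLp_meanDev ν i)
  have hs : MemLp (fun z => ∑ j, poolWeight (N ν) j *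
      ((sumDev (y ν) η (Γ ν) j z + d j z.1.1 z.1.2) - meanDev (y ν) η (Γ ν) j z)) 2
      ((volume : Measure (T × T)).prod (P ν)) :=
    memLp_finsetSum _ fun j _ => (hm j).const_mul _
  exact (hm i).sub (hs.const_mul _)

/-- The statistic is an iterated integral; it agrees with the integral over the product wherever the
residual sections are square integrable, hence almost surely. -/
lemma testStat_ae_eq (h : IsLocalAlternative N τ P y η Γ γ d) (ν : ℕ) :
    ∀ᵐ ω ∂P ν, testStat (y ν) ω = ∫ p, ∑ i, residual y ν i (p, ω) ^ 2 := by
  have hs : ∀ᵐ ω ∂P ν, ∀ i, MemLp (fun p => residual y ν i (p, ω)) 2 volume :=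
    ae_all_iff.2 fun i => memLp_two_section (h.measurable_residual ν i) (h.memLp_residual ν i)
  filter_upwards [hs] with ω hω
  rw [integral_finsetSum _ fun i _ => (hω i).integrable_sq, testStat]
  refine Finset.sum_congr rfl fun i _ => ?_
  have h2 := two_le_cast (h.two_le ν i)
  have e : ∀ p : T × T, (sampleCov (y ν i) p.1 p.2 ω - pooledCov (y ν) p.1 p.2 ω) ^ 2 =
      ((N ν i : ℝ) - 1)⁻¹ * residual y ν i (p, ω) ^ 2 := by
    intro p
    rw [residual, mul_pow, Real.sq_sqrt (by linarith), inv_mul_cancel_left₀ (by linarith)]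
  have hi : Integrable (fun p : T × T =>
      (sampleCov (y ν i) p.1 p.2 ω - pooledCov (y ν) p.1 p.2 ω) ^ 2)
      ((volume : Measure T).prod volume) := by
    simp_rw [e]
    exact (hω i).integrable_sq.const_mul _
  rw [← integral_prod _ hi, ← Measure.volume_eq_prod]
  simp_rw [e]
  rw [integral_const_mul, mul_inv_cancel_left₀ (by linarith)]

lemma integrable_residual_sq (h : IsLocalAlternative N τ P y η Γ γ d) (ν : ℕ) :
    Integrable (fun z => ∑ i, residual y ν i z ^ 2) ((volume : Measure (T × T)).prod (P ν)) :=
  integrable_finsetSum _ fun i _ => (h.memLp_residual ν i).integrable_sq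

lemma integrable_testStat (h : IsLocalAlternative N τ P y η Γ γ d) (ν : ℕ) :
    Integrable (testStat (y ν)) (P ν) :=
  (h.integrable_residual_sq ν).integral_prod_right.congr
    ((h.testStat_ae_eq ν).mono fun _ hω => hω.symm)

lemma integrable_rotatedSum_sq (h : IsLocalAlternative N τ P y η Γ γ d) (ν : ℕ) :
    Integrable (fun z => ∑ l, rotatedSum U (y ν) η (Γ ν) d l z ^ 2)
      ((volume : Measure (T × T)).prod (P ν)) :=
  integrable_finsetSum _ fun l _ => (h.memLp_rotatedSum ν l).integrable_sq

lemma integral_abs_testStat_sub_le (h : IsLocalAlternative N τ P y η Γ γ d) (ν : ℕ) :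
    ∫ ω, |testStat (y ν) ω - ∑ l, ∫ p, rotatedSum U (y ν) η (Γ ν) d l (p, ω) ^ 2| ∂P ν ≤
      ∫ z, |∑ i, residual y ν i z ^ 2 - ∑ l, rotatedSum U (y ν) η (Γ ν) d l z ^ 2|
        ∂((volume : Measure (T × T)).prod (P ν)) := by
  have hG := h.integrable_residual_sq ν
  have hH := h.integrable_rotatedSum_sq (U := U) ν
  have hGH : Integrable (fun z => |∑ i, residual y ν i z ^ 2 -
      ∑ l, rotatedSum U (y ν) η (Γ ν) d l z ^ 2|) ((volume : Measure (T × T)).prod (P ν)) :=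
    (hG.sub hH).abs
  have hs : ∀ᵐ ω ∂P ν, ∀ l, MemLp (fun p => rotatedSum U (y ν) η (Γ ν) d l (p, ω)) 2 volume :=
    ae_all_iff.2 fun l => memLp_two_section (h.measurable_rotatedSum ν l) (h.memLp_rotatedSum ν l)
  rw [integral_prod_symm _ hGH]
  refine integral_mono_of_nonneg (ae_of_all _ fun ω => abs_nonneg _) hGH.integral_prod_right ?_
  filter_upwards [h.testStat_ae_eq ν, hs, hG.prod_left_ae, hH.prod_left_ae] with ω h1 h2 h3 h4
  rw [h1, ← integral_finsetSum _ fun l _ => (h2 l).integrable_sq, ← integral_sub h3 h4]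
  exact abs_integral_le_integral_abs

/-- The test statistic is asymptotically equivalent to the rotated statistic in `L¹`. -/
lemma tendsto_integral_abs_testStat_sub (h : IsLocalAlternative N τ P y η Γ γ d)
    (hW : limitW τ = U * diagOneZero k * U.transpose) :
    Tendsto (fun ν => ∫ ω, |testStat (y ν) ω -
      ∑ l, ∫ p, rotatedSum U (y ν) η (Γ ν) d l (p, ω) ^ 2| ∂P ν) atTop (𝓝 0) := by
  obtain ⟨C, D, hC0, hD0, hC, hCγ, hD⟩ := h.exists_bound
  have hne := h.nonempty
  set V := (volume : Measure (T × T)).real Set.univ with hV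
  set Q := 8 * C ^ 2 + 2 * D ^ 2 with hQ
  have hbound : ∀ ε, 0 < ε → ∀ ν, ∫ ω, |testStat (y ν) ω -
      ∑ l, ∫ p, rotatedSum U (y ν) η (Γ ν) d l (p, ω) ^ 2| ∂P ν ≤
      ∑ i, ((1 + ε⁻¹) * (1 + 2 * k) * (V * (8 * C ^ 2 / ((N ν i : ℝ) - 1))) +
      ((1 + ε⁻¹) * (2 * k) * (poolWeight (N ν) i - √(τ i)) ^ 2 + ε * (1 + k)) * (V * Q)) := by
    intro ε hε ν
    have hpt : ∀ z, |∑ i, residual y ν i z ^ 2 - ∑ l, rotatedSum U (y ν) η (Γ ν) d l z ^ 2| ≤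
        ∑ i, ((1 + ε⁻¹) * (1 + 2 * k) * meanDev (y ν) η (Γ ν) i z ^ 2 +
        ((1 + ε⁻¹) * (2 * k) * (poolWeight (N ν) i - √(τ i)) ^ 2 + ε * (1 + k)) *
          (sumDev (y ν) η (Γ ν) i z + d i z.1.1 z.1.2) ^ 2) := by
      intro z
      simp_rw [h.residual_eq, rotatedSum_eq]
      -- Both integrands become values of a form I − bbᵀ: with the actual weights at q − e, and with
      -- the limit weights √τ at q, where e is the sample mean term.
      rw [sum_sq_sub_mul_sum (sum_poolWeight_sq (h.two_le ν)), sum_sq_rotation hW]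
      exact abs_quadratic_sub_le (abs_poolWeight_le (h.two_le ν)) h.abs_sqrt_ratio_le hε _ _
    have he := fun i => (h.memLp_meanDev ν i).integrable_sq
    have hq := fun i => (h.memLp_shiftedDev ν i).integrable_sq
    refine (h.integral_abs_testStat_sub_le ν).trans ?_
    have hi := fun i => ((he i).const_mul ((1 + ε⁻¹) * (1 + 2 * k))).fun_add
      ((hq i).const_mul ((1 + ε⁻¹) * (2 * k) * (poolWeight (N ν) i - √(τ i)) ^ 2 + ε * (1 + k)))
    refine (integral_mono_of_nonneg (ae_of_all _ fun z => abs_nonneg _)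
      (integrable_finsetSum _ fun i _ => hi i) (ae_of_all _ hpt)).trans ?_
    rw [integral_finsetSum _ fun i _ => hi i]
    refine Finset.sum_le_sum fun i _ => ?_
    rw [integral_add ((he i).const_mul _) ((hq i).const_mul _), integral_const_mul,
      integral_const_mul]
    have b1 := integral_sq_prod_le (h.memLp_meanDev ν i) fun p =>
      ((h.isSample ν).meanDev_moments (h.gaussian ν) (h.two_le ν) (hC ν) i p).2
    have b2 := integral_sq_prod_le (h.memLp_shiftedDev ν i)
      (h.integral_shiftedDev_sq_le hC hD ν i)
    gcongr
  have hlim : ∀ ε, Tendsto (fun ν => ∑ i, ((1 + ε⁻¹) * (1 + 2 * k) *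
      (V * (8 * C ^ 2 / ((N ν i : ℝ) - 1))) +
      ((1 + ε⁻¹) * (2 * k) * (poolWeight (N ν) i - √(τ i)) ^ 2 + ε * (1 + k)) * (V * Q))) atTop
      (𝓝 (∑ i : Fin k, ((1 + ε⁻¹) * (1 + 2 * k) * (V * 0) +
      ((1 + ε⁻¹) * (2 * k) * (√(τ i) - √(τ i)) ^ 2 + ε * (1 + k)) * (V * Q)))) := by
    intro ε
    refine tendsto_finsetSum _ fun i _ => Tendsto.add ?_ ?_
    · refine (Tendsto.const_mul _ ?_).const_mul _
      exact tendsto_const_nhds.div_atTop (tendsto_atTop_add_const_right _ (-1) (h.tendsto_size i))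
    · exact ((((h.tendsto_poolWeight i).sub_const _).pow 2).const_mul _ |>.add_const _).mul_const _
  have hV0 : 0 ≤ V := measureReal_nonneg
  have hQ0 : 0 ≤ Q := by positivity
  have hB : 0 < k * ((1 + k) * (V * Q)) + 1 := by positivity
  refine tendsto_order.2 ⟨fun a ha => Eventually.of_forall fun ν =>
    ha.trans_le (integral_nonneg fun ω => abs_nonneg _), fun a ha => ?_⟩
  -- As ν → ∞ the bound tends to ε k(1 + k)VQ. The extra 1 in the denominator keeps the division
  -- legitimate when VQ = 0 and the final inequality strict.
  set ε := a / (k * ((1 + k) * (V * Q)) + 1) with hε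
  have hε0 : 0 < ε := div_pos ha hB
  have hlt : ∑ i : Fin k, ((1 + ε⁻¹) * (1 + 2 * k) * (V * 0) +
      ((1 + ε⁻¹) * (2 * k) * (√(τ i) - √(τ i)) ^ 2 + ε * (1 + k)) * (V * Q)) < a := by
    have : a = ε * (k * ((1 + k) * (V * Q)) + 1) := (div_mul_cancel₀ _ hB.ne').symm
    simp only [mul_zero, sub_self, ne_eq, OfNat.ofNat_ne_zero, not_false_eq_true, zero_pow,
      zero_add, Finset.sum_const, Finset.card_univ, Fintype.card_fin, nsmul_eq_mul]
    linarith
  filter_upwards [(hlim ε).eventually_lt_const hlt] with ν hν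
  exact (hbound ε hε0 ν).trans_lt hν

end IsLocalAlternative

/-! ### Limit of the covariance of the pooled estimator -/

section Moments

variable {Ω : Type*} [MeasurableSpace Ω] {P : Measure Ω} [IsProbabilityMeasure P]

lemma sq_covariance_le {X Y : Ω → ℝ} (hX : MemLp X 2 P) (hY : MemLp Y 2 P) :
    cov[X, Y; P] ^ 2 ≤ (∫ ω, X ω ^ 2 ∂P) * ∫ ω, Y ω ^ 2 ∂P := by
  have key : ∀ {Z : Ω → ℝ}, MemLp Z 2 P → ∫ ω, (Z ω - ∫ x, Z x ∂P) ^ 2 ∂P ≤ ∫ ω, Z ω ^ 2 ∂P := by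
    intro Z hZ
    rw [← variance_eq_integral hZ.1.aemeasurable]
    exact variance_le_expectation_sq hZ.1
  refine (sq_integral_mul_le (hX.sub (memLp_const _)) (hY.sub (memLp_const _))).trans ?_
  exact mul_le_mul (key hX) (key hY) (integral_nonneg fun ω => sq_nonneg _)
    (integral_nonneg fun ω => sq_nonneg _)

lemma integral_sq_sum_mul_le {k : ℕ} {b : Fin k → ℝ} (hb : ∀ i, |b i| ≤ 1) {f : Fin k → Ω → ℝ}
    (hf : ∀ i, MemLp (f i) 2 P) {B : Fin k → ℝ} (hB : ∀ i, ∫ ω, f i ω ^ 2 ∂P ≤ B i) :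
    ∫ ω, (∑ i, b i * f i ω) ^ 2 ∂P ≤ k * ∑ i, B i := by
  have hi := fun i => (hf i).integrable_sq
  have h1 : ∫ ω, (∑ i, b i * f i ω) ^ 2 ∂P ≤ ∫ ω, k * ∑ i, f i ω ^ 2 ∂P := by
    refine integral_mono_of_nonneg (ae_of_all _ fun ω => sq_nonneg _)
      ((integrable_finsetSum _ fun i _ => hi i).const_mul _) (ae_of_all _ fun ω => ?_)
    have cs := sq_sum_le_card_mul_sum_sq (s := Finset.univ) (f := fun i => b i * f i ω)
    simp only [Finset.card_univ, Fintype.card_fin] at cs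
    refine cs.trans (mul_le_mul_of_nonneg_left (Finset.sum_le_sum fun i _ => ?_)
      (Nat.cast_nonneg _))
    rw [mul_pow]
    refine mul_le_of_le_one_left (sq_nonneg _) ?_
    rw [← sq_abs]
    exact pow_le_one₀ (abs_nonneg _) (hb i)
  refine h1.trans ?_
  rw [integral_const_mul, integral_finsetSum _ fun i _ => hi i]
  exact mul_le_mul_of_nonneg_left (Finset.sum_le_sum fun i _ => hB i) (Nat.cast_nonneg _)

end Moments

namespace IsLocalAlternative

variable {T : Type*} [MeasureSpace T] [IsFiniteMeasure (volume : Measure T)] {k : ℕ}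
  {N : ℕ → Fin k → ℕ} {τ : Fin k → ℝ} {Ω : ℕ → Type*} [∀ ν, MeasurableSpace (Ω ν)]
  {P : (ν : ℕ) → Measure (Ω ν)} [∀ ν, IsProbabilityMeasure (P ν)]
  {y : (ν : ℕ) → (i : Fin k) → Fin (N ν i) → T → Ω ν → ℝ} {η : Fin k → T → ℝ}
  {Γ : ℕ → Fin k → T → T → ℝ} {γ : T → T → ℝ} {d : Fin k → T → T → ℝ}

lemma covariance_sum_shiftedDev (h : IsLocalAlternative N τ P y η Γ γ d) (b : Fin k → ℝ) (ν : ℕ)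
    (p q : T × T) :
    cov[fun ω => ∑ i, b i * (sumDev (y ν) η (Γ ν) i (p, ω) + d i p.1 p.2),
      fun ω => ∑ i, b i * (sumDev (y ν) η (Γ ν) i (q, ω) + d i q.1 q.2); P ν] =
      ∑ i, b i ^ 2 * ((N ν i : ℝ) / ((N ν i : ℝ) - 1) * varpi (Γ ν i) p q) := by
  set W : T × T → Ω ν → ℝ := fun p ω => ∑ i, b i * sumDev (y ν) η (Γ ν) i (p, ω) with hWdef
  have hv := fun i p => IsSample.memLp_sumDev (η := η) (Γ := Γ ν) (h.gaussian ν) i p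
  have hW2 : ∀ p, MemLp (W p) 2 (P ν) := fun p =>
    memLp_finsetSum _ fun i _ => (hv i p).const_mul _
  have hWi : ∀ p, Integrable (W p) (P ν) := fun p => (hW2 p).integrable (by norm_num)
  have hW0 : ∀ p, ∫ ω, W p ω ∂P ν = 0 := by
    intro p
    simp only [hWdef]
    rw [integral_finsetSum _ fun i _ => ((hv i p).integrable (by norm_num)).const_mul _]
    simp [integral_const_mul, (h.isSample ν).integral_sumDev (h.gaussian ν)]
  have e : ∀ p : T × T, (fun ω => ∑ i, b i * (sumDev (y ν) η (Γ ν) i (p, ω) + d i p.1 p.2)) =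
      fun ω => W p ω + ∑ i, b i * d i p.1 p.2 := by
    intro p
    ext ω
    simp only [hWdef, mul_add, Finset.sum_add_distrib]
  rw [e, e, covariance_add_const_left (hWi p), covariance_add_const_right (hWi q),
    covariance_eq_sub (hW2 p) (hW2 q), hW0, zero_mul, sub_zero]
  simp only [hWdef, Pi.mul_apply]
  rw [integral_sum_mul_sum_of_orthogonal (fun i => (hv i p).const_mul _)
    (fun i => (hv i q).const_mul _)]
  · refine Finset.sum_congr rfl fun i _ => ?_
    simp_rw [mul_mul_mul_comm _ (sumDev (y ν) η (Γ ν) i _)]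
    rw [integral_const_mul, (h.isSample ν).integral_sumDev_mul_self (h.gaussian ν) (h.two_le ν), sq]
  · intro i j hij
    simp_rw [mul_mul_mul_comm _ (sumDev (y ν) η (Γ ν) i _)]
    rw [integral_const_mul, (h.isSample ν).integral_sumDev_mul_of_ne (h.gaussian ν) hij, mul_zero]

/-- The covariance function of the pooled sample covariance function converges to `varpi γ`. -/
theorem tendsto_covariance_pooledCov (h : IsLocalAlternative N τ P y η Γ γ d) (p q : T × T) :
    Tendsto (fun ν =>
        cov[fun ω => √((∑ i, (N ν i : ℝ)) - k) * (pooledCov (y ν) p.1 p.2 ω - γ p.1 p.2),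
          fun ω => √((∑ i, (N ν i : ℝ)) - k) * (pooledCov (y ν) q.1 q.2 ω - γ q.1 q.2);
          P ν]) atTop (𝓝 (varpi γ p q)) := by
  obtain ⟨C, D, hC0, hD0, hC, hCγ, hD⟩ := h.exists_bound
  have hne := h.nonempty
  set A : (ν : ℕ) → T × T → Ω ν → ℝ := fun ν p ω =>
    ∑ i, poolWeight (N ν) i * (sumDev (y ν) η (Γ ν) i (p, ω) + d i p.1 p.2) with hA
  set E : (ν : ℕ) → T × T → Ω ν → ℝ := fun ν p ω =>
    ∑ i, poolWeight (N ν) i * meanDev (y ν) η (Γ ν) i (p, ω) with hE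
  have hm := fun ν i p => (h.isSample ν).meanDev_moments (h.gaussian ν) (h.two_le ν) (hC ν) i p
  have hA2 : ∀ ν p, MemLp (A ν p) 2 (P ν) := fun ν p =>
    memLp_finsetSum _ fun i _ => (h.memLp_shiftedDev_eval ν i p).const_mul _
  have hE2 : ∀ ν p, MemLp (E ν p) 2 (P ν) := fun ν p =>
    memLp_finsetSum _ fun i _ => (hm ν i p).1.const_mul _
  have hAb : ∀ ν p, ∫ ω, A ν p ω ^ 2 ∂P ν ≤ k * ∑ i : Fin k, (8 * C ^ 2 + 2 * D ^ 2) :=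
    fun ν p => integral_sq_sum_mul_le (abs_poolWeight_le (h.two_le ν))
      (fun i => h.memLp_shiftedDev_eval ν i p) fun i => h.integral_shiftedDev_sq_le hC hD ν i p
  have hEb : ∀ ν p, ∫ ω, E ν p ω ^ 2 ∂P ν ≤ k * ∑ i, 8 * C ^ 2 / ((N ν i : ℝ) - 1) :=
    fun ν p => integral_sq_sum_mul_le (abs_poolWeight_le (h.two_le ν))
      (fun i => (hm ν i p).1) fun i => (hm ν i p).2
  have hE0 : Tendsto (fun ν => (k : ℝ) * ∑ i, 8 * C ^ 2 / ((N ν i : ℝ) - 1)) atTop (𝓝 0) := by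
    have : Tendsto (fun ν => (k : ℝ) * ∑ i, 8 * C ^ 2 / ((N ν i : ℝ) - 1)) atTop
        (𝓝 ((k : ℝ) * ∑ i : Fin k, 0)) :=
      (tendsto_finsetSum _ fun i _ => tendsto_const_nhds.div_atTop
        (tendsto_atTop_add_const_right _ (-1) (h.tendsto_size i))).const_mul _
    simpa using this
  -- By Cauchy–Schwarz, a covariance vanishes in the limit when one factor is bounded in L² and the
  -- other tends to 0 in L². This disposes of every term involving the sample mean part E.
  have hzero : ∀ {X Y : (ν : ℕ) → Ω ν → ℝ} {B : ℝ}, (∀ ν, MemLp (X ν) 2 (P ν)) →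
      (∀ ν, MemLp (Y ν) 2 (P ν)) → (∀ ν, ∫ ω, X ν ω ^ 2 ∂P ν ≤ B) →
      (∀ ν, ∫ ω, Y ν ω ^ 2 ∂P ν ≤ k * ∑ i, 8 * C ^ 2 / ((N ν i : ℝ) - 1)) →
      Tendsto (fun ν => cov[X ν, Y ν; P ν]) atTop (𝓝 0) := by
    intro X Y B hX hY hXB hYB
    have hl : Tendsto (fun ν => √(B * (k * ∑ i, 8 * C ^ 2 / ((N ν i : ℝ) - 1)))) atTop (𝓝 0) := by
      simpa using (hE0.const_mul B).sqrt
    refine squeeze_zero_norm (fun ν => ?_) hl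
    refine Real.abs_le_sqrt ((sq_covariance_le (hX ν) (hY ν)).trans ?_)
    exact mul_le_mul (hXB ν) (hYB ν) (integral_nonneg fun ω => sq_nonneg _)
      ((integral_nonneg fun ω => sq_nonneg _).trans (hXB ν))
  have hmain : Tendsto (fun ν => cov[A ν p, A ν q; P ν]) atTop (𝓝 (varpi γ p q)) := by
    have e : ∀ ν, cov[A ν p, A ν q; P ν] = _ := fun ν =>
      h.covariance_sum_shiftedDev (poolWeight (N ν)) ν p q
    simp_rw [e]
    have hl : Tendsto (fun ν => ∑ i, poolWeight (N ν) i ^ 2 *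
        ((N ν i : ℝ) / ((N ν i : ℝ) - 1) * varpi (Γ ν i) p q)) atTop
        (𝓝 (∑ i, √(τ i) ^ 2 * (1 * varpi γ p q))) :=
      tendsto_finsetSum _ fun i _ => ((h.tendsto_poolWeight i).pow 2).mul
        ((h.tendsto_size_div i).mul (h.tendsto_varpi i p q))
    simp_rw [one_mul, ← Finset.sum_mul, Real.sq_sqrt (h.pos _).le] at hl
    rwa [h.sum_eq_one, one_mul] at hl
  obtain ⟨B, hB⟩ : ∃ B : ℝ, ∀ ν, (k : ℝ) * ∑ i, 8 * C ^ 2 / ((N ν i : ℝ) - 1) ≤ B := by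
    obtain ⟨B, hB⟩ := hE0.bddAbove_range
    exact ⟨B, fun ν => hB ⟨ν, rfl⟩⟩
  have c1 := hzero (fun ν => hA2 ν p) (fun ν => hE2 ν q) (fun ν => hAb ν p) (fun ν => hEb ν q)
  have c2 := hzero (fun ν => hA2 ν q) (fun ν => hE2 ν p) (fun ν => hAb ν q) (fun ν => hEb ν p)
  have c3 := hzero (fun ν => hE2 ν p) (fun ν => hE2 ν q) (fun ν => (hEb ν p).trans (hB ν))
    (fun ν => hEb ν q)
  have key := ((hmain.sub c1).sub c2).add c3
  rw [sub_zero, sub_zero, add_zero] at key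
  refine key.congr fun ν => ?_
  have e : ∀ p : T × T, (fun ω => √((∑ i, (N ν i : ℝ)) - k) *
      (pooledCov (y ν) p.1 p.2 ω - γ p.1 p.2)) = fun ω => A ν p ω - E ν p ω := by
    intro p
    ext ω
    rw [sqrt_mul_pooledCov_sub (h.two_le ν)]
    simp_rw [h.sqrt_mul_sampleCov_sub, hA, hE, mul_sub, Finset.sum_sub_distrib]
  rw [e, e, covariance_fun_sub_fun_sub (hA2 ν p) (hE2 ν p) (hA2 ν q) (hE2 ν q),
    covariance_comm (E ν p) (A ν q)]

end IsLocalAlternative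

/-! ### Convergence in distribution of the test statistic -/

open Complex in
lemma norm_exp_mul_I_sub_exp_mul_I_le (a b : ℝ) : ‖cexp (a * I) - cexp (b * I)‖ ≤ |a - b| := by
  have e : cexp (a * I) - cexp (b * I) = cexp (b * I) * (cexp (I * (a - b : ℝ)) - 1) := by
    rw [mul_sub, ← Complex.exp_add, mul_one]
    push_cast
    ring_nf
  rw [e, norm_mul, norm_exp_ofReal_mul_I, one_mul]
  exact Real.norm_exp_I_mul_ofReal_sub_one_le

open Complex in
-- The map x ↦ exp(isx) is |s|-Lipschitz, so closeness in L¹ passes to characteristic functions.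
lemma norm_integral_exp_sub_integral_exp_le {Ω : Type*} [MeasurableSpace Ω] {P : Measure Ω}
    [IsProbabilityMeasure P] {X Y : Ω → ℝ} (hX : Integrable X P) (hY : Integrable Y P) (s : ℝ) :
    ‖∫ ω, cexp ((s * X ω : ℝ) * I) ∂P - ∫ ω, cexp ((s * Y ω : ℝ) * I) ∂P‖ ≤
      |s| * ∫ ω, |X ω - Y ω| ∂P := by
  have hi : ∀ {Z : Ω → ℝ}, Integrable Z P → Integrable (fun ω => cexp ((s * Z ω : ℝ) * I)) P := by
    intro Z hZ
    have := hZ.1.aemeasurable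
    refine Integrable.of_bound (C := 1) (AEMeasurable.aestronglyMeasurable (by fun_prop))
      (ae_of_all _ fun ω => ?_)
    rw [norm_exp_ofReal_mul_I]
  rw [← integral_sub (hi hX) (hi hY), ← integral_const_mul]
  refine norm_integral_le_of_norm_le ((hX.sub hY).abs.const_mul _) (ae_of_all _ fun ω => ?_)
  refine (norm_exp_mul_I_sub_exp_mul_I_le _ _).trans (le_of_eq ?_)
  rw [← mul_sub, abs_mul]

/-- Convergence of a sequence through a double-indexed approximation. -/
lemma tendsto_of_approximation {f : ℕ → ℂ} {g : ℕ → ℕ → ℂ} {G : ℕ → ℂ} {L : ℂ} {e : ℕ → ℝ}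
    {e' : ℕ → ℕ → ℝ} {ε : ℕ → ℝ} (hf : ∀ R ν, ‖f ν - g R ν‖ ≤ e ν + e' R ν)
    (he : Tendsto e atTop (𝓝 0)) (he' : ∀ R, Tendsto (e' R) atTop (𝓝 (ε R)))
    (hε : Tendsto ε atTop (𝓝 0)) (hg : ∀ R, Tendsto (g R) atTop (𝓝 (G R)))
    (hG : Tendsto G atTop (𝓝 L)) : Tendsto f atTop (𝓝 L) := by
  rw [tendsto_iff_norm_sub_tendsto_zero]
  have hb : ∀ R ν, ‖f ν - L‖ ≤ (e ν + e' R ν) + (‖g R ν - G R‖ + ‖G R - L‖) := by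
    intro R ν
    have : f ν - L = (f ν - g R ν) + ((g R ν - G R) + (G R - L)) := by ring
    rw [this]
    exact (norm_add_le _ _).trans (add_le_add (hf R ν) (norm_add_le _ _))
  have hlim : ∀ R, Tendsto (fun ν => (e ν + e' R ν) + (‖g R ν - G R‖ + ‖G R - L‖)) atTop
      (𝓝 ((0 + ε R) + (0 + ‖G R - L‖))) := fun R =>
    (he.add (he' R)).add ((tendsto_iff_norm_sub_tendsto_zero.1 (hg R)).add_const _)
  have hR : Tendsto (fun R => (0 + ε R) + (0 + ‖G R - L‖)) atTop (𝓝 0) := by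
    simpa using hε.add (tendsto_iff_norm_sub_tendsto_zero.1 hG)
  refine tendsto_order.2 ⟨fun a ha => Eventually.of_forall fun ν => ha.trans_le (norm_nonneg _),
    fun a ha => ?_⟩
  -- The truncation level is fixed first; only then does ν tend to infinity.
  obtain ⟨R, hRa⟩ := (hR.eventually_lt_const ha).exists
  filter_upwards [(hlim R).eventually_lt_const hRa] with ν hν
  exact (hb R ν).trans_lt hν

open Complex in
lemma tendstoInDistribution_of_tendsto_integral_exp {Ω : ℕ → Type*} [∀ ν, MeasurableSpace (Ω ν)]
    {P : (ν : ℕ) → Measure (Ω ν)} [∀ ν, IsProbabilityMeasure (P ν)] {Ω' : Type*}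
    [MeasurableSpace Ω'] {P' : Measure Ω'} [IsProbabilityMeasure P'] {X : (ν : ℕ) → Ω ν → ℝ}
    {Z : Ω' → ℝ} (hX : ∀ ν, AEMeasurable (X ν) (P ν)) (hZ : AEMeasurable Z P')
    (h : ∀ s : ℝ, Tendsto (fun ν => ∫ ω, cexp ((s * X ν ω : ℝ) * I) ∂P ν) atTop
      (𝓝 (∫ ω, cexp ((s * Z ω : ℝ) * I) ∂P'))) : TendstoInDistribution X atTop Z P P' where
  forall_aemeasurable := hX
  aemeasurable_limit := hZ
  tendsto := by
    refine ProbabilityMeasure.tendsto_of_tendsto_charFun fun s => ?_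
    have e : ∀ ν, charFun ((P ν).map (X ν)) s = ∫ ω, cexp ((s * X ν ω : ℝ) * I) ∂P ν := by
      intro ν
      rw [charFun_apply_real, integral_map (hX ν) (by fun_prop)]
      simp
    have e' : charFun (P'.map Z) s = ∫ ω, cexp ((s * Z ω : ℝ) * I) ∂P' := by
      rw [charFun_apply_real, integral_map hZ (by fun_prop)]
      simp
    change Tendsto (fun ν => charFun ((P ν).map (X ν)) s) atTop (𝓝 (charFun (P'.map Z) s))
    rw [e']
    simp_rw [e]
    exact h s

lemma deltaSq_nonneg {T : Type*} [MeasureSpace T] {k : ℕ} (U : Matrix (Fin k) (Fin k) ℝ)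
    (d : Fin k → T → T → ℝ) (φ : T × T → ℝ) : 0 ≤ deltaSq U d φ :=
  Finset.sum_nonneg fun _ _ => sq_nonneg _

namespace IsLocalAlternative

variable {T : Type*} [MeasureSpace T] [IsFiniteMeasure (volume : Measure T)] {k : ℕ}
  {N : ℕ → Fin k → ℕ} {τ : Fin k → ℝ} {Ω : ℕ → Type*} [∀ ν, MeasurableSpace (Ω ν)]
  {P : (ν : ℕ) → Measure (Ω ν)} [∀ ν, IsProbabilityMeasure (P ν)]
  {y : (ν : ℕ) → (i : Fin k) → Fin (N ν i) → T → Ω ν → ℝ} {η : Fin k → T → ℝ}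
  {Γ : ℕ → Fin k → T → T → ℝ} {γ : T → T → ℝ} {d : Fin k → T → T → ℝ}
  {lam : ℕ → ℝ} {φ : HilbertBasis ℕ ℝ (Lp ℝ 2 (volume : Measure (T × T)))}
  {U : Matrix (Fin k) (Fin k) ℝ} {Ω' : Type*} [MeasurableSpace Ω'] {P' : Measure Ω'}
  [IsProbabilityMeasure P'] {A : {r : ℕ // 0 < lam r} → Ω' → ℝ}

lemma ae_summable_limitTerm (h : IsLocalAlternative N τ P y η Γ γ d) (hk : k - 1 ≠ 0)
    (hφ : IsEigensystem (varpi γ) lam φ)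
    (hA : ∀ r : {r : ℕ // 0 < lam r},
      HasLaw (A r) (noncentralChiSq (k - 1) ((lam r)⁻¹ * deltaSq U d (φ r))) P') :
    ∀ᵐ ω ∂P', Summable fun r => limitTerm lam (fun r => deltaSq U d (φ r)) A r ω :=
  ECF.ae_summable_limitTerm hk (h.eigenvalue_nonneg hφ)
    (fun r => deltaSq_nonneg U d (φ r)) hA
    (((h.hasSum_eigenvalue hφ).summable.mul_left _).add (h.summable_deltaSq U φ))

open Complex in
-- Three approximations are chained: statistic to rotated statistic as ν → ∞, rotated statistic to
-- its truncation uniformly for large ν, and truncation to the partial sums of the limiting series.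
-- The limit of the truncated characteristic function is that of a partial sum, by the product
-- formula for `limitTerm`.
lemma tendsto_integral_exp_testStat (h : IsLocalAlternative N τ P y η Γ γ d) (hk : k - 1 ≠ 0)
    (hU : U ∈ Matrix.orthogonalGroup (Fin k) ℝ)
    (hW : limitW τ = U * diagOneZero k * U.transpose) (hφ : IsEigensystem (varpi γ) lam φ)
    (hind : iIndepFun A P')
    (hA : ∀ r : {r : ℕ // 0 < lam r},
      HasLaw (A r) (noncentralChiSq (k - 1) ((lam r)⁻¹ * deltaSq U d (φ r))) P') (s : ℝ) :
    Tendsto (fun ν => ∫ ω, cexp ((s * testStat (y ν) ω : ℝ) * I) ∂P ν) atTop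
      (𝓝 (∫ ω, cexp ((s * ∑' r, limitTerm lam (fun r => deltaSq U d (φ r)) A r ω : ℝ) * I)
        ∂P')) := by
  obtain ⟨ε, hε, hR⟩ := h.exists_tendsto_integral_abs_sub_truncation hU hφ
  have hlam := h.eigenvalue_nonneg hφ
  have hG := tendsto_integral_exp_sum_limitTerm (P' := P')
    (fun r => (limitTerm_moments hk hlam
      (fun r => deltaSq_nonneg U d (φ r)) hA r).1.1.aemeasurable)
    (h.ae_summable_limitTerm hk hφ hA) s
  have hS : ∀ ν, Integrable (fun ω => ∑ l, ∫ p, rotatedSum U (y ν) η (Γ ν) d l (p, ω) ^ 2) (P ν) :=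
    fun ν => integrable_finsetSum _ fun l _ => h.integrable_integral_rotatedSum_sq ν l
  have hSR : ∀ R ν, Integrable (fun ω => ∑ r ∈ Finset.range R, ∑ l,
      coeff U y η Γ d φ ν l r ω ^ 2) (P ν) := fun R ν =>
    integrable_finsetSum _ fun r _ => integrable_finsetSum _ fun l _ =>
      (h.memLp_coeff ν l r).integrable_sq
  refine tendsto_of_approximation (fun R ν => ?_)
    (by simpa using (h.tendsto_integral_abs_testStat_sub hW).const_mul |s|)
    (fun R => (hR R).const_mul |s|) (by simpa using hε.const_mul |s|) (fun R => ?_) hG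
    (g := fun R ν => ∫ ω, cexp ((s * ∑ r ∈ Finset.range R, ∑ l,
      coeff U y η Γ d φ ν l r ω ^ 2 : ℝ) * I) ∂P ν)
  · exact (norm_sub_le_norm_sub_add_norm_sub _ _ _).trans (add_le_add
      (norm_integral_exp_sub_integral_exp_le (h.integrable_testStat ν) (hS ν) s)
      (norm_integral_exp_sub_integral_exp_le (hS ν) (hSR R ν) s))
  · have e := integral_exp_sum_limitTerm hk hlam
      (m := fun l r => ∫ p, rotatedDev U d l p * φ r p) hind hA R s
    have key := h.tendsto_integral_exp_sum_coeff_sq hU hφ R s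
    rw [← e] at key
    exact key

/-- The limit law of the test statistic under local alternatives. -/
theorem tendstoInDistribution_testStat (h : IsLocalAlternative N τ P y η Γ γ d) (hk : k - 1 ≠ 0)
    (hU : U ∈ Matrix.orthogonalGroup (Fin k) ℝ)
    (hW : limitW τ = U * diagOneZero k * U.transpose) (hφ : IsEigensystem (varpi γ) lam φ)
    (hind : iIndepFun A P')
    (hA : ∀ r : {r : ℕ // 0 < lam r},
      HasLaw (A r) (noncentralChiSq (k - 1) ((lam r)⁻¹ * deltaSq U d (φ r))) P') :
    TendstoInDistribution (fun ν => testStat (y ν)) atTop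
      (fun ω => (∑' r : {r : ℕ // 0 < lam r}, lam r * A r ω) +
        ∑' r : {r : ℕ // lam r = 0}, deltaSq U d (φ r)) P P' := by
  have hlam := h.eigenvalue_nonneg hφ
  have hs := h.ae_summable_limitTerm hk hφ hA
  have hZ : (fun ω => ∑' r, limitTerm lam (fun r => deltaSq U d (φ r)) A r ω) =ᵐ[P']
      fun ω => (∑' r : {r : ℕ // 0 < lam r}, lam r * A r ω) +
        ∑' r : {r : ℕ // lam r = 0}, deltaSq U d (φ r) := by
    filter_upwards [hs] with ω hω
    exact (tsum_limitTerm_eq hlam hω).2.2.symm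
  have hm : ∀ r, AEMeasurable (limitTerm lam (fun r => deltaSq U d (φ r)) A r) P' := fun r =>
    (limitTerm_moments hk hlam (fun r => deltaSq_nonneg U d (φ r)) hA
      r).1.1.aemeasurable
  have hZm : AEMeasurable (fun ω => ∑' r, limitTerm lam (fun r => deltaSq U d (φ r)) A r ω) P' := by
    refine aemeasurable_of_tendsto_metrizable_ae atTop
      (fun R => Finset.aemeasurable_fun_sum (Finset.range R) fun r _ => hm r) ?_
    filter_upwards [hs] with ω hω
    exact hω.hasSum.tendsto_sum_nat
  exact (tendstoInDistribution_of_tendsto_integral_exp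
    (fun ν => (h.integrable_testStat ν).1.aemeasurable) hZm
    (h.tendsto_integral_exp_testStat hk hU hW hφ hind hA)).congr (fun ν => ae_eq_rfl) hZ

end IsLocalAlternative

end ECF

theorem theorem3 {a b : ℝ} (hab : a < b) {k : ℕ}
    -- the sample sizes `n_1, …, n_k` along the asymptotic regime, and their limit proportions
    (N : ℕ → Fin k → ℕ) (hN : ∀ ν i, 2 ≤ N ν i)
    (hn : Tendsto (fun ν => ∑ i, N ν i) atTop atTop)
    (τ : Fin k → ℝ) (hτ : ∀ i, τ i ∈ Set.Ioo (0 : ℝ) 1)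
    (hNτ : ∀ i, Tendsto (fun ν => (N ν i : ℝ) / ∑ i', (N ν i' : ℝ)) atTop (𝓝 (τ i)))
    -- the `k` Gaussian functional samples on `[a, b]`
    {Ω : ℕ → Type*} [∀ ν, MeasurableSpace (Ω ν)] (P : (ν : ℕ) → Measure (Ω ν))
    [∀ ν, IsProbabilityMeasure (P ν)]
    (y : (ν : ℕ) → (i : Fin k) → Fin (N ν i) → Set.Icc a b → Ω ν → ℝ)
    (η : Fin k → Set.Icc a b → ℝ) (hη : ∀ i, MemLp (η i) 2 volume)
    (Γ : ℕ → Fin k → Set.Icc a b → Set.Icc a b → ℝ)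
    (hy : ∀ ν, ECF.IsSample (P ν) (y ν) η (Γ ν))
    (hGauss : ∀ ν i j, IsGaussianProcess (y ν i j) (P ν))
    (hΓ : ∃ C : ℝ, ∀ ν i s t, |Γ ν i s t| ≤ C)
    -- the local alternative
    (γ : Set.Icc a b → Set.Icc a b → ℝ) (hγ : ECF.IsCovFun γ)
    (d : Fin k → Set.Icc a b → Set.Icc a b → ℝ)
    (hH1 : ∀ ν i s t, Γ ν i s t = γ s t + (√((N ν i : ℝ) - 1))⁻¹ * d i s t)
    -- the decomposition of `W` and the eigensystem of `ϖ`
    (U : Matrix (Fin k) (Fin k) ℝ) (hU : U ∈ Matrix.orthogonalGroup (Fin k) ℝ)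
    (hW : ECF.limitW τ = U * ECF.diagOneZero k * U.transpose)
    (lam : ℕ → ℝ) (φ : HilbertBasis ℕ ℝ (Lp ℝ 2 (volume : Measure (Set.Icc a b × Set.Icc a b))))
    (hφ : ECF.IsEigensystem (ECF.varpi γ) lam φ)
    -- the independent noncentral chi-squared variables `A_r`, for the `r` with `λ_r > 0`
    {Ω' : Type*} [MeasurableSpace Ω'] (P' : Measure Ω') [IsProbabilityMeasure P']
    (A : {r : ℕ // 0 < lam r} → Ω' → ℝ) (hAindep : iIndepFun A P')
    (hAlaw : ∀ r : {r : ℕ // 0 < lam r},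
      HasLaw (A r) (ECF.noncentralChiSq (k - 1) ((lam r)⁻¹ * ECF.deltaSq U d (φ r))) P') :
    -- `ϖ` is the limiting covariance function of `√(n - k) (γ̂ - γ)`
    (∀ p q : Set.Icc a b × Set.Icc a b,
      Tendsto (fun ν =>
        cov[fun ω => √((∑ i, (N ν i : ℝ)) - k) * (ECF.pooledCov (y ν) p.1 p.2 ω - γ p.1 p.2),
          fun ω => √((∑ i, (N ν i : ℝ)) - k) * (ECF.pooledCov (y ν) q.1 q.2 ω - γ q.1 q.2);
          P ν]) atTop (𝓝 (ECF.varpi γ p q))) ∧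
    -- all eigenvalues are nonnegative
    (∀ r, 0 ≤ lam r) ∧
    -- both series in `T₁` converge
    (∀ᵐ ω ∂P', Summable fun r : {r : ℕ // 0 < lam r} => lam r * A r ω) ∧
    (Summable fun r : {r : ℕ // lam r = 0} => ECF.deltaSq U d (φ r)) ∧
    -- `T_n` converges in distribution to `T₁`
    TendstoInDistribution (fun ν => ECF.testStat (y ν)) atTop
      (fun ω => (∑' r : {r : ℕ // 0 < lam r}, lam r * A r ω) +
        ∑' r : {r : ℕ // lam r = 0}, ECF.deltaSq U d (φ r)) P P' := by
  have h : ECF.IsLocalAlternative N τ P y η Γ γ d :=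
    ⟨hN, hn, fun i => (hτ i).1, hNτ, hy, hGauss, hΓ, hH1⟩
  have hfin : IsFiniteMeasure (volume : Measure (Set.Icc a b)) := by
    refine ⟨?_⟩
    rw [Measure.Subtype.volume_univ measurableSet_Icc.nullMeasurableSet]
    exact measure_Icc_lt_top
  -- The proportions sum to 1 and each is less than 1, so there are at least two samples; with one
  -- sample the limit law would have no degrees of freedom.
  have hk : k - 1 ≠ 0 := by
    obtain ⟨i⟩ := h.nonempty
    intro hk
    have : Subsingleton (Fin k) := Fin.subsingleton_iff_le_one.2 (by omega)
    have hsum := h.sum_eq_one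
    rw [Fintype.sum_subsingleton _ i] at hsum
    exact (hτ i).2.ne hsum
  refine ⟨h.tendsto_covariance_pooledCov, h.eigenvalue_nonneg hφ, ?_,
    (h.summable_deltaSq U φ).subtype _,
    h.tendstoInDistribution_testStat hk hU hW hφ hAindep hAlaw⟩
  filter_upwards [h.ae_summable_limitTerm hk hφ hAlaw] with ω hω
  exact (ECF.tsum_limitTerm_eq (h.eigenvalue_nonneg hφ) hω).1
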